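/- Let $r \geq 2$ be an integer. The product over all primes $$\prod_p \left(1-\frac1p\right)^{r+1}\left(1+\frac{r+1}{p-1}\right)$$ converges, and there is a real polynomial $\mathcal{P}_r$, depending only on $r$, of degree $r$ and with leading coefficient $$\frac{1}{r!}\prod_p \left(1-\frac1p\right)^{r+1}\left(1+\frac{r+1}{p-1}\right),$$ such that for every $\varepsilon>0$, as the real variable $x\to\infty$, $$\sum_{n_1\leq x,\dotsc,n_r\leq x} \mu(n_1\dotsb n_r)^2\left\lfloor \frac{x}{n_1\dotsb n_r}\right\rfloor = x\,\mathcal{P}_r(\log x) + O_{r,\varepsilon}\!\left(x^{1-\frac{3}{r+7}+\varepsilon}\right),$$ where the sum runs over all $r$-tuples of positive integers $n_i\leq x$ and $\mu$ is the Möbius function. -/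

import Mathlib

/-- The sum over all `r`-tuples `(n₁, …, n_r)` of positive integers `nᵢ ≤ x` of
`μ(n₁ ⋯ n_r)² ⌊x / (n₁ ⋯ n_r)⌋`. -/
noncomputable def moebiusSqFloorSum (r : ℕ) (x : ℝ) : ℤ :=
  ∑ n ∈ Fintype.piFinset (fun _ : Fin r => Finset.Icc 1 ⌊x⌋₊),
    (ArithmeticFunction.moebius (∏ i, n i)) ^ 2 * ⌊x / ((∏ i, n i : ℕ) : ℝ)⌋

/-- The factor at `p` of the Euler product: `(1 - 1/p)^(r+1) (1 + (r+1)/(p-1))`. -/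
noncomputable def eulerFactor (r : ℕ) (p : Nat.Primes) : ℝ :=
  (1 - 1 / (p : ℝ)) ^ (r + 1) * (1 + ((r : ℝ) + 1) / ((p : ℝ) - 1))

/-!
Each `m` has `(r + 1) ^ ω(m)` factorisations `m = n₁ ⋯ n_r k` with `n₁ ⋯ n_r` squarefree, so the sum
in question is `∑_{m ≤ x} (r + 1) ^ ω(m)`. The Dirichlet series of `(r + 1) ^ ω` is
`ζ(s) ^ (r + 1) H(s)`, where `H` converges absolutely for `Re s > 1/2` and `H(1)` is the Euler
product; the pole of order `r + 1` at `1` produces the main term.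

On `Re s = σ > 1/2` the series minus its polar part is `O(|t| ^ ((r + 1)/6))`, by Weyl's bound for
`ζ` (van der Corput's third derivative test, proved through Weyl differencing from the
Kusmin–Landau inequality). As this need not be integrable against `1 / s`, the summatory function is
first integrated `r + 2` times in the variable `log x` and then recovered, thanks to its
monotonicity, from differences of step `δ`. The smoothing costs `O(δ x ^ (1 + ε))` and the contour
integral is `O(δ ^ (-(r + 1)/6) x ^ (1/2 + ε))`; the choice `δ = x ^ (-3/(r + 7))` balances the two.
-/

/-! ### The arithmetic of `k ^ ω(n)` -/

section Arithmetic

open ArithmeticFunction Finset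
open scoped ArithmeticFunction.Moebius ArithmeticFunction.omega ArithmeticFunction.zeta

theorem sum_squarefree_divisors_pow_omega {R : Type*} [CommSemiring R] (a : R) {m : ℕ}
    (hm : m ≠ 0) : ∑ d ∈ m.divisors with Squarefree d, a ^ ω d = (a + 1) ^ ω m := by
  have hω_prod {t : Finset ℕ} (ht : t ∈ m.primeFactors.powerset) : ω t.val.prod = #t := by
    have hprime : ∀ p ∈ t, p.Prime := fun p hp =>
      Nat.prime_of_mem_primeFactors (mem_powerset.1 ht hp)
    rw [show t.val.prod = ∏ p ∈ t, p by simp, cardDistinctFactors_prod fun p hp q hq hpq =>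
        (Nat.coprime_primes (hprime p hp) (hprime q hq)).2 hpq,
      sum_congr rfl fun p hp => cardDistinctFactors_apply_prime (hprime p hp), card_eq_sum_ones]
  have hfactors : (UniqueFactorizationMonoid.normalizedFactors m).toFinset = m.primeFactors := by
    rw [Nat.factors_eq]; rfl
  have hω : ω m = #m.primeFactors := by
    rw [cardDistinctFactors_apply, ← List.card_toFinset]; rfl
  rw [Nat.sum_divisors_filter_squarefree hm, hfactors, hω, ← sum_pow_mul_eq_add_pow a 1]
  exact sum_congr rfl fun t ht => by rw [hω_prod ht, one_pow, mul_one]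

theorem card_tuples_squarefree_dvd (r : ℕ) {m X : ℕ} (hm : m ≠ 0) (hmX : m ≤ X) :
    #{n ∈ Fintype.piFinset (fun _ : Fin r => Finset.Icc 1 X) |
      Squarefree (∏ i, n i) ∧ (∏ i, n i) ∣ m} = (r + 1) ^ ω m := by
  rw [← sum_squarefree_divisors_pow_omega r hm,
    card_eq_sum_card_fiberwise (f := fun n => ∏ i, n i) (t := m.divisors.filter Squarefree)]
  · refine sum_congr rfl fun d hd => ?_
    rw [mem_filter, Nat.mem_divisors] at hd
    rw [← Nat.card_finMulAntidiag_of_squarefree hd.2]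
    congr 1
    ext n
    simp only [mem_filter, Fintype.mem_piFinset, mem_Icc, Nat.mem_finMulAntidiag]
    constructor
    · rintro ⟨-, rfl⟩; exact ⟨rfl, hd.2.ne_zero⟩
    · rintro ⟨rfl, -⟩
      refine ⟨⟨fun i => ?_, hd.2, hd.1.1⟩, rfl⟩
      have hi : n i ∣ m := (dvd_prod_of_mem n (mem_univ i)).trans hd.1.1
      exact ⟨Nat.pos_of_ne_zero (ne_zero_of_dvd_ne_zero hm hi),
        (Nat.le_of_dvd (Nat.pos_of_ne_zero hm) hi).trans hmX⟩
  · intro n hn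
    simp only [coe_filter, Fintype.mem_piFinset, Set.mem_ofPred_eq, Nat.mem_divisors] at hn ⊢
    exact ⟨⟨hn.2.2, hm⟩, hn.2.1⟩

/-- The arithmetic function `n ↦ k ^ ω(n)`, which counts the `n = n₁ ⋯ n_k` with pairwise coprime
factors; its value at `0` is `0`. -/
noncomputable def omegaPow (k : ℕ) : ArithmeticFunction ℤ :=
  ⟨fun n => if n = 0 then 0 else (k : ℤ) ^ ω n, by simp⟩

theorem omegaPow_apply {k n : ℕ} (hn : n ≠ 0) : omegaPow k n = (k : ℤ) ^ ω n := by
  simp [omegaPow, hn]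

theorem omegaPow_nonneg (k n : ℕ) : 0 ≤ omegaPow k n := by
  rcases eq_or_ne n 0 with rfl | hn
  · simp
  · rw [omegaPow_apply hn]; positivity

theorem isMultiplicative_omegaPow (k : ℕ) : (omegaPow k).IsMultiplicative := by
  refine IsMultiplicative.iff_ne_zero.2 ⟨by simp [omegaPow_apply], fun {m n} hm hn h => ?_⟩
  rw [omegaPow_apply hm, omegaPow_apply hn, omegaPow_apply (mul_ne_zero hm hn),
    cardDistinctFactors_mul h, pow_add]

theorem omegaPow_prime_pow_succ (k : ℕ) {p : ℕ} (hp : p.Prime) (j : ℕ) :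
    omegaPow k (p ^ (j + 1)) = k := by
  rw [omegaPow_apply (pow_ne_zero _ hp.ne_zero),
    cardDistinctFactors_apply_prime_pow hp j.succ_ne_zero, pow_one]

theorem moebiusSqFloorSum_eq_sum_omegaPow (r : ℕ) {x : ℝ} (hx : 0 ≤ x) :
    moebiusSqFloorSum r x = ∑ m ∈ Finset.Icc 1 ⌊x⌋₊, omegaPow (r + 1) m := by
  have hcount : ∀ m ∈ Finset.Icc 1 ⌊x⌋₊, omegaPow (r + 1) m =
      ∑ n ∈ Fintype.piFinset (fun _ : Fin r => Finset.Icc 1 ⌊x⌋₊),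
        (if Squarefree (∏ i, n i) ∧ (∏ i, n i) ∣ m then (1 : ℤ) else 0) := by
    intro m hm
    rw [mem_Icc] at hm
    have hm0 : m ≠ 0 := by lia
    rw [omegaPow_apply hm0, ← sum_filter, sum_const, card_tuples_squarefree_dvd r hm0 hm.2]
    simp
  rw [sum_congr rfl hcount, sum_comm, moebiusSqFloorSum]
  refine sum_congr rfl fun n _ => ?_
  rw [moebius_sq]
  by_cases hsq : Squarefree (∏ i, n i)
  · simp only [hsq, true_and, if_true, one_mul]
    rw [← sum_filter, sum_const, nsmul_eq_mul, mul_one, show Icc 1 ⌊x⌋₊ = Ioc 0 ⌊x⌋₊ from rfl,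
      Nat.Ioc_filter_dvd_card_eq_div, ← Nat.floor_div_natCast,
      Int.natCast_floor_eq_floor (by positivity)]
  · simp [hsq]

/-- The Bell series of `f` at `p`: the generating series of the values of an arithmetic function at
the powers of `p`. Bell series turn Dirichlet convolutions into products. -/
noncomputable def bellSeries {R : Type*} [Zero R] (p : ℕ) (f : ArithmeticFunction R) :
    PowerSeries R :=
  PowerSeries.mk fun j => f (p ^ j)

theorem bellSeries_mul {R : Type*} [Semiring R] {p : ℕ} (hp : p.Prime)
    (f g : ArithmeticFunction R) : bellSeries p (f * g) = bellSeries p f * bellSeries p g := by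
  ext n
  rw [PowerSeries.coeff_mul]
  simp only [bellSeries, PowerSeries.coeff_mk, mul_apply]
  rw [Nat.sum_divisorsAntidiagonal (fun a b => f a * g b), Nat.sum_divisors_prime_pow hp,
    Finset.Nat.sum_antidiagonal_eq_sum_range_succ (fun a b => f (p ^ a) * g (p ^ b))]
  refine sum_congr rfl fun i hi => ?_
  rw [Nat.pow_div (by simpa [Nat.lt_succ_iff] using hi) hp.pos]

theorem bellSeries_pow {R : Type*} [Semiring R] {p : ℕ} (hp : p.Prime)
    (f : ArithmeticFunction R) (n : ℕ) : bellSeries p (f ^ n) = bellSeries p f ^ n := by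
  induction n with
  | zero =>
    ext j
    rcases j with _ | j
    · simp [bellSeries]
    · simp [bellSeries, one_apply, PowerSeries.coeff_one, hp.ne_one]
  | succ n ih => rw [pow_succ, bellSeries_mul hp, ih, pow_succ]

theorem bellSeries_moebius {p : ℕ} (hp : p.Prime) : bellSeries p μ = 1 - PowerSeries.X := by
  ext j
  rcases j with _ | _ | j
  · simp [bellSeries]
  · simp [bellSeries, PowerSeries.coeff_one, moebius_apply_prime hp]
  · simp [bellSeries, PowerSeries.coeff_one, PowerSeries.coeff_X,
      moebius_apply_prime_pow hp (Nat.succ_ne_zero _)]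

theorem bellSeries_omegaPow_mul {p : ℕ} (hp : p.Prime) (k : ℕ) :
    bellSeries p (omegaPow k) * (1 - PowerSeries.X) =
      1 + PowerSeries.C ((k : ℤ) - 1) * PowerSeries.X := by
  ext j
  rw [mul_sub, mul_one, map_sub]
  rcases j with _ | _ | j
  · simp [bellSeries, (isMultiplicative_omegaPow k).1]
  · simpa [bellSeries, PowerSeries.coeff_one, PowerSeries.coeff_succ_mul_X,
      (isMultiplicative_omegaPow k).1] using omegaPow_prime_pow_succ k hp 0
  · simp only [bellSeries, PowerSeries.coeff_succ_mul_X, PowerSeries.coeff_mk,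
      omegaPow_prime_pow_succ k hp]
    rw [map_add, PowerSeries.coeff_succ_mul_X, PowerSeries.coeff_one, PowerSeries.coeff_C]
    simp

/-- The polynomial `(1 + r X) (1 - X) ^ r`, the Bell series of `omegaCofactor r` at every prime;
its value at `1 / p` is the Euler factor at `p`. -/
noncomputable def cofactorPoly (r : ℕ) : Polynomial ℤ :=
  (1 + Polynomial.C (r : ℤ) * Polynomial.X) * (1 - Polynomial.X) ^ r

/-- The Dirichlet quotient of `n ↦ (r + 1) ^ ω(n)` by the `(r + 1)`-fold divisor function. -/
noncomputable def omegaCofactor (r : ℕ) : ArithmeticFunction ℤ := omegaPow (r + 1) * μ ^ (r + 1)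

theorem isMultiplicative_omegaCofactor (r : ℕ) : (omegaCofactor r).IsMultiplicative :=
  (isMultiplicative_omegaPow _).mul isMultiplicative_moebius.pow

theorem zeta_pow_mul_omegaCofactor (r : ℕ) :
    (ζ : ArithmeticFunction ℤ) ^ (r + 1) * omegaCofactor r = omegaPow (r + 1) := by
  rw [omegaCofactor, mul_left_comm, ← mul_pow, coe_zeta_mul_moebius, one_pow, mul_one]

theorem omegaCofactor_prime_pow (r : ℕ) {p : ℕ} (hp : p.Prime) (j : ℕ) :
    omegaCofactor r (p ^ j) = (cofactorPoly r).coeff j := by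
  have hbell : bellSeries p (omegaCofactor r) = (cofactorPoly r : PowerSeries ℤ) := by
    rw [omegaCofactor, bellSeries_mul hp, bellSeries_pow hp, bellSeries_moebius hp, pow_succ',
      ← mul_assoc, bellSeries_omegaPow_mul hp, cofactorPoly]
    push_cast
    simp
  simpa [bellSeries] using congrArg (PowerSeries.coeff j) hbell

theorem cofactorPoly_coeff_zero (r : ℕ) : (cofactorPoly r).coeff 0 = 1 := by
  simp [cofactorPoly, Polynomial.coeff_zero_eq_eval_zero]

theorem cofactorPoly_coeff_one (r : ℕ) : (cofactorPoly r).coeff 1 = 0 := by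
  have hderiv : Polynomial.eval 0 (Polynomial.derivative (cofactorPoly r)) = 0 := by
    simp [cofactorPoly, Polynomial.derivative_mul, Polynomial.derivative_pow]
  rw [← Polynomial.coeff_zero_eq_eval_zero, Polynomial.coeff_derivative] at hderiv
  simpa using hderiv

theorem aeval_inv_prime_cofactorPoly (r : ℕ) (p : Nat.Primes) :
    Polynomial.aeval ((p : ℝ)⁻¹) (cofactorPoly r) = eulerFactor r p := by
  have hp : (1 : ℝ) < p := by exact_mod_cast p.2.one_lt
  have hp1 : (p : ℝ) - 1 ≠ 0 := by linarith
  have hp0 : (p : ℝ) ≠ 0 := by linarith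
  simp only [cofactorPoly, eulerFactor, map_mul, map_add, map_one, map_pow, map_sub,
    Polynomial.aeval_C, Polynomial.aeval_X, one_div, pow_succ]
  simp only [eq_intCast, Int.cast_natCast]
  field_simp
  ring

/-- A nonnegative multiplicative function is summable as soon as its Euler factors exceed `1` by
a summable amount. -/
theorem summable_of_multiplicative_of_tsum_prime_pow_le {f : ℕ → ℝ} (hf0 : ∀ n, 0 ≤ f n)
    (hz : f 0 = 0) (h1 : f 1 = 1) (hmul : ∀ {m n : ℕ}, m.Coprime n → f (m * n) = f m * f n)
    (hs : ∀ {p : ℕ}, p.Prime → Summable fun e => f (p ^ e)) {b : ℕ → ℝ} (hb : Summable b)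
    (hb0 : ∀ n, 0 ≤ b n) (hle : ∀ {p : ℕ}, p.Prime → ∑' e, f (p ^ e) ≤ 1 + b p) :
    Summable f := by
  refine summable_of_sum_range_le (c := Real.exp (∑' n, b n)) hf0 fun N => ?_
  obtain ⟨-, hsmooth⟩ := EulerProduct.summable_and_hasSum_smoothNumbers_prod_primesBelow_tsum
    (f := f) h1 hmul (fun hp => by simpa [abs_of_nonneg, hf0] using hs hp) N
  have hrange : ∑ n ∈ range N, f n ≤ ∏ p ∈ N.primesBelow, ∑' e, f (p ^ e) := by
    have hmem : ∀ n ∈ (range N).filter (fun n => n ≠ 0), n ∈ N.smoothNumbers := fun n hn => by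
      rw [mem_filter, mem_range] at hn
      exact Nat.mem_smoothNumbers_of_lt (Nat.pos_of_ne_zero hn.2) hn.1
    rw [← hsmooth.tsum_eq, ← sum_filter_of_ne (p := fun n => n ≠ 0)
      (fun n _ hn h0 => hn (h0 ▸ hz)), ← sum_subtype_of_mem f hmem]
    exact hsmooth.summable.sum_le_tsum _ fun _ _ => hf0 _
  calc ∑ n ∈ range N, f n ≤ ∏ p ∈ N.primesBelow, ∑' e, f (p ^ e) := hrange
    _ ≤ ∏ p ∈ N.primesBelow, Real.exp (b p) := by
        refine prod_le_prod (fun p _ => tsum_nonneg fun e => hf0 _) fun p hp => ?_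
        linarith [hle (Nat.prime_of_mem_primesBelow hp), Real.add_one_le_exp (b p)]
    _ = Real.exp (∑ p ∈ N.primesBelow, b p) := (Real.exp_sum _ _).symm
    _ ≤ _ := Real.exp_le_exp.2 (hb.sum_le_tsum _ fun _ _ => hb0 _)

theorem sum_abs_coeff_mul_pow_le {P : Polynomial ℤ} (h1 : P.coeff 1 = 0) {x : ℝ} (hx0 : 0 ≤ x)
    (hx1 : x ≤ 1) :
    ∑ e ∈ P.support.erase 0, |(P.coeff e : ℝ)| * x ^ e ≤
      (∑ e ∈ P.support, |(P.coeff e : ℝ)|) * x ^ 2 := by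
  calc ∑ e ∈ P.support.erase 0, |(P.coeff e : ℝ)| * x ^ e
      ≤ ∑ e ∈ P.support.erase 0, |(P.coeff e : ℝ)| * x ^ 2 := by
        refine sum_le_sum fun e he => ?_
        rcases e with _ | _ | e
        · simp at he
        · simp [h1]
        · exact mul_le_mul_of_nonneg_left (pow_le_pow_of_le_one hx0 hx1 (by lia)) (abs_nonneg _)
    _ ≤ _ := by
        rw [← sum_mul]
        exact mul_le_mul_of_nonneg_right (sum_le_sum_of_subset_of_nonneg (erase_subset _ _)
          fun _ _ _ => abs_nonneg _) (by positivity)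

theorem hasSum_abs_omegaCofactor_prime_pow (r : ℕ) {p : ℕ} (hp : p.Prime) (σ : ℝ) :
    HasSum (fun e => |(omegaCofactor r (p ^ e) : ℝ)| * ((p ^ e : ℕ) : ℝ) ^ (-σ))
      (∑ e ∈ (cofactorPoly r).support,
        |((cofactorPoly r).coeff e : ℝ)| * ((p : ℝ) ^ (-σ)) ^ e) := by
  have hval : ∀ e, |(omegaCofactor r (p ^ e) : ℝ)| * ((p ^ e : ℕ) : ℝ) ^ (-σ) =
      |((cofactorPoly r).coeff e : ℝ)| * ((p : ℝ) ^ (-σ)) ^ e := fun e => by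
    rw [omegaCofactor_prime_pow r hp, Nat.cast_pow, ← Real.rpow_natCast, ← Real.rpow_natCast,
      ← Real.rpow_mul (by positivity), ← Real.rpow_mul (by positivity), mul_comm (e : ℝ)]
  simp_rw [hval]
  refine hasSum_sum_of_ne_finset_zero fun e he => ?_
  rw [Polynomial.notMem_support_iff.1 he, Int.cast_zero, abs_zero, zero_mul]

theorem summable_abs_omegaCofactor_mul_rpow (r : ℕ) {σ : ℝ} (hσ : 1 / 2 < σ) :
    Summable fun n : ℕ => |(omegaCofactor r n : ℝ)| * (n : ℝ) ^ (-σ) := by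
  set B : ℝ := ∑ e ∈ (cofactorPoly r).support, |((cofactorPoly r).coeff e : ℝ)|
  refine summable_of_multiplicative_of_tsum_prime_pow_le
    (b := fun n => B * (n : ℝ) ^ (-(2 * σ))) (fun n => by positivity) (by simp)
    (by simp [(isMultiplicative_omegaCofactor r).1]) (fun {m n} hmn => ?_)
    (fun hp => (hasSum_abs_omegaCofactor_prime_pow r hp σ).summable)
    ((Real.summable_nat_rpow.2 (by linarith)).mul_left B)
    (fun n => by positivity) (fun {p} hp => ?_)
  · rw [(isMultiplicative_omegaCofactor r).2 hmn]
    push_cast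
    rw [abs_mul, Real.mul_rpow (by positivity) (by positivity)]
    ring
  · have hp1 : (1 : ℝ) ≤ p := by exact_mod_cast hp.one_lt.le
    have hmem : 0 ∈ (cofactorPoly r).support := by
      rw [Polynomial.mem_support_iff, cofactorPoly_coeff_zero]; exact one_ne_zero
    have hsq : (p : ℝ) ^ (-(2 * σ)) = ((p : ℝ) ^ (-σ)) ^ 2 := by
      rw [← Real.rpow_natCast, ← Real.rpow_mul (by positivity)]; congr 1; push_cast; ring
    rw [(hasSum_abs_omegaCofactor_prime_pow r hp σ).tsum_eq, ← add_sum_erase _ _ hmem,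
      cofactorPoly_coeff_zero, Int.cast_one, abs_one, pow_zero, mul_one, hsq]
    gcongr
    exact sum_abs_coeff_mul_pow_le (cofactorPoly_coeff_one r) (by positivity)
      (Real.rpow_le_one_of_one_le_of_nonpos hp1 (by linarith))

end Arithmetic

section EulerProduct

open Finset

theorem eulerFactor_eq_tsum (r : ℕ) (p : Nat.Primes) :
    eulerFactor r p = ∑' e, (omegaCofactor r ((p : ℕ) ^ e) : ℝ) * (((p : ℕ) ^ e : ℕ) : ℝ)⁻¹ := by
  rw [← aeval_inv_prime_cofactorPoly, Polynomial.aeval_eq_sum_range' (Nat.lt_succ_self _),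
    tsum_eq_sum (s := range ((cofactorPoly r).natDegree + 1))]
  · refine sum_congr rfl fun e _ => ?_
    rw [omegaCofactor_prime_pow r p.2]
    simp
  · intro e he
    rw [omegaCofactor_prime_pow r p.2, Polynomial.coeff_eq_zero_of_natDegree_lt
      (by simpa [Nat.lt_succ_iff] using he), Int.cast_zero, zero_mul]

theorem hasProd_eulerFactor (r : ℕ) :
    HasProd (eulerFactor r) (∑' n : ℕ, (omegaCofactor r n : ℝ) * (n : ℝ)⁻¹) := by
  have hs := summable_abs_omegaCofactor_mul_rpow r (σ := 1) (by norm_num)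
  rw [funext (eulerFactor_eq_tsum r)]
  exact EulerProduct.eulerProduct_hasProd (f := fun n : ℕ => (omegaCofactor r n : ℝ) * (n : ℝ)⁻¹)
    (by simp [(isMultiplicative_omegaCofactor r).1])
    (fun {m n} hmn => by
      rw [(isMultiplicative_omegaCofactor r).2 hmn]; push_cast; rw [mul_inv]; ring)
    (by simpa [Real.rpow_neg_one, abs_mul] using hs) (by simp)

theorem eulerFactor_pos (r : ℕ) (p : Nat.Primes) : 0 < eulerFactor r p := by
  have hp : (1 : ℝ) < p := by exact_mod_cast p.2.one_lt
  have hinv : 0 < 1 - 1 / (p : ℝ) := sub_pos.2 ((div_lt_one (by linarith)).2 hp)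
  exact mul_pos (pow_pos hinv _)
    (add_pos one_pos (div_pos (by positivity) (sub_pos.2 hp)))

theorem abs_eulerFactor_sub_one_le (r : ℕ) (p : Nat.Primes) :
    |eulerFactor r p - 1| ≤
      (∑ e ∈ (cofactorPoly r).support, |((cofactorPoly r).coeff e : ℝ)|) * ((p : ℝ)⁻¹) ^ 2 := by
  have hp : (1 : ℝ) ≤ p := by exact_mod_cast p.2.one_lt.le
  have hmem : 0 ∈ (cofactorPoly r).support := by
    rw [Polynomial.mem_support_iff, cofactorPoly_coeff_zero]; exact one_ne_zero
  have heval : eulerFactor r p - 1 =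
      ∑ e ∈ (cofactorPoly r).support.erase 0, ((cofactorPoly r).coeff e : ℝ) * ((p : ℝ)⁻¹) ^ e := by
    rw [← aeval_inv_prime_cofactorPoly, Polynomial.aeval_def, Polynomial.eval₂_eq_sum,
      Polynomial.sum, ← add_sum_erase _ _ hmem, cofactorPoly_coeff_zero]
    simp
  rw [heval]
  refine (abs_sum_le_sum_abs _ _).trans (le_trans (le_of_eq ?_)
    (sum_abs_coeff_mul_pow_le (cofactorPoly_coeff_one r) (by positivity)
      (inv_le_one_of_one_le₀ hp)))
  exact sum_congr rfl fun e _ => by rw [abs_mul, abs_of_nonneg (by positivity : 0 ≤ (p : ℝ)⁻¹ ^ e)]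

theorem tprod_eulerFactor_ne_zero (r : ℕ) : ∏' p : Nat.Primes, eulerFactor r p ≠ 0 := by
  have hsq : Summable fun p : Nat.Primes => ((p : ℝ)⁻¹) ^ 2 := by
    simp only [inv_pow]
    exact ((Real.summable_nat_pow_inv (p := 2)).2 one_lt_two).comp_injective Subtype.val_injective
  have hlog := Real.summable_log_one_add_of_summable
    ((hsq.mul_left _).of_norm_bounded (abs_eulerFactor_sub_one_le r))
  simp only [add_sub_cancel] at hlog
  rw [← Real.rexp_tsum_eq_tprod (eulerFactor_pos r) hlog]
  exact (Real.exp_pos _).ne'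

end EulerProduct

section DirichletSeries

open ArithmeticFunction
open scoped ArithmeticFunction.zeta

theorem LSeriesSummable_omegaCofactor (r : ℕ) {s : ℂ} (hs : 1 / 2 < s.re) :
    LSeriesSummable (fun n => (omegaCofactor r n : ℂ)) s := by
  refine Summable.of_norm ((summable_abs_omegaCofactor_mul_rpow r hs).congr fun n => ?_)
  rw [LSeries.norm_term_eq]
  rcases eq_or_ne n 0 with rfl | hn
  · simp
  · rw [if_neg hn, Real.rpow_neg (by positivity), div_eq_mul_inv, Complex.norm_intCast]

/-- The Dirichlet series of `omegaCofactor r`, the factor `H(s)` of `ζ(s) ^ (r + 1) H(s)`. -/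
noncomputable def cofactorSeries (r : ℕ) (s : ℂ) : ℂ :=
  LSeries (fun n => (omegaCofactor r n : ℂ)) s

theorem differentiableOn_cofactorSeries (r : ℕ) :
    DifferentiableOn ℂ (cofactorSeries r) {s | 1 / 2 < s.re} := by
  have habscissa : LSeries.abscissaOfAbsConv (fun n => (omegaCofactor r n : ℂ)) ≤
      ((1 / 2 : ℝ) : EReal) :=
    LSeries.abscissaOfAbsConv_le_of_forall_lt_LSeriesSummable fun y hy =>
      LSeriesSummable_omegaCofactor r (by simpa using hy)
  intro s hs
  refine (LSeries_hasDerivAt (habscissa.trans_lt ?_)).differentiableAt.differentiableWithinAt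
  exact_mod_cast hs

theorem cofactorSeries_one (r : ℕ) :
    cofactorSeries r 1 = ((∏' p : Nat.Primes, eulerFactor r p : ℝ) : ℂ) := by
  rw [(hasProd_eulerFactor r).tprod_eq, Complex.ofReal_tsum, cofactorSeries, LSeries]
  refine tsum_congr fun n => ?_
  rcases eq_or_ne n 0 with rfl | hn
  · simp
  · simp [LSeries.term_of_ne_zero hn, div_eq_mul_inv]

theorem exists_norm_cofactorSeries_le (r : ℕ) {σ : ℝ} (hσ : 1 / 2 < σ) :
    ∃ C : ℝ, 0 ≤ C ∧ ∀ s : ℂ, σ ≤ s.re → ‖cofactorSeries r s‖ ≤ C := by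
  have hsum := (LSeriesSummable_omegaCofactor r (s := σ) (by simpa using hσ)).norm
  refine ⟨∑' n, ‖LSeries.term (fun n => (omegaCofactor r n : ℂ)) σ n‖,
    tsum_nonneg fun n => norm_nonneg _, fun s hs => ?_⟩
  exact tsum_of_norm_bounded hsum.hasSum fun n =>
    LSeries.norm_term_le_of_re_le_re _ (by simpa using hs) n

theorem LSeriesHasSum_arithmeticFunction_one (s : ℂ) :
    LSeriesHasSum (fun n => (1 : ArithmeticFunction ℂ) n) s 1 := by
  rw [one_eq_delta, LSeriesHasSum, funext (LSeries.term_delta s)]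
  exact hasSum_ite_eq 1 1

theorem LSeriesHasSum_pow {f : ArithmeticFunction ℂ} {s a : ℂ}
    (hf : LSeriesHasSum (fun n => f n) s a) (k : ℕ) :
    LSeriesHasSum (fun n => (f ^ k) n) s (a ^ k) := by
  induction k with
  | zero => simpa only [pow_zero] using LSeriesHasSum_arithmeticFunction_one s
  | succ k ih => simpa only [pow_succ] using LSeriesHasSum_mul ih hf

theorem LSeriesHasSum_omegaPow (r : ℕ) {s : ℂ} (hs : 1 < s.re) :
    LSeriesHasSum (fun n => (omegaPow (r + 1) n : ℂ)) s
      (riemannZeta s ^ (r + 1) * cofactorSeries r s) := by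
  have hzeta : LSeriesHasSum (fun n => ((ζ : ArithmeticFunction ℂ) n)) s (riemannZeta s) := by
    simpa using LSeriesHasSum_zeta hs
  have hcofactor : LSeriesHasSum (fun n => (omegaCofactor r : ArithmeticFunction ℂ) n) s
      (cofactorSeries r s) := by
    have h : LSeriesHasSum (fun n => (omegaCofactor r n : ℂ)) s (cofactorSeries r s) :=
      (LSeriesSummable_omegaCofactor r (by linarith)).LSeriesHasSum
    simpa using h
  have hconv : (ζ : ArithmeticFunction ℂ) ^ (r + 1) * (omegaCofactor r : ArithmeticFunction ℂ) =
      (omegaPow (r + 1) : ArithmeticFunction ℂ) := by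
    have hpow (k : ℕ) : (((ζ : ArithmeticFunction ℤ) ^ k : ArithmeticFunction ℤ) :
        ArithmeticFunction ℂ) = (ζ : ArithmeticFunction ℂ) ^ k := by
      induction k with
      | zero => simp
      | succ k ih => rw [pow_succ, pow_succ, intCoe_mul, ih, coe_coe]
    rw [← zeta_pow_mul_omegaCofactor, intCoe_mul, hpow]
  simpa [hconv] using LSeriesHasSum_mul (LSeriesHasSum_pow hzeta (r + 1)) hcofactor

end DirichletSeries

/-! ### Exponential sums -/

section KusminLandau

open Finset Real
open scoped FourierTransform

theorem fourierChar_intCast (m : ℤ) : 𝐞 (m : ℝ) = 1 := by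
  refine Circle.ext ?_
  rw [fourierChar_apply, Circle.coe_one, ← Complex.exp_int_mul_two_pi_mul_I m]
  congr 1; push_cast; ring

theorem norm_fourierChar_sub_one (δ : ℝ) : ‖(𝐞 δ : ℂ) - 1‖ = 2 * |sin (π * δ)| := by
  rw [fourierChar_apply, mul_comm, Complex.norm_exp_I_mul_ofReal_sub_one, norm_mul,
    Real.norm_ofNat, Real.norm_eq_abs]
  congr 3; ring

theorem inv_fourierChar_sub_one {δ : ℝ} (h : sin (π * δ) ≠ 0) :
    ((𝐞 δ : ℂ) - 1)⁻¹ = -(1 / 2) - Complex.I / 2 * (cot (π * δ) : ℂ) := by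
  have hexp : (𝐞 δ : ℂ) = (cos (π * δ) + sin (π * δ) * Complex.I) ^ 2 := by
    rw [Complex.ofReal_cos, Complex.ofReal_sin, ← Complex.exp_mul_I, fourierChar_apply,
      ← Complex.exp_nat_mul]
    congr 1; push_cast; ring
  have hsq : (sin (π * δ) : ℂ) ^ 2 + (cos (π * δ) : ℂ) ^ 2 = 1 := by
    exact_mod_cast sin_sq_add_cos_sq (π * δ)
  have hsin : (sin (π * δ) : ℂ) ≠ 0 := by exact_mod_cast h
  refine inv_eq_of_mul_eq_one_right ?_
  rw [hexp, cot_eq_cos_div_sin, Complex.ofReal_div]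
  generalize (cos (π * δ) : ℂ) = c at *
  generalize (sin (π * δ) : ℂ) = s at *
  field_simp
  linear_combination (s - c * Complex.I) * hsq +
    (-s ^ 3 - 2 * c ^ 2 * s - c * s ^ 2 * Complex.I) * Complex.I_sq

theorem two_mul_le_sin_pi_mul {θ δ : ℝ} (hθ : 0 ≤ θ) (h1 : θ ≤ δ) (h2 : δ ≤ 1 - θ) :
    2 * θ ≤ sin (π * δ) := by
  have jordan {u : ℝ} (hu0 : 0 ≤ u) (hu : u ≤ 1 / 2) : 2 * u ≤ sin (π * u) := by
    have h := mul_le_sin (x := π * u) (by positivity) (by nlinarith [pi_pos])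
    rwa [show 2 / π * (π * u) = 2 * u by field_simp] at h
  rcases le_total δ (1 / 2) with h | h
  · linarith [jordan (hθ.trans h1) h]
  · have h3 := jordan (u := 1 - δ) (by linarith) (by linarith)
    rw [show π * (1 - δ) = π - π * δ by ring, sin_pi_sub] at h3
    linarith

theorem cot_le_cot {a b : ℝ} (hab : a ≤ b) (hb : b - a ≤ π) (ha : 0 < sin a) (hb' : 0 < sin b) :
    cot b ≤ cot a := by
  rw [cot_eq_cos_div_sin, cot_eq_cos_div_sin, div_le_div_iff₀ hb' ha]
  have h := sin_nonneg_of_nonneg_of_le_pi (sub_nonneg.2 hab) hb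
  rw [sin_sub] at h
  linarith

/-- Partial summation for a sequence which is a multiple of its own differences. -/
theorem norm_sum_le_of_eq_mul_sub {w c : ℕ → ℂ} {N : ℕ} (hw : ∀ n ≤ N + 1, ‖w n‖ ≤ 1)
    (h : ∀ n ≤ N, w n = c n * (w (n + 1) - w n)) :
    ‖∑ n ∈ range (N + 1), w n‖ ≤ ‖c 0‖ + ‖c N‖ + ∑ n ∈ range N, ‖c n - c (n + 1)‖ := by
  have habel : ∀ k ≤ N, ∑ n ∈ range (k + 1), w n =
      c k * w (k + 1) - c 0 * w 0 + ∑ n ∈ range k, (c n - c (n + 1)) * w (n + 1) := by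
    intro k
    induction k with
    | zero => intro hk; simpa [mul_sub] using h 0 hk
    | succ k ih =>
      intro hk
      rw [sum_range_succ, ih (by lia), sum_range_succ _ k]
      linear_combination h (k + 1) hk
  have hmul {n : ℕ} (a : ℂ) (hn : n ≤ N + 1) : ‖a * w n‖ ≤ ‖a‖ := by
    rw [norm_mul]; exact mul_le_of_le_one_right (norm_nonneg _) (hw n hn)
  rw [habel N le_rfl]
  calc _ ≤ ‖c N * w (N + 1) - c 0 * w 0‖ + ‖∑ n ∈ range N, (c n - c (n + 1)) * w (n + 1)‖ :=
        norm_add_le _ _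
    _ ≤ ‖c N * w (N + 1)‖ + ‖c 0 * w 0‖ + ∑ n ∈ range N, ‖(c n - c (n + 1)) * w (n + 1)‖ :=
        add_le_add (norm_sub_le _ _) (norm_sum_le _ _)
    _ ≤ ‖c N‖ + ‖c 0‖ + ∑ n ∈ range N, ‖c n - c (n + 1)‖ :=
        add_le_add (add_le_add (hmul _ le_rfl) (hmul _ (Nat.zero_le _))) <|
          sum_le_sum fun n hn => hmul _ (by rw [mem_range] at hn; lia)
    _ = _ := by ring

theorem sin_pi_mul_pos {δ : ℝ} (h0 : 0 < δ) (h1 : δ < 1) : 0 < sin (π * δ) :=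
  sin_pos_of_pos_of_lt_pi (by positivity) (mul_lt_of_lt_one_right pi_pos h1)

theorem fourierChar_ne_one_of_mem_Ioo {δ : ℝ} (h0 : 0 < δ) (h1 : δ < 1) : (𝐞 δ : ℂ) - 1 ≠ 0 := by
  rw [← norm_ne_zero_iff, norm_fourierChar_sub_one]
  exact mul_ne_zero two_ne_zero (abs_ne_zero.2 (sin_pi_mul_pos h0 h1).ne')

theorem norm_inv_fourierChar_sub_one_le {θ δ : ℝ} (hθ : 0 < θ) (h1 : θ ≤ δ) (h2 : δ ≤ 1 - θ) :
    ‖((𝐞 δ : ℂ) - 1)⁻¹‖ ≤ 1 / (4 * θ) := by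
  rw [norm_inv, norm_fourierChar_sub_one, ← one_div]
  exact one_div_le_one_div_of_le (by positivity)
    (by linarith [two_mul_le_sin_pi_mul hθ.le h1 h2, le_abs_self (sin (π * δ))])

theorem abs_cot_pi_mul_le {θ δ : ℝ} (hθ : 0 < θ) (h1 : θ ≤ δ) (h2 : δ ≤ 1 - θ) :
    |cot (π * δ)| ≤ 1 / (2 * θ) := by
  rw [cot_eq_cos_div_sin, abs_div]
  exact div_le_div₀ zero_le_one (abs_cos_le_one _) (by positivity)
    ((two_mul_le_sin_pi_mul hθ.le h1 h2).trans (le_abs_self _))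

theorem norm_inv_fourierChar_sub_one_sub {a b : ℝ} (ha : 0 < a) (hab : a ≤ b) (hb : b < 1) :
    ‖((𝐞 a : ℂ) - 1)⁻¹ - ((𝐞 b : ℂ) - 1)⁻¹‖ = (cot (π * a) - cot (π * b)) / 2 := by
  have hsina := sin_pi_mul_pos ha (hab.trans_lt hb)
  have hsinb := sin_pi_mul_pos (ha.trans_le hab) hb
  have hcot : cot (π * b) ≤ cot (π * a) :=
    cot_le_cot (by gcongr) (by nlinarith [pi_pos]) hsina hsinb
  have hdiff : ((𝐞 a : ℂ) - 1)⁻¹ - ((𝐞 b : ℂ) - 1)⁻¹ =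
      -(Complex.I / 2 * ((cot (π * a) - cot (π * b) : ℝ) : ℂ)) := by
    rw [inv_fourierChar_sub_one hsina.ne', inv_fourierChar_sub_one hsinb.ne']
    push_cast; ring
  rw [hdiff, norm_neg, norm_mul, Complex.norm_real, Real.norm_of_nonneg (sub_nonneg.2 hcot),
    norm_div, Complex.norm_I, Complex.norm_ofNat]
  ring

/-- The Kusmin–Landau inequality. -/
theorem norm_sum_fourierChar_le_of_diff_mem {x : ℕ → ℝ} {N : ℕ} {θ : ℝ} (hθ : 0 < θ)
    (h : ∀ n < N, θ ≤ x (n + 1) - x n ∧ x (n + 1) - x n ≤ 1 - θ)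
    (hmono : ∀ n, n + 1 < N → x (n + 1) - x n ≤ x (n + 2) - x (n + 1)) :
    ‖∑ n ∈ range N, (𝐞 (x n) : ℂ)‖ ≤ 1 / θ := by
  rcases N with _ | N
  · simp only [range_zero, sum_empty, norm_zero]; positivity
  set c : ℕ → ℂ := fun n => ((𝐞 (x (n + 1) - x n) : ℂ) - 1)⁻¹
  set κ : ℕ → ℝ := fun n => cot (π * (x (n + 1) - x n))
  have hmul_sub : ∀ n ≤ N, (𝐞 (x n) : ℂ) = c n * (𝐞 (x (n + 1)) - 𝐞 (x n)) := fun n hn => by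
    have hadd : (𝐞 (x (n + 1)) : ℂ) = 𝐞 (x (n + 1) - x n) * 𝐞 (x n) := by
      rw [← Circle.coe_mul, ← AddChar.map_add_eq_mul, sub_add_cancel]
    have hn' := h n (by lia)
    have hne := fourierChar_ne_one_of_mem_Ioo (hθ.trans_le hn'.1) (by linarith)
    rw [hadd, ← sub_one_mul, ← mul_assoc, inv_mul_cancel₀ hne, one_mul]
  have hstep : ∀ n ∈ range N, ‖c n - c (n + 1)‖ = (κ n - κ (n + 1)) / 2 := fun n hn => by
    rw [mem_range] at hn
    exact norm_inv_fourierChar_sub_one_sub (hθ.trans_le (h n (by lia)).1) (hmono n (by lia))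
      (by linarith [(h (n + 1) (by lia)).2])
  have hmain := norm_sum_le_of_eq_mul_sub (fun n _ => (Circle.norm_coe (𝐞 (x n))).le) hmul_sub
  rw [sum_congr rfl hstep, ← sum_div, sum_range_sub'] at hmain
  have hends : ∀ n ≤ N, ‖c n‖ ≤ 1 / (4 * θ) ∧ |κ n| ≤ 1 / (2 * θ) := fun n hn =>
    have hn' := h n (by lia)
    ⟨norm_inv_fourierChar_sub_one_le hθ hn'.1 hn'.2, abs_cot_pi_mul_le hθ hn'.1 hn'.2⟩
  obtain ⟨hc0, hκ0⟩ := hends 0 (Nat.zero_le _)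
  obtain ⟨hcN, hκN⟩ := hends N le_rfl
  have hsum : 1 / θ = 1 / (4 * θ) + 1 / (4 * θ) + (1 / (2 * θ) + 1 / (2 * θ)) / 2 := by
    field_simp; norm_num
  linarith [le_abs_self (κ 0), neg_abs_le (κ N)]

theorem norm_sum_fourierChar_le_of_ordConnected {x : ℕ → ℝ} {s : Finset ℕ} {θ : ℝ} (hθ : 0 < θ)
    (m : ℤ) (hs : (s : Set ℕ).OrdConnected)
    (h : ∀ n ∈ s, m + θ ≤ x (n + 1) - x n ∧ x (n + 1) - x n ≤ m + 1 - θ)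
    (hmono : ∀ n ∈ s, n + 1 ∈ s → x (n + 1) - x n ≤ x (n + 2) - x (n + 1)) :
    ‖∑ n ∈ s, (𝐞 (x n) : ℂ)‖ ≤ 1 / θ := by
  rcases s.eq_empty_or_nonempty with rfl | hne
  · simp only [sum_empty, norm_zero]; positivity
  set a := s.min' hne
  set b := s.max' hne
  have hmem : ∀ n, n ∈ s ↔ a ≤ n ∧ n < b + 1 := fun n =>
    ⟨fun hn => ⟨s.min'_le n hn, Nat.lt_succ_of_le (s.le_max' n hn)⟩,
      fun hn => mem_coe.1 (hs.out (s.min'_mem hne) (s.max'_mem hne) ⟨hn.1, by lia⟩)⟩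
  have hs' : s = Ico a (b + 1) := by ext n; rw [hmem, mem_Ico]
  have hper : ∀ n : ℕ, (𝐞 (x (a + n)) : ℂ) = 𝐞 (x (a + n) - m * n) := fun n => by
    have h1 := AddChar.map_add_eq_mul 𝐞 (x (a + n) - m * n) ((m * n : ℤ) : ℝ)
    rw [fourierChar_intCast, mul_one] at h1
    rw [← h1]; congr 2; push_cast; ring
  rw [hs', sum_Ico_eq_sum_range, sum_congr rfl fun n _ => hper n]
  refine norm_sum_fourierChar_le_of_diff_mem (x := fun n => x (a + n) - m * n) hθ (fun n hn => ?_)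
    (fun n hn => ?_)
  · have := h (a + n) ((hmem _).2 (by lia))
    simp only [← add_assoc]
    push_cast
    constructor <;> linarith
  · have := hmono (a + n) ((hmem _).2 (by lia)) ((hmem _).2 (by lia))
    simp only [← add_assoc]
    push_cast
    linarith

end KusminLandau

section SecondDifferences

open Finset Real
open scoped FourierTransform

theorem sub_mul_le_sub_of_le_diff {d : ℕ → ℝ} {N : ℕ} {l : ℝ}
    (h : ∀ n, n + 1 < N → l ≤ d (n + 1) - d n) {i j : ℕ} (hij : i ≤ j) (hj : j < N) :
    ((j : ℝ) - i) * l ≤ d j - d i := by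
  induction j, hij using Nat.le_induction with
  | base => simp
  | succ j _ ih =>
    push_cast
    linarith [ih (by lia), h j hj]

theorem card_le_of_separated {d : ℕ → ℝ} {s : Finset ℕ} {l θ u : ℝ} (hl : 0 < l) (hθ : 0 ≤ θ)
    (hsep : ∀ i ∈ s, ∀ j ∈ s, i ≤ j → ((j : ℝ) - i) * l ≤ d j - d i)
    (hs : ∀ n ∈ s, u ≤ d n ∧ d n ≤ u + θ) : (#s : ℝ) ≤ θ / l + 1 := by
  rcases s.eq_empty_or_nonempty with rfl | hne
  · rw [card_empty, Nat.cast_zero]; positivity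
  have hcard : (#s : ℝ) ≤ (s.max' hne : ℝ) - s.min' hne + 1 := by
    have hsub : s ⊆ Icc (s.min' hne) (s.max' hne) := fun n hn =>
      mem_Icc.2 ⟨s.min'_le n hn, s.le_max' n hn⟩
    have hle := card_le_card hsub
    rw [Nat.card_Icc] at hle
    have hpos := s.min'_le _ (s.max'_mem hne)
    have : (#s : ℝ) + s.min' hne ≤ s.max' hne + 1 := by
      exact_mod_cast (by lia : #s + s.min' hne ≤ s.max' hne + 1)
    linarith
  have hlen : (s.max' hne : ℝ) - s.min' hne ≤ θ / l := by
    rw [le_div_iff₀ hl]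
    linarith [hsep _ (s.min'_mem hne) _ (s.max'_mem hne) (s.min'_le _ (s.max'_mem hne)),
      hs _ (s.min'_mem hne), hs _ (s.max'_mem hne)]
  linarith

theorem norm_sum_fourierChar_le_card (x : ℕ → ℝ) (s : Finset ℕ) :
    ‖∑ n ∈ s, (𝐞 (x n) : ℂ)‖ ≤ #s := by
  refine (norm_sum_le_of_le s fun n _ => (Circle.norm_coe _).le).trans (le_of_eq ?_)
  simp

variable {x : ℕ → ℝ} {N : ℕ} {l : ℝ}

theorem norm_sum_fourierChar_le_of_diff_mem_Icc (hl : 0 < l) (hl1 : l ≤ 1)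
    (h : ∀ n, n + 1 < N → l ≤ (x (n + 2) - x (n + 1)) - (x (n + 1) - x n)) {s : Finset ℕ} {u : ℝ}
    (hs : ∀ n ∈ s, n < N ∧ u ≤ x (n + 1) - x n ∧ x (n + 1) - x n ≤ u + √l) :
    ‖∑ n ∈ s, (𝐞 (x n) : ℂ)‖ ≤ 2 / √l := by
  have hsl : 0 < √l := sqrt_pos.2 hl
  calc ‖∑ n ∈ s, (𝐞 (x n) : ℂ)‖ ≤ #s := norm_sum_fourierChar_le_card x s
    _ ≤ √l / l + 1 := card_le_of_separated (d := fun n => x (n + 1) - x n) hl hsl.le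
        (fun i _ j hj hij => sub_mul_le_sub_of_le_diff (d := fun n => x (n + 1) - x n) h hij
          (hs j hj).1) fun n hn => (hs n hn).2
    _ = 1 / √l + 1 := by rw [sqrt_div_self']
    _ ≤ 1 / √l + 1 / √l := by gcongr; exact (one_le_div hsl).2 (sqrt_le_one.2 hl1)
    _ = 2 / √l := by ring

theorem norm_sum_fourierChar_of_diff_mem_Icc_le
    (h : ∀ n, n + 1 < N → x (n + 1) - x n ≤ x (n + 2) - x (n + 1)) (m : ℤ) {θ : ℝ} (hθ : 0 < θ) :
    ‖∑ n ∈ range N with m + θ ≤ x (n + 1) - x n ∧ x (n + 1) - x n ≤ m + 1 - θ, (𝐞 (x n) : ℂ)‖ ≤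
      1 / θ := by
  have hmono : ∀ i j, i ≤ j → j < N → x (i + 1) - x i ≤ x (j + 1) - x j := fun i j hij hj => by
    simpa using sub_mul_le_sub_of_le_diff (d := fun n => x (n + 1) - x n) (l := 0)
      (fun n hn => sub_nonneg.2 (h n hn)) hij hj
  refine norm_sum_fourierChar_le_of_ordConnected hθ m ⟨fun a ha b hb n hn => ?_⟩
    (fun n hn => (mem_filter.1 hn).2) fun n _ hn => ?_
  · simp only [mem_coe, mem_filter, mem_range] at ha hb ⊢
    have hnN := hn.2.trans_lt hb.1
    exact ⟨hnN, ha.2.1.trans (hmono a n hn.1 hnN), (hmono n b hn.2 hb.1).trans hb.2.2⟩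
  · exact h n (mem_range.1 (mem_filter.1 hn).1)

/-- Differences within `√l` of an integer are rare because they are `l`-separated; the others are
covered by the Kusmin–Landau inequality. -/
theorem norm_sum_fourierChar_floor_diff_eq_le (hl : 0 < l) (hl1 : l ≤ 1)
    (h : ∀ n, n + 1 < N → l ≤ (x (n + 2) - x (n + 1)) - (x (n + 1) - x n)) (m : ℤ) :
    ‖∑ n ∈ range N with ⌊x (n + 1) - x n⌋ = m, (𝐞 (x n) : ℂ)‖ ≤ 5 / √l := by
  have hsl : 0 < √l := sqrt_pos.2 hl
  set d : ℕ → ℝ := fun n => x (n + 1) - x n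
  set s := {n ∈ range N | ⌊d n⌋ = m}
  have hmem : ∀ n, n ∈ s ↔ n < N ∧ (m : ℝ) ≤ d n ∧ d n < m + 1 := fun n => by
    rw [mem_filter, mem_range, Int.floor_eq_iff]
  set low := {n ∈ s | d n < m + √l}
  set high := {n ∈ s | ¬ d n < m + √l ∧ m + 1 - √l < d n}
  set mid := {n ∈ s | ¬ d n < m + √l ∧ ¬ m + 1 - √l < d n}
  have hlow : ‖∑ n ∈ low, (𝐞 (x n) : ℂ)‖ ≤ 2 / √l :=
    norm_sum_fourierChar_le_of_diff_mem_Icc hl hl1 h (u := m) fun n hn => by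
      rw [mem_filter, hmem] at hn
      exact ⟨hn.1.1, hn.1.2.1, hn.2.le⟩
  have hhigh : ‖∑ n ∈ high, (𝐞 (x n) : ℂ)‖ ≤ 2 / √l :=
    norm_sum_fourierChar_le_of_diff_mem_Icc hl hl1 h (u := m + 1 - √l) fun n hn => by
      rw [mem_filter, hmem] at hn
      exact ⟨hn.1.1, hn.2.2.le, by linarith [hn.1.2.2]⟩
  have hmid : ‖∑ n ∈ mid, (𝐞 (x n) : ℂ)‖ ≤ 1 / √l := by
    have hmid_eq : mid = {n ∈ range N | m + √l ≤ d n ∧ d n ≤ m + 1 - √l} := by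
      ext n
      rw [mem_filter, hmem, not_lt, not_lt, mem_filter, mem_range]
      exact ⟨fun hn => ⟨hn.1.1, hn.2⟩,
        fun hn => ⟨⟨hn.1, by linarith [hn.2.1], by linarith [hn.2.2]⟩, hn.2⟩⟩
    rw [hmid_eq]
    exact norm_sum_fourierChar_of_diff_mem_Icc_le (fun n hn => by linarith [h n hn]) m hsl
  rw [← sum_filter_add_sum_filter_not s fun n => d n < m + √l,
    ← sum_filter_add_sum_filter_not {n ∈ s | ¬ d n < m + √l} fun n => m + 1 - √l < d n,
    filter_filter _ _ s, filter_filter _ _ s]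
  calc _ ≤ 2 / √l + (2 / √l + 1 / √l) := (norm_add_le _ _).trans
        (add_le_add hlow ((norm_add_le _ _).trans (add_le_add hhigh hmid)))
    _ = 5 / √l := by ring

theorem card_Icc_floor_le {a b c : ℝ} (hab : a ≤ b) (hc : b - a ≤ c) :
    (#(Icc ⌊a⌋ ⌊b⌋) : ℝ) ≤ c + 2 := by
  have hle : ⌊a⌋ ≤ ⌊b⌋ := Int.floor_le_floor hab
  rw [Int.card_Icc, ← Int.cast_natCast, Int.toNat_of_nonneg (by lia)]
  push_cast
  linarith [Int.floor_le b, Int.sub_one_lt_floor a]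

/-- Van der Corput's second derivative test, for second differences. -/
theorem norm_sum_fourierChar_le_of_second_diff {A : ℝ} (hl : 0 < l) (hl1 : l ≤ 1) (hA : 0 ≤ A)
    (h : ∀ n, n + 1 < N → l ≤ (x (n + 2) - x (n + 1)) - (x (n + 1) - x n) ∧
      (x (n + 2) - x (n + 1)) - (x (n + 1) - x n) ≤ A) :
    ‖∑ n ∈ range N, (𝐞 (x n) : ℂ)‖ ≤ 5 * (A * N + 2) / √l := by
  rcases N with _ | N
  · simp only [range_zero, sum_empty, norm_zero]; positivity
  set d : ℕ → ℝ := fun n => x (n + 1) - x n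
  have hmono : ∀ i j, i ≤ j → j ≤ N → d i ≤ d j := fun i j hij hj => by
    simpa using sub_mul_le_sub_of_le_diff (l := 0) (fun n hn => hl.le.trans (h n hn).1) hij
      (Nat.lt_succ_of_le hj)
  have hrange : d N - d 0 ≤ A * (N + 1 : ℕ) := by
    have h1 := sub_mul_le_sub_of_le_diff (d := fun n => -d n) (l := -A)
      (fun n hn => by linarith [(h n hn).2]) (Nat.zero_le N) (Nat.lt_succ_self N)
    push_cast at h1 ⊢
    linarith
  have hmaps : ∀ n ∈ range (N + 1), ⌊d n⌋ ∈ Icc ⌊d 0⌋ ⌊d N⌋ := fun n hn => by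
    have hnN := Nat.lt_succ_iff.1 (mem_range.1 hn)
    exact mem_Icc.2 ⟨Int.floor_le_floor (hmono 0 n (Nat.zero_le n) hnN),
      Int.floor_le_floor (hmono n N hnN le_rfl)⟩
  rw [← sum_fiberwise_of_maps_to hmaps]
  calc ‖∑ m ∈ Icc ⌊d 0⌋ ⌊d N⌋, ∑ n ∈ range (N + 1) with ⌊d n⌋ = m, (𝐞 (x n) : ℂ)‖
      ≤ ∑ m ∈ Icc ⌊d 0⌋ ⌊d N⌋, 5 / √l := norm_sum_le_of_le _ fun m _ =>
        norm_sum_fourierChar_floor_diff_eq_le hl hl1 (fun n hn => (h n hn).1) m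
    _ = #(Icc ⌊d 0⌋ ⌊d N⌋) * (5 / √l) := by rw [sum_const, nsmul_eq_mul]
    _ ≤ (A * (N + 1 : ℕ) + 2) * (5 / √l) := by
        gcongr
        exact card_Icc_floor_le (hmono 0 N (Nat.zero_le N) le_rfl) hrange
    _ = _ := by ring

end SecondDifferences

section WeylDifferencing

open Finset
open scoped ComplexConjugate

theorem sum_natDist_le {f : ℕ → ℝ} (hf : ∀ d, 0 ≤ f d) {H h : ℕ} (hh : h < H) :
    ∑ h' ∈ range H, f (Nat.dist h h') ≤ f 0 + 2 * ∑ d ∈ Ico 1 H, f d := by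
  have hside {s : Finset ℕ} (hs : s ⊆ range H) (hh' : h ∉ s)
      (hinj : Set.InjOn (Nat.dist h) s) : ∑ h' ∈ s, f (Nat.dist h h') ≤ ∑ d ∈ Ico 1 H, f d := by
    rw [← sum_image hinj]
    refine sum_le_sum_of_subset_of_nonneg (image_subset_iff.2 fun h' hs' => ?_) fun _ _ _ => hf _
    have h1 := mem_range.1 (hs hs')
    have h2 : h' ≠ h := fun h3 => hh' (h3 ▸ hs')
    rw [mem_Ico, Nat.dist]
    lia
  have hbelow := hside (s := range h) (range_subset_range.2 hh.le) (by simp)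
    fun a ha b hb hab => by
      simp only [Nat.dist, coe_range, Set.mem_Iio] at ha hb hab; lia
  have habove := hside (s := Ico (h + 1) H) (fun n hn => mem_range.2 (mem_Ico.1 hn).2) (by simp)
    fun a ha b hb hab => by
      simp only [Nat.dist, coe_Ico, Set.mem_Ico] at ha hb hab; lia
  rw [range_eq_Ico, ← sum_Ico_consecutive _ (Nat.zero_le h) hh.le, ← range_eq_Ico,
    sum_eq_sum_Ico_succ_bot hh, Nat.dist_self]
  linarith

/-- The finite sequence `z 0, …, z (L - 1)`, shifted to start at `h` and extended by zero. -/
noncomputable def shiftedSegment (z : ℕ → ℂ) (L h m : ℕ) : ℂ :=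
  if h ≤ m ∧ m < L + h then z (m - h) else 0

theorem sum_shiftedSegment (z : ℕ → ℂ) {L h K : ℕ} (hK : L + h ≤ K) :
    ∑ m ∈ range K, shiftedSegment z L h m = ∑ n ∈ range L, z n := by
  simp only [shiftedSegment]
  rw [← sum_filter]
  refine sum_nbij' (fun m => m - h) (fun n => n + h) ?_ ?_ ?_ ?_ ?_ <;>
    intro a ha <;> simp only [mem_filter, mem_range] at ha ⊢ <;> lia

theorem shiftedSegment_mul_conj (z : ℕ → ℂ) (L : ℕ) {h h' : ℕ} (hle : h ≤ h') (m : ℕ) :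
    shiftedSegment z L h m * conj (shiftedSegment z L h' m) =
      shiftedSegment (fun n => z (n + (h' - h)) * conj (z n)) (L - (h' - h)) h' m := by
  simp only [shiftedSegment]
  by_cases hboth : h' ≤ m ∧ m < L - (h' - h) + h'
  · rw [if_pos (by lia), if_pos (by lia), if_pos hboth, show m - h' + (h' - h) = m - h by lia]
  · rw [if_neg hboth]
    by_cases hleft : h ≤ m ∧ m < L + h
    · rw [if_neg (by lia : ¬ (h' ≤ m ∧ m < L + h')), map_zero, mul_zero]
    · rw [if_neg hleft, zero_mul]

/-- The norm of the autocorrelation `∑ z (n + d) * conj (z n)` of `z 0, …, z (L - 1)` at lag `d`. -/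
noncomputable def autocorrNorm (z : ℕ → ℂ) (L d : ℕ) : ℝ :=
  ‖∑ n ∈ range (L - d), z (n + d) * conj (z n)‖

theorem re_sum_shiftedSegment_mul_conj_le (z : ℕ → ℂ) {L H h h' : ℕ} (hh : h < H) (hh' : h' < H) :
    (∑ m ∈ range (L + H), shiftedSegment z L h m * conj (shiftedSegment z L h' m)).re ≤
      autocorrNorm z L (Nat.dist h h') := by
  have hordered {a b : ℕ} (hab : a ≤ b) (hb : b < H) :
      ‖∑ m ∈ range (L + H), shiftedSegment z L a m * conj (shiftedSegment z L b m)‖ ≤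
        autocorrNorm z L (b - a) := by
    rw [sum_congr rfl fun m _ => shiftedSegment_mul_conj z L hab m,
      sum_shiftedSegment _ (by lia), autocorrNorm]
  refine (Complex.re_le_norm _).trans ?_
  rcases le_total h h' with hle | hle
  · rw [Nat.dist_eq_sub_of_le hle]
    exact hordered hle hh'
  · rw [Nat.dist_eq_sub_of_le_right hle, ← RCLike.norm_conj, map_sum]
    simp only [map_mul, Complex.conj_conj]
    simp only [mul_comm (conj (shiftedSegment z L h _))]
    exact hordered hle hh

theorem norm_sum_sq_eq_sum_re (s : Finset ℕ) (w : ℕ → ℂ) :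
    ‖∑ h ∈ s, w h‖ ^ 2 = ∑ h ∈ s, ∑ h' ∈ s, (w h * conj (w h')).re := by
  rw [← Complex.ofReal_re (‖∑ h ∈ s, w h‖ ^ 2), Complex.ofReal_pow, ← Complex.mul_conj', map_sum,
    sum_mul_sum]
  simp only [Complex.re_sum]

theorem sum_norm_sum_shiftedSegment_sq_le (z : ℕ → ℂ) (L H : ℕ) :
    ∑ m ∈ range (L + H), ‖∑ h ∈ range H, shiftedSegment z L h m‖ ^ 2 ≤
      H * (autocorrNorm z L 0 + 2 * ∑ d ∈ Ico 1 H, autocorrNorm z L d) := by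
  calc ∑ m ∈ range (L + H), ‖∑ h ∈ range H, shiftedSegment z L h m‖ ^ 2
      = ∑ h ∈ range H, ∑ h' ∈ range H,
          (∑ m ∈ range (L + H), shiftedSegment z L h m * conj (shiftedSegment z L h' m)).re := by
        simp_rw [norm_sum_sq_eq_sum_re, Complex.re_sum]
        rw [sum_comm]
        exact sum_congr rfl fun h _ => sum_comm
    _ ≤ ∑ h ∈ range H, ∑ h' ∈ range H, autocorrNorm z L (Nat.dist h h') :=
        sum_le_sum fun h hh => sum_le_sum fun h' hh' =>
          re_sum_shiftedSegment_mul_conj_le z (mem_range.1 hh) (mem_range.1 hh')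
    _ ≤ ∑ h ∈ range H, (autocorrNorm z L 0 + 2 * ∑ d ∈ Ico 1 H, autocorrNorm z L d) :=
        sum_le_sum fun h hh =>
          sum_natDist_le (f := autocorrNorm z L) (fun d => norm_nonneg _) (mem_range.1 hh)
    _ = _ := by rw [sum_const, card_range, nsmul_eq_mul]

/-- The Weyl–van der Corput inequality: sum over all shifts of `z` by less than `H`, and apply
Cauchy–Schwarz. -/
theorem mul_norm_sum_sq_le (z : ℕ → ℂ) (L : ℕ) {H : ℕ} (hH : 0 < H) :
    (H : ℝ) * ‖∑ n ∈ range L, z n‖ ^ 2 ≤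
      (L + H) * (autocorrNorm z L 0 + 2 * ∑ d ∈ Ico 1 H, autocorrNorm z L d) := by
  have hH' : (0 : ℝ) < H := by exact_mod_cast hH
  have hshift : (H : ℂ) * ∑ n ∈ range L, z n =
      ∑ m ∈ range (L + H), ∑ h ∈ range H, shiftedSegment z L h m := by
    have hrow : ∀ h ∈ range H, ∑ m ∈ range (L + H), shiftedSegment z L h m = ∑ n ∈ range L, z n :=
      fun h hh => sum_shiftedSegment z (by rw [mem_range] at hh; lia)
    rw [sum_comm, sum_congr rfl hrow, sum_const, card_range, nsmul_eq_mul]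
  refine le_of_mul_le_mul_left ?_ hH'
  calc (H : ℝ) * (H * ‖∑ n ∈ range L, z n‖ ^ 2)
      = ‖∑ m ∈ range (L + H), ∑ h ∈ range H, shiftedSegment z L h m‖ ^ 2 := by
        rw [← hshift, norm_mul, Complex.norm_natCast]; ring
    _ ≤ (∑ m ∈ range (L + H), ‖∑ h ∈ range H, shiftedSegment z L h m‖) ^ 2 := by
        gcongr; exact norm_sum_le _ _
    _ ≤ #(range (L + H)) * ∑ m ∈ range (L + H), ‖∑ h ∈ range H, shiftedSegment z L h m‖ ^ 2 :=
        sq_sum_le_card_mul_sum_sq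
    _ ≤ (L + H : ℕ) * (H * (autocorrNorm z L 0 + 2 * ∑ d ∈ Ico 1 H, autocorrNorm z L d)) := by
        rw [card_range]
        gcongr
        exact sum_norm_sum_shiftedSegment_sq_le z L H
    _ = _ := by push_cast; ring

theorem autocorrNorm_zero_le {z : ℕ → ℂ} (hz : ∀ n, ‖z n‖ ≤ 1) (L : ℕ) :
    autocorrNorm z L 0 ≤ L := by
  calc autocorrNorm z L 0 ≤ ∑ n ∈ range L, 1 := norm_sum_le_of_le _ fun n _ => by
        rw [norm_mul, RCLike.norm_conj]
        exact mul_le_one₀ (hz n) (norm_nonneg _) (hz n)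
    _ = L := by simp

end WeylDifferencing

/-! ### The phase `-c log (M + n)` -/

section LogarithmicPhase

open Finset Real
open scoped FourierTransform ComplexConjugate

/-- Minus the second difference of the logarithm, `2 log (v + 1) - log v - log (v + 2)`. -/
noncomputable def negLogSecondDiff (v : ℝ) : ℝ := 2 * log (v + 1) - log v - log (v + 2)

theorem negLogSecondDiff_mem_Icc {v : ℝ} (hv : 0 < v) :
    negLogSecondDiff v ∈ Set.Icc (1 / (v + 1) ^ 2) (1 / (v * (v + 2))) := by
  have hlog : negLogSecondDiff v = log ((v + 1) ^ 2 / (v * (v + 2))) := by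
    rw [negLogSecondDiff, log_div (by positivity) (by positivity), log_pow,
      log_mul (by positivity) (by positivity)]
    push_cast
    ring
  rw [hlog]
  constructor
  · refine le_trans (le_of_eq ?_) (one_sub_inv_le_log_of_pos (by positivity))
    field_simp
    ring
  · refine (log_le_sub_one_of_pos (by positivity)).trans (le_of_eq ?_)
    field_simp
    ring

theorem negLogSecondDiff_nonneg {v : ℝ} (hv : 0 < v) : 0 ≤ negLogSecondDiff v :=
  le_trans (by positivity) (negLogSecondDiff_mem_Icc hv).1

theorem negLogSecondDiff_eq_neg_log {v : ℝ} (hv : 0 < v) :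
    negLogSecondDiff v = -log (1 - 1 / (v + 1) ^ 2) := by
  have hquot : 1 - 1 / (v + 1) ^ 2 = v * (v + 2) / (v + 1) ^ 2 := by field_simp; ring
  rw [negLogSecondDiff, hquot, log_div (by positivity) (by positivity), log_pow,
    log_mul (by positivity) (by positivity)]
  push_cast
  ring

theorem neg_log_one_sub_sub_mem_Icc {a b : ℝ} (hb : 0 ≤ b) (hba : b ≤ a) (ha : a ≤ 1 / 4) :
    -log (1 - a) - -log (1 - b) ∈ Set.Icc (a - b) (4 / 3 * (a - b)) := by
  have hlog : -log (1 - a) - -log (1 - b) = log ((1 - b) / (1 - a)) := by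
    rw [log_div (by linarith) (by linarith)]
    ring
  have hpos : 0 < (1 - b) / (1 - a) := div_pos (by linarith) (by linarith)
  rw [hlog]
  constructor
  · refine le_trans ?_ (one_sub_inv_le_log_of_pos hpos)
    rw [inv_div, one_sub_div (by linarith), le_div_iff₀ (by linarith)]
    nlinarith
  · refine (log_le_sub_one_of_pos hpos).trans ?_
    rw [div_sub_one (by linarith), div_le_iff₀ (by linarith)]
    nlinarith

theorem negLogSecondDiff_sub_mem_Icc {v d : ℝ} (hv : 1 ≤ v) (hd : 0 ≤ d) :
    negLogSecondDiff v - negLogSecondDiff (v + d) ∈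
      Set.Icc (1 / (v + 1) ^ 2 - 1 / (v + d + 1) ^ 2)
        (4 / 3 * (1 / (v + 1) ^ 2 - 1 / (v + d + 1) ^ 2)) := by
  rw [negLogSecondDiff_eq_neg_log (by linarith), negLogSecondDiff_eq_neg_log (by linarith)]
  refine neg_log_one_sub_sub_mem_Icc (by positivity) ?_ ?_
  · exact one_div_le_one_div_of_le (by positivity) (by gcongr; linarith)
  · exact one_div_le_one_div_of_le (by norm_num) (by nlinarith)

theorem inv_sq_sub_inv_sq_mem_Icc {M w d : ℝ} (hM : 0 < M) (hw : M ≤ w) (hd : 0 ≤ d)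
    (hwd : w + d ≤ 2 * M) :
    1 / w ^ 2 - 1 / (w + d) ^ 2 ∈ Set.Icc (d / (4 * M ^ 3)) (2 * d / M ^ 3) := by
  have hw0 : 0 < w := hM.trans_le hw
  have hdiff : 1 / w ^ 2 - 1 / (w + d) ^ 2 = d * (2 * w + d) / (w ^ 2 * (w + d) ^ 2) := by
    field_simp
    ring
  rw [hdiff]
  constructor
  · have hcube : (w + d) ^ 2 * w ≤ 8 * M ^ 3 :=
      calc (w + d) ^ 2 * w ≤ (2 * M) ^ 2 * (2 * M) := by gcongr; linarith
        _ = 8 * M ^ 3 := by ring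
    calc d / (4 * M ^ 3) = d * (2 * w) / (w * (8 * M ^ 3)) := by field_simp; ring
      _ ≤ d * (2 * w + d) / (w * ((w + d) ^ 2 * w)) := by gcongr; linarith
      _ = _ := by ring
  · calc d * (2 * w + d) / (w ^ 2 * (w + d) ^ 2)
        ≤ d * (2 * (w + d)) / (w ^ 2 * (w + d) ^ 2) := by gcongr; linarith
      _ = 2 * d / (w ^ 2 * (w + d)) := by field_simp
      _ ≤ 2 * d / (M ^ 2 * M) := by gcongr; linarith
      _ = _ := by ring

/-- The phase `-c log (M + n)`, for which `n ↦ 𝐞 (logPhase c M n)` is `(M + n) ^ (-2πic)`. -/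
noncomputable def logPhase (c : ℝ) (M n : ℕ) : ℝ := -(c * log ((M : ℝ) + n))

theorem logPhase_succ_sub {c : ℝ} {M : ℕ} (hM : 1 ≤ M) (n : ℕ) :
    logPhase c M (n + 1) - logPhase c M n = -(c * log (((M : ℝ) + n + 1) / (M + n))) := by
  have : (0 : ℝ) < M := by exact_mod_cast hM
  rw [log_div (by positivity) (by positivity), logPhase, logPhase]
  push_cast
  rw [← add_assoc]
  ring

theorem logPhase_second_diff (c : ℝ) (M n : ℕ) :
    (logPhase c M (n + 2) - logPhase c M (n + 1)) - (logPhase c M (n + 1) - logPhase c M n) =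
      c * negLogSecondDiff (M + n) := by
  simp only [logPhase, negLogSecondDiff]
  push_cast
  rw [← add_assoc, ← add_assoc]
  ring

theorem norm_sum_logPhase_le_second {c : ℝ} (hc : 0 < c) {M L : ℕ} (hM : 1 ≤ M) (hL : L ≤ M)
    (hcM : c ≤ 4 * (M : ℝ) ^ 2) :
    ‖∑ n ∈ range L, (𝐞 (logPhase c M n) : ℂ)‖ ≤ 10 * √c + 20 * M / √c := by
  have hM0 : (0 : ℝ) < M := by exact_mod_cast hM
  have hLM : (L : ℝ) ≤ M := by exact_mod_cast hL
  have : 0 < √c := sqrt_pos.2 hc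
  have hsqrt : √(c / (4 * (M : ℝ) ^ 2)) = √c / (2 * M) := by
    rw [show 4 * (M : ℝ) ^ 2 = (2 * M) ^ 2 by ring, sqrt_div hc.le, sqrt_sq (by positivity)]
  calc ‖∑ n ∈ range L, (𝐞 (logPhase c M n) : ℂ)‖
      ≤ 5 * (c / (M : ℝ) ^ 2 * L + 2) / √(c / (4 * (M : ℝ) ^ 2)) := by
        refine norm_sum_fourierChar_le_of_second_diff (by positivity)
          ((div_le_one (by positivity)).2 hcM) (by positivity) fun n hn => ?_
        have hnM : (M : ℝ) + n + 1 ≤ 2 * M := by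
          exact_mod_cast (by lia : M + n + 1 ≤ 2 * M)
        have hbounds := negLogSecondDiff_mem_Icc (v := M + n) (by positivity)
        rw [logPhase_second_diff, div_eq_mul_one_div, div_eq_mul_one_div c ((M : ℝ) ^ 2)]
        constructor
        · gcongr
          refine le_trans ?_ hbounds.1
          gcongr
          nlinarith
        · gcongr
          refine hbounds.2.trans ?_
          gcongr
          nlinarith
    _ ≤ 5 * (c / (M : ℝ) ^ 2 * M + 2) / (√c / (2 * M)) := by rw [hsqrt]; gcongr
    _ = 10 * √c + 20 * M / √c := by
        field_simp
        rw [sq_sqrt hc.le]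
        ring

theorem norm_sum_logPhase_le_first {c : ℝ} (hc : 0 < c) {M L : ℕ} (hM : 1 ≤ M) (hL : L ≤ M)
    (hcM : 2 * c ≤ M) :
    ‖∑ n ∈ range L, (𝐞 (logPhase c M n) : ℂ)‖ ≤ 2 * M / c := by
  have hM0 : (0 : ℝ) < M := by exact_mod_cast hM
  refine (norm_sum_fourierChar_le_of_ordConnected (θ := c / (2 * M)) (by positivity) (-1)
    (by rw [coe_range]; exact Set.ordConnected_Iio) (fun n hn => ?_)
    fun n _ _ => ?_).trans_eq (by field_simp)
  · have hnM : (M : ℝ) + n + 1 ≤ 2 * M := by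
      exact_mod_cast (by rw [mem_range] at hn; lia : M + n + 1 ≤ 2 * M)
    have hpos : 0 < ((M : ℝ) + n + 1) / (M + n) := by positivity
    have hupper : c * log (((M : ℝ) + n + 1) / (M + n)) ≤ c * (1 / M) := by
      gcongr
      refine (log_le_sub_one_of_pos hpos).trans ?_
      rw [div_sub_one (by positivity), add_sub_cancel_left]
      gcongr
      linarith
    have hlower : c * (1 / (2 * M)) ≤ c * log (((M : ℝ) + n + 1) / (M + n)) := by
      gcongr
      refine le_trans ?_ (one_sub_inv_le_log_of_pos hpos)
      rw [inv_div, one_sub_div (by positivity), add_sub_cancel_left]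
      gcongr
    have hhalf : c * (1 / M) ≤ 1 / 2 := by
      rw [mul_one_div, div_le_iff₀ hM0]
      linarith
    have hθ : c * (1 / M) = 2 * (c / (2 * M)) := by field_simp
    rw [mul_one_div] at hlower
    rw [logPhase_succ_sub hM]
    push_cast
    constructor <;> linarith
  · have hdiff := logPhase_second_diff c M n
    have hnonneg := mul_nonneg hc.le (negLogSecondDiff_nonneg (v := M + n) (by positivity))
    linarith

theorem autocorrNorm_fourierChar (x : ℕ → ℝ) (L d : ℕ) :
    autocorrNorm (fun n => (𝐞 (x n) : ℂ)) L d =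
      ‖∑ n ∈ range (L - d), (𝐞 (x n - x (n + d)) : ℂ)‖ := by
  rw [autocorrNorm, ← RCLike.norm_conj, map_sum]
  congr 1
  refine sum_congr rfl fun n _ => ?_
  rw [map_mul, Complex.conj_conj, Circle.starRingEnd_addChar, ← Circle.coe_mul,
    ← AddChar.map_add_eq_mul]
  congr 2
  ring

theorem logPhase_sub_shift_second_diff_mem_Icc {c : ℝ} (hc : 0 ≤ c) {M d n : ℕ} (hM : 1 ≤ M)
    (hn : n + d + 1 ≤ M) :
    (logPhase c M (n + 2) - logPhase c M (n + 2 + d)) -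
          (logPhase c M (n + 1) - logPhase c M (n + 1 + d)) -
        ((logPhase c M (n + 1) - logPhase c M (n + 1 + d)) -
          (logPhase c M n - logPhase c M (n + d))) ∈
      Set.Icc (c * d / (4 * (M : ℝ) ^ 3)) (3 * (c * d) / (M : ℝ) ^ 3) := by
  have hM1 : (1 : ℝ) ≤ M := by exact_mod_cast hM
  have hn' : (M : ℝ) + n + 1 + d ≤ 2 * M := by
    exact_mod_cast (by lia : M + n + 1 + d ≤ 2 * M)
  have : (0 : ℝ) ≤ n := n.cast_nonneg
  have hdiff : (logPhase c M (n + 2) - logPhase c M (n + 2 + d)) -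
        (logPhase c M (n + 1) - logPhase c M (n + 1 + d)) -
      ((logPhase c M (n + 1) - logPhase c M (n + 1 + d)) -
        (logPhase c M n - logPhase c M (n + d))) =
      c * (negLogSecondDiff (M + n) - negLogSecondDiff (M + n + d)) := by
    have hshift := logPhase_second_diff c M (n + d)
    rw [Nat.cast_add, ← add_assoc] at hshift
    rw [add_right_comm n 2 d, add_right_comm n 1 d]
    linear_combination logPhase_second_diff c M n - hshift
  obtain ⟨hlog1, hlog2⟩ := negLogSecondDiff_sub_mem_Icc (v := (M : ℝ) + n) (d := d)
    (by linarith) d.cast_nonneg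
  rw [add_right_comm _ (d : ℝ) 1] at hlog1 hlog2
  obtain ⟨hsq1, hsq2⟩ := inv_sq_sub_inv_sq_mem_Icc (M := M) (w := M + n + 1) (d := d)
    (by linarith) (by linarith) d.cast_nonneg hn'
  have hthree : 4 / 3 * (2 * d / (M : ℝ) ^ 3) ≤ 3 * d / (M : ℝ) ^ 3 := by
    rw [mul_div_assoc, mul_div_assoc]
    linarith [show (0 : ℝ) ≤ d / (M : ℝ) ^ 3 by positivity]
  rw [hdiff]
  constructor
  · rw [mul_div_assoc]
    exact mul_le_mul_of_nonneg_left (hsq1.trans hlog1) hc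
  · rw [show 3 * (c * d) / (M : ℝ) ^ 3 = c * (3 * d / (M : ℝ) ^ 3) by ring]
    exact mul_le_mul_of_nonneg_left (by linarith) hc

theorem autocorrNorm_logPhase_le {c : ℝ} (hc : 0 < c) {M L d : ℕ} (hM : 1 ≤ M) (hL : L ≤ M)
    (hd : 1 ≤ d) (hcd : c * d ≤ 4 * (M : ℝ) ^ 3) :
    autocorrNorm (fun n => (𝐞 (logPhase c M n) : ℂ)) L d ≤
      30 * √(c * d) / √M + 20 * (M * √M) / √(c * d) := by
  have hM0 : (0 : ℝ) < M := by exact_mod_cast hM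
  have : (0 : ℝ) < d := by exact_mod_cast hd
  have hcd0 : 0 < c * d := by positivity
  have hLM : ((L - d : ℕ) : ℝ) ≤ M := by exact_mod_cast (by lia : L - d ≤ M)
  have hsqrtM : (M : ℝ) = √M * √M := (mul_self_sqrt hM0.le).symm
  have hsqrt : √(c * d / (4 * (M : ℝ) ^ 3)) = √(c * d) / (2 * (M * √M)) := by
    rw [sqrt_div hcd0.le]
    congr 1
    rw [sqrt_eq_iff_mul_self_eq (by positivity) (by positivity)]
    linear_combination (4 * (M : ℝ) ^ 2) * hsqrtM
  rw [autocorrNorm_fourierChar]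
  calc ‖∑ n ∈ range (L - d), (𝐞 (logPhase c M n - logPhase c M (n + d)) : ℂ)‖
      ≤ 5 * (3 * (c * d) / (M : ℝ) ^ 3 * (L - d : ℕ) + 2) / √(c * d / (4 * (M : ℝ) ^ 3)) :=
        norm_sum_fourierChar_le_of_second_diff (by positivity)
          ((div_le_one (by positivity)).2 hcd) (by positivity) fun n hn =>
            logPhase_sub_shift_second_diff_mem_Icc hc.le hM (by lia)
    _ ≤ 5 * (3 * (c * d) / (M : ℝ) ^ 3 * M + 2) / (√(c * d) / (2 * (M * √M))) := by
        rw [hsqrt]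
        gcongr
    _ = 30 * (√(c * d) * √(c * d)) * √M / (√(c * d) * (√M * √M)) +
          20 * (M * √M) / √(c * d) := by
        rw [← hsqrtM, mul_self_sqrt hcd0.le]
        field_simp
        ring
    _ = _ := by
        have hsM : √(M : ℝ) ≠ 0 := (sqrt_pos.2 hM0).ne'
        have hsc : √(c * d) ≠ 0 := (sqrt_pos.2 hcd0).ne'
        congr 1
        field_simp

end LogarithmicPhase

section LogarithmicPhaseBlocks

open Finset Real
open scoped FourierTransform

theorem sum_Ico_inv_sqrt_le (n : ℕ) : ∑ d ∈ Ico 1 (n + 1), 1 / √(d : ℝ) ≤ 2 * √(n : ℝ) := by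
  induction n with
  | zero => simp
  | succ n ih =>
    have hpos : 0 < √((n + 1 : ℕ) : ℝ) := sqrt_pos.2 (by positivity)
    have hsq : √((n + 1 : ℕ) : ℝ) * √((n + 1 : ℕ) : ℝ) = n + 1 := by
      rw [mul_self_sqrt (by positivity)]
      push_cast
      ring
    have hsq' : √(n : ℝ) * √(n : ℝ) = n := mul_self_sqrt n.cast_nonneg
    have hterm : 1 / √((n + 1 : ℕ) : ℝ) ≤ 2 * √((n + 1 : ℕ) : ℝ) - 2 * √(n : ℝ) := by
      rw [div_le_iff₀ hpos]
      nlinarith [sq_nonneg (√((n + 1 : ℕ) : ℝ) - √(n : ℝ))]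
    rw [sum_Ico_succ_top (by lia)]
    linarith

theorem pow_three_div_three_le_sqrt {c τ : ℝ} (hc : τ ^ 6 / 9 ≤ c) : τ ^ 3 / 3 ≤ √c :=
  le_sqrt_of_sq_le (by linarith [show (τ ^ 3 / 3) ^ 2 = τ ^ 6 / 9 by ring])

theorem sqrt_le_pow {c τ : ℝ} (hτ : 0 ≤ τ) {k : ℕ} (hc : c ≤ τ ^ (k * 2)) : √c ≤ τ ^ k :=
  sqrt_le_iff.2 ⟨by positivity, by rwa [← pow_mul]⟩

theorem sum_autocorrNorm_logPhase_le {c : ℝ} (hc : 0 < c) {M L H : ℕ} (hM : 1 ≤ M) (hL : L ≤ M)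
    (hcH : c * H ≤ 4 * (M : ℝ) ^ 3) :
    ∑ d ∈ Ico 1 H, autocorrNorm (fun n => (𝐞 (logPhase c M n) : ℂ)) L d ≤
      H * (30 * √c * √H / √M) + 20 * √M ^ 3 / √c * (2 * √H) := by
  have hterm (d : ℕ) (hd : d ∈ Ico 1 H) :
      autocorrNorm (fun n => (𝐞 (logPhase c M n) : ℂ)) L d ≤
        30 * √c * √H / √M + 20 * √M ^ 3 / √c * (1 / √(d : ℝ)) := by
    have hdH : (d : ℝ) ≤ H := by exact_mod_cast (mem_Ico.1 hd).2.le
    calc _ ≤ 30 * √(c * d) / √M + 20 * (M * √M) / √(c * d) :=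
          autocorrNorm_logPhase_le hc hM hL (mem_Ico.1 hd).1 (le_trans (by gcongr) hcH)
      _ = 30 * √c * √d / √M + 20 * √M ^ 3 / √c * (1 / √(d : ℝ)) := by
          rw [sqrt_mul hc.le, pow_succ, sq_sqrt M.cast_nonneg]
          ring
      _ ≤ _ := by gcongr
  have hcard : ((H - 1 : ℕ) : ℝ) ≤ H := by exact_mod_cast Nat.sub_le H 1
  calc ∑ d ∈ Ico 1 H, autocorrNorm (fun n => (𝐞 (logPhase c M n) : ℂ)) L d
      ≤ ∑ d ∈ Ico 1 H, (30 * √c * √H / √M + 20 * √M ^ 3 / √c * (1 / √(d : ℝ))) :=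
        sum_le_sum hterm
    _ = (H - 1 : ℕ) * (30 * √c * √H / √M) +
          20 * √M ^ 3 / √c * ∑ d ∈ Ico 1 H, 1 / √(d : ℝ) := by
        rw [sum_add_distrib, sum_const, Nat.card_Ico, nsmul_eq_mul, ← mul_sum]
    _ ≤ _ := by
        gcongr
        exact (sum_le_sum_of_subset_of_nonneg (Ico_subset_Ico_right H.le_succ)
          fun d _ _ => by positivity).trans (sum_Ico_inv_sqrt_le H)

theorem sum_autocorrNorm_logPhase_le_mul {c τ : ℝ} (hτ : 0 < τ) (hc1 : τ ^ 6 / 9 ≤ c)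
    (hc2 : c ≤ τ ^ 6) {M L H : ℕ} (hM1 : τ ^ 2 ≤ M) (hM2 : (M : ℝ) ≤ τ ^ 4) (hL : L ≤ M)
    (hH : (H : ℝ) ≤ M / τ ^ 2) :
    ∑ d ∈ Ico 1 H, autocorrNorm (fun n => (𝐞 (logPhase c M n) : ℂ)) L d ≤ 150 * M := by
  have hc : 0 < c := lt_of_lt_of_le (by positivity) hc1
  have hM0 : (0 : ℝ) < M := lt_of_lt_of_le (by positivity) hM1
  have hmM : √(M : ℝ) ^ 2 = M := sq_sqrt hM0.le
  have hmτ : √(M : ℝ) / τ ^ 2 ≤ 1 := (div_le_one (by positivity)).2 (sqrt_le_pow hτ.le hM2)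
  have hHm : √(H : ℝ) ≤ √M / τ :=
    sqrt_le_iff.2 ⟨by positivity, by rwa [div_pow, hmM]⟩
  have hcH : c * H ≤ 4 * (M : ℝ) ^ 3 :=
    calc c * H ≤ τ ^ 6 * (M / τ ^ 2) := by gcongr
      _ = (τ ^ 2) ^ 2 * M := by field_simp
      _ ≤ (M : ℝ) ^ 2 * M := by gcongr
      _ ≤ 4 * (M : ℝ) ^ 3 := by linarith [pow_pos hM0 3, pow_succ (M : ℝ) 2]
  calc _ ≤ H * (30 * √c * √H / √M) + 20 * √M ^ 3 / √c * (2 * √H) :=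
        sum_autocorrNorm_logPhase_le hc (by exact_mod_cast hM0) hL hcH
    _ ≤ √M ^ 2 / τ ^ 2 * (30 * τ ^ 3 * (√M / τ) / √M) +
          20 * √M ^ 3 / (τ ^ 3 / 3) * (2 * (√M / τ)) := by
        gcongr
        · exact hH.trans_eq (by rw [hmM])
        · exact sqrt_le_pow hτ.le hc2
        · exact pow_three_div_three_le_sqrt hc1
    _ = 30 * √M ^ 2 + 120 * √M ^ 2 * (√M / τ ^ 2) ^ 2 := by field_simp; ring
    _ ≤ 30 * √M ^ 2 + 120 * √M ^ 2 * 1 := by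
        gcongr
        exact pow_le_one₀ (by positivity) hmτ
    _ = 150 * M := by rw [hmM]; ring

theorem norm_sum_logPhase_le_of_pow_two_le {c τ : ℝ} (hτ : 1 ≤ τ) (hc1 : τ ^ 6 / 9 ≤ c)
    (hc2 : c ≤ τ ^ 6) {M L : ℕ} (hM1 : τ ^ 2 ≤ M) (hM2 : (M : ℝ) ≤ τ ^ 4) (hL : L ≤ M) :
    ‖∑ n ∈ range L, (𝐞 (logPhase c M n) : ℂ)‖ ≤ 35 * √M * τ := by
  have hτ0 : 0 < τ := by linarith
  have hM0 : (0 : ℝ) < M := lt_of_lt_of_le (by positivity) hM1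
  have hLM : (L : ℝ) ≤ M := by exact_mod_cast hL
  obtain ⟨H, hHdef⟩ : ∃ H, H = ⌊(M : ℝ) / τ ^ 2⌋₊ := ⟨_, rfl⟩
  have hH1 : 1 ≤ H := by
    rw [hHdef]
    exact Nat.le_floor (by rw [Nat.cast_one, le_div_iff₀ (by positivity)]; linarith)
  have hHle : (H : ℝ) ≤ M / τ ^ 2 := hHdef ▸ Nat.floor_le (by positivity)
  have hHge : (M : ℝ) / τ ^ 2 ≤ 2 * H := by
    have hlt : (M : ℝ) / τ ^ 2 < H + 1 := hHdef ▸ Nat.lt_floor_add_one _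
    have : (1 : ℝ) ≤ H := by exact_mod_cast hH1
    linarith
  have hHM : (H : ℝ) ≤ M := hHle.trans (div_le_self hM0.le (one_le_pow₀ hτ))
  have hweyl : (H : ℝ) * ‖∑ n ∈ range L, (𝐞 (logPhase c M n) : ℂ)‖ ^ 2 ≤ 602 * (M : ℝ) ^ 2 :=
    calc _ ≤ (L + H : ℝ) * (autocorrNorm (fun n => (𝐞 (logPhase c M n) : ℂ)) L 0 +
            2 * ∑ d ∈ Ico 1 H, autocorrNorm (fun n => (𝐞 (logPhase c M n) : ℂ)) L d) :=
          mul_norm_sum_sq_le _ L hH1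
      _ ≤ (M + M) * (M + 2 * (150 * M)) := by
          gcongr
          · exact add_nonneg (norm_nonneg _)
              (mul_nonneg zero_le_two (sum_nonneg fun d _ => norm_nonneg _))
          · exact (autocorrNorm_zero_le (fun n => (Circle.norm_coe _).le) L).trans hLM
          · exact sum_autocorrNorm_logPhase_le_mul hτ0 hc1 hc2 hM1 hM2 hL hHle
      _ = _ := by ring
  refine le_of_sq_le_sq (le_of_mul_le_mul_left ?_ hM0) (by positivity)
  calc (M : ℝ) * ‖∑ n ∈ range L, (𝐞 (logPhase c M n) : ℂ)‖ ^ 2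
      = M / τ ^ 2 * ‖∑ n ∈ range L, (𝐞 (logPhase c M n) : ℂ)‖ ^ 2 * τ ^ 2 := by field_simp
    _ ≤ 2 * H * ‖∑ n ∈ range L, (𝐞 (logPhase c M n) : ℂ)‖ ^ 2 * τ ^ 2 := by gcongr
    _ ≤ M * (35 ^ 2 * M * τ ^ 2) := by nlinarith [mul_le_mul_of_nonneg_right hweyl (sq_nonneg τ)]
    _ = M * (35 * √M * τ) ^ 2 := by rw [mul_pow, mul_pow, sq_sqrt hM0.le]

theorem norm_sum_logPhase_le_of_pow_four_le {c τ : ℝ} (hτ : 1 ≤ τ) (hc1 : τ ^ 6 / 9 ≤ c)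
    (hc2 : c ≤ τ ^ 6) {M L : ℕ} (hM1 : τ ^ 4 ≤ M) (hM2 : (M : ℝ) ≤ τ ^ 8) (hL : L ≤ M) :
    ‖∑ n ∈ range L, (𝐞 (logPhase c M n) : ℂ)‖ ≤ 70 * √M * τ := by
  have hτ0 : 0 < τ := by linarith
  have hc : 0 < c := lt_of_lt_of_le (by positivity) hc1
  have hM0 : (0 : ℝ) < M := lt_of_lt_of_le (by positivity) hM1
  have hm1 : τ ^ 2 ≤ √(M : ℝ) := le_sqrt_of_sq_le (by rwa [← pow_mul])
  have hm2 : √(M : ℝ) / τ ^ 4 ≤ 1 := (div_le_one (by positivity)).2 (sqrt_le_pow hτ0.le hM2)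
  have hcM : c ≤ 4 * (M : ℝ) ^ 2 := by
    have hτ68 : τ ^ 6 ≤ (τ ^ 4) ^ 2 :=
      (pow_le_pow_right₀ hτ (by norm_num)).trans_eq (pow_mul τ 4 2)
    nlinarith [pow_le_pow_left₀ (by positivity) hM1 2]
  calc _ ≤ 10 * √c + 20 * M / √c :=
        norm_sum_logPhase_le_second hc (by exact_mod_cast hM0) hL hcM
    _ ≤ 10 * τ ^ 3 + 20 * M / (τ ^ 3 / 3) := by
        gcongr
        · exact sqrt_le_pow hτ0.le hc2
        · exact pow_three_div_three_le_sqrt hc1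
    _ = 10 * (τ ^ 2 * τ) + 60 * (√M * (√M / τ ^ 4) * τ) := by
        field_simp
        rw [sq_sqrt hM0.le]
        ring
    _ ≤ 10 * (√M * τ) + 60 * (√M * 1 * τ) := by gcongr
    _ = 70 * √M * τ := by ring

theorem norm_sum_logPhase_le_of_pow_eight_le {c τ : ℝ} (hτ : 1 ≤ τ) (hc1 : τ ^ 6 / 9 ≤ c)
    (hc2 : c ≤ τ ^ 6 / 2) {M L : ℕ} (hM1 : τ ^ 8 ≤ M) (hM2 : (M : ℝ) ≤ τ ^ 12) (hL : L ≤ M) :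
    ‖∑ n ∈ range L, (𝐞 (logPhase c M n) : ℂ)‖ ≤ 18 * √M := by
  have hτ0 : 0 < τ := by linarith
  have hc : 0 < c := lt_of_lt_of_le (by positivity) hc1
  have hM0 : (0 : ℝ) < M := lt_of_lt_of_le (by positivity) hM1
  have hm : √(M : ℝ) / τ ^ 6 ≤ 1 := (div_le_one (by positivity)).2 (sqrt_le_pow hτ0.le hM2)
  have hcM : 2 * c ≤ M := by
    linarith [pow_le_pow_right₀ hτ (by norm_num : 6 ≤ 8)]
  calc _ ≤ 2 * M / c := norm_sum_logPhase_le_first hc (by exact_mod_cast hM0) hL hcM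
    _ ≤ 2 * M / (τ ^ 6 / 9) := by gcongr
    _ = 18 * (√M * (√M / τ ^ 6)) := by
        field_simp
        rw [sq_sqrt hM0.le]
        ring
    _ ≤ 18 * (√M * 1) := by gcongr
    _ = 18 * √M := by rw [mul_one]

theorem norm_sum_logPhase_block_le {c τ : ℝ} (hτ : 1 ≤ τ) (hc1 : τ ^ 6 / 9 ≤ c)
    (hc2 : c ≤ τ ^ 6 / 2) {M L : ℕ} (hMτ : (M : ℝ) ≤ τ ^ 12) (hL : L ≤ M) :
    ‖∑ n ∈ range L, (𝐞 (logPhase c M n) : ℂ)‖ ≤ 70 * √M * τ := by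
  have hτ0 : 0 < τ := by linarith
  have hc2' : c ≤ τ ^ 6 := hc2.trans (half_le_self (by positivity))
  rcases le_total (M : ℝ) (τ ^ 2) with hM2 | hM2
  · calc ‖∑ n ∈ range L, (𝐞 (logPhase c M n) : ℂ)‖ ≤ L := by
          simpa only [card_range] using norm_sum_fourierChar_le_card (logPhase c M) (range L)
      _ ≤ M := by exact_mod_cast hL
      _ = √M * √M := (mul_self_sqrt M.cast_nonneg).symm
      _ ≤ 70 * √M * τ := by
          nlinarith [sqrt_le_iff.2 ⟨hτ0.le, hM2⟩, sqrt_nonneg (M : ℝ),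
            mul_nonneg (sqrt_nonneg (M : ℝ)) hτ0.le]
  rcases le_total (M : ℝ) (τ ^ 4) with hM4 | hM4
  · refine (norm_sum_logPhase_le_of_pow_two_le hτ hc1 hc2' hM2 hM4 hL).trans ?_
    gcongr
    norm_num
  rcases le_total (M : ℝ) (τ ^ 8) with hM8 | hM8
  · exact norm_sum_logPhase_le_of_pow_four_le hτ hc1 hc2' hM4 hM8 hL
  · refine (norm_sum_logPhase_le_of_pow_eight_le hτ hc1 hc2 hM8 hMτ hL).trans ?_
    nlinarith [mul_le_mul_of_nonneg_left hτ (sqrt_nonneg (M : ℝ)), sqrt_nonneg (M : ℝ)]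

theorem sum_range_logPhase_split (c : ℝ) {M N : ℕ} (hM : 1 ≤ M) (hMN : M ≤ N) :
    ∑ n ∈ range N, (𝐞 (logPhase c 1 n) : ℂ) =
      ∑ n ∈ range (M - 1), (𝐞 (logPhase c 1 n) : ℂ) +
        ∑ n ∈ range (N + 1 - M), (𝐞 (logPhase c M n) : ℂ) := by
  rw [show N = (M - 1) + (N + 1 - M) by lia, sum_range_add,
    show M - 1 + (N + 1 - M) + 1 - M = N + 1 - M by lia]
  congr 1
  refine sum_congr rfl fun n _ => ?_
  rw [logPhase, logPhase, Nat.cast_add, Nat.cast_sub hM, Nat.cast_one, ← add_assoc,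
    add_sub_cancel]

theorem norm_sum_logPhase_le {c τ : ℝ} (hτ : 1 ≤ τ) (hc1 : τ ^ 6 / 9 ≤ c) (hc2 : c ≤ τ ^ 6 / 2)
    (N : ℕ) (hN : (N : ℝ) ≤ τ ^ 12) :
    ‖∑ n ∈ range N, (𝐞 (logPhase c 1 n) : ℂ)‖ ≤ 250 * τ * √N := by
  induction N using Nat.strong_induction_on with
  | _ N ih =>
    rcases Nat.eq_zero_or_pos N with rfl | hN0
    · simp
    obtain ⟨M, hM⟩ : ∃ M, M = (N + 2) / 2 := ⟨_, rfl⟩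
    have hM1 : 1 ≤ M := by lia
    have hMN : (M : ℝ) ≤ N := by exact_mod_cast (by lia : M ≤ N)
    have hhead : ‖∑ n ∈ range (M - 1), (𝐞 (logPhase c 1 n) : ℂ)‖ ≤ 250 * τ * √(M - 1 : ℕ) :=
      ih (M - 1) (by lia) (le_trans (by exact_mod_cast (by lia : M - 1 ≤ N)) hN)
    have htail : ‖∑ n ∈ range (N + 1 - M), (𝐞 (logPhase c M n) : ℂ)‖ ≤ 70 * √M * τ :=
      norm_sum_logPhase_block_le hτ hc1 hc2 (hMN.trans hN) (by lia)
    have hsqrt : √((M - 1 : ℕ) : ℝ) ≤ 18 / 25 * √(N : ℝ) := by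
      have hhalf : 2 * ((M - 1 : ℕ) : ℝ) ≤ N := by exact_mod_cast (by lia : 2 * (M - 1) ≤ N)
      refine sqrt_le_iff.2 ⟨by positivity, ?_⟩
      rw [mul_pow, sq_sqrt N.cast_nonneg]
      linarith [N.cast_nonneg (α := ℝ)]
    rw [sum_range_logPhase_split c hM1 (by lia)]
    calc _ ≤ 250 * τ * √(M - 1 : ℕ) + 70 * √M * τ := norm_add_le_of_le hhead htail
      _ ≤ 250 * τ * (18 / 25 * √(N : ℝ)) + 70 * √N * τ := by gcongr
      _ = 250 * τ * √N := by ring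

end LogarithmicPhaseBlocks

section PartialSummation

open Finset Real
open scoped FourierTransform

theorem sum_range_succ_mul_sub (a : ℕ → ℂ) (w : ℕ → ℝ) (n : ℕ) :
    ∑ i ∈ range (n + 1 + 1), (w i : ℂ) * a i - w (n + 1) * ∑ i ∈ range (n + 1 + 1), a i =
      (∑ i ∈ range (n + 1), (w i : ℂ) * a i - w n * ∑ i ∈ range (n + 1), a i) +
        ((w n - w (n + 1) : ℝ) : ℂ) * ∑ i ∈ range (n + 1), a i := by
  rw [sum_range_succ _ (n + 1), sum_range_succ a (n + 1)]
  push_cast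
  ring

theorem norm_sum_mul_le_of_antitone {a : ℕ → ℂ} {w b : ℕ → ℝ} (hw : Antitone w)
    (hw0 : ∀ n, 0 ≤ w n) (N : ℕ) (hb0 : 0 ≤ b 0)
    (hb : ∀ n ≤ N, ‖∑ i ∈ range n, a i‖ ≤ b n) :
    ‖∑ n ∈ range N, (w n : ℂ) * a n‖ ≤ w 0 * b 0 + ∑ n ∈ range N, w n * (b (n + 1) - b n) := by
  rcases N with _ | N
  · simpa using mul_nonneg (hw0 0) hb0
  have hcentred (n : ℕ) (hn : n ≤ N) :
      ‖∑ i ∈ range (n + 1), (w i : ℂ) * a i - w n * ∑ i ∈ range (n + 1), a i‖ ≤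
        w 0 * b 0 + ∑ i ∈ range n, w i * (b (i + 1) - b i) - w n * b n := by
    induction n with
    | zero => simp
    | succ n ih =>
      have hdecr : 0 ≤ w n - w (n + 1) := sub_nonneg.2 (hw n.le_succ)
      have hstep : ‖((w n - w (n + 1) : ℝ) : ℂ) * ∑ i ∈ range (n + 1), a i‖ ≤
          (w n - w (n + 1)) * b (n + 1) := by
        rw [norm_mul, Complex.norm_real, norm_of_nonneg hdecr]
        exact mul_le_mul_of_nonneg_left (hb (n + 1) (by lia)) hdecr
      rw [sum_range_succ_mul_sub, sum_range_succ (fun i => w i * (b (i + 1) - b i))]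
      refine (norm_add_le_of_le (ih (by lia)) hstep).trans (le_of_eq ?_)
      ring
  have hlast : ‖(w N : ℂ) * ∑ i ∈ range (N + 1), a i‖ ≤ w N * b (N + 1) := by
    rw [norm_mul, Complex.norm_real, norm_of_nonneg (hw0 N)]
    exact mul_le_mul_of_nonneg_left (hb (N + 1) le_rfl) (hw0 N)
  have hsum := norm_add_le_of_le (hcentred N le_rfl) hlast
  rw [sub_add_cancel] at hsum
  refine hsum.trans (le_of_eq ?_)
  rw [sum_range_succ (fun i => w i * (b (i + 1) - b i))]
  ring

theorem sqrt_succ_sub_sqrt_le (n : ℕ) :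
    √((n + 1 : ℕ) : ℝ) - √n ≤ ((n : ℝ) + 1) ^ (-(1 / 2) : ℝ) := by
  have hpos : 0 < √((n : ℝ) + 1) := sqrt_pos.2 (by positivity)
  rw [rpow_neg (by positivity), ← sqrt_eq_rpow, ← one_div, Nat.cast_add_one, le_div_iff₀ hpos]
  nlinarith [mul_self_sqrt (show (0 : ℝ) ≤ n + 1 by positivity), sqrt_nonneg (n : ℝ),
    mul_self_sqrt (n.cast_nonneg (α := ℝ)), sqrt_le_sqrt (show (n : ℝ) ≤ n + 1 by linarith)]

theorem exists_norm_sum_rpow_mul_logPhase_le {σ : ℝ} (hσ : 1 / 2 < σ) :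
    ∃ C : ℝ, 0 ≤ C ∧ ∀ c τ : ℝ, 1 ≤ τ → τ ^ 6 / 9 ≤ c → c ≤ τ ^ 6 / 2 → ∀ N : ℕ,
      (N : ℝ) ≤ τ ^ 12 →
      ‖∑ n ∈ range N, ((((n : ℝ) + 1) ^ (-σ) : ℝ) : ℂ) * 𝐞 (logPhase c 1 n)‖ ≤ C * τ := by
  have hsum : Summable fun n : ℕ => ((n : ℝ) + 1) ^ (-(σ + 1 / 2)) := by
    simpa using (summable_nat_add_iff 1).2
      (summable_nat_rpow (p := -(σ + 1 / 2)) |>.2 (by linarith))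
  refine ⟨250 * ∑' n : ℕ, ((n : ℝ) + 1) ^ (-(σ + 1 / 2)), by positivity,
    fun c τ hτ hc1 hc2 N hN => ?_⟩
  have : 0 < τ := by linarith
  have hanti : Antitone fun n : ℕ => ((n : ℝ) + 1) ^ (-σ) := fun m n hmn =>
    rpow_le_rpow_of_nonpos (by positivity) (by gcongr) (by linarith)
  have hterm (n : ℕ) :
      ((n : ℝ) + 1) ^ (-σ) * (250 * τ * √((n + 1 : ℕ) : ℝ) - 250 * τ * √n) ≤
        250 * τ * ((n : ℝ) + 1) ^ (-(σ + 1 / 2)) :=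
    calc _ = 250 * τ * (((n : ℝ) + 1) ^ (-σ) * (√((n + 1 : ℕ) : ℝ) - √n)) := by ring
      _ ≤ 250 * τ * (((n : ℝ) + 1) ^ (-σ) * ((n : ℝ) + 1) ^ (-(1 / 2) : ℝ)) := by
          gcongr
          exact sqrt_succ_sub_sqrt_le n
      _ = _ := by rw [← rpow_add (by positivity), ← neg_add]
  calc _ ≤ ((0 : ℕ) + 1 : ℝ) ^ (-σ) * (250 * τ * √(0 : ℕ)) +
          ∑ n ∈ range N, ((n : ℝ) + 1) ^ (-σ) *
            (250 * τ * √((n + 1 : ℕ) : ℝ) - 250 * τ * √n) :=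
        norm_sum_mul_le_of_antitone hanti (fun n => by positivity) N (by simp) fun n hn =>
          norm_sum_logPhase_le hτ hc1 hc2 n (le_trans (by exact_mod_cast hn) hN)
    _ ≤ ∑ n ∈ range N, 250 * τ * ((n : ℝ) + 1) ^ (-(σ + 1 / 2)) := by
        rw [Nat.cast_zero, sqrt_zero, mul_zero, mul_zero, zero_add]
        exact sum_le_sum fun n _ => hterm n
    _ ≤ 250 * τ * ∑' n : ℕ, ((n : ℝ) + 1) ^ (-(σ + 1 / 2)) := by
        rw [← mul_sum]
        gcongr
        exact hsum.sum_le_tsum _ fun n _ => by positivity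
    _ = _ := by ring

end PartialSummation

/-! ### The Riemann zeta function to the right of the critical line -/

section Zeta

open Finset Complex
open scoped FourierTransform

theorem hasDerivAt_ofReal_cpow_of_pos {u : ℝ} (hu : 0 < u) (a : ℂ) :
    HasDerivAt (fun y : ℝ => (y : ℂ) ^ a) (a * (u : ℂ) ^ (a - 1)) u := by
  have hcpow := (hasDerivAt_id (u : ℂ)).cpow_const (c := a) (Or.inl (by simpa using hu))
  simpa using hcpow.comp_ofReal

theorem norm_cpow_neg_sub_cpow_neg_le {a u v : ℝ} (ha : 1 ≤ a) (hu : a ≤ u) (huv : u ≤ v) {s : ℂ}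
    (hs : 1 / 2 ≤ s.re) :
    ‖(v : ℂ) ^ (-s) - (u : ℂ) ^ (-s)‖ ≤ ‖s‖ * a ^ (-(3 / 2) : ℝ) * (v - u) := by
  have ha0 : 0 < a := by linarith
  have hderiv (y : ℝ) (hy : y ∈ Set.Icc u v) :
      ‖-s * (y : ℂ) ^ (-s - 1)‖ ≤ ‖s‖ * a ^ (-(3 / 2) : ℝ) := by
    have hay : a ≤ y := hu.trans hy.1
    rw [norm_mul, norm_neg, norm_cpow_eq_rpow_re_of_pos (ha0.trans_le hay)]
    gcongr
    calc y ^ (-s - 1).re ≤ y ^ (-(3 / 2) : ℝ) :=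
          Real.rpow_le_rpow_of_exponent_le (ha.trans hay)
            (by rw [sub_re, neg_re, one_re]; linarith)
      _ ≤ a ^ (-(3 / 2) : ℝ) := Real.rpow_le_rpow_of_nonpos ha0 hay (by norm_num)
  have hmvt := (convex_Icc u v).norm_image_sub_le_of_norm_hasDerivWithin_le
    (fun y hy =>
      (hasDerivAt_ofReal_cpow_of_pos (ha0.trans_le (hu.trans hy.1)) (-s)).hasDerivWithinAt)
    hderiv (Set.left_mem_Icc.2 huv) (Set.right_mem_Icc.2 huv)
  rwa [Real.norm_of_nonneg (by linarith)] at hmvt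

/-- The difference between `(s - 1) * (n + 1) ^ (-s)` and `(s - 1) * ∫ x in n..n + 1, x ^ (-s)`. -/
noncomputable def zetaTerm (n : ℕ) (s : ℂ) : ℂ :=
  (s - 1) * ((n : ℂ) + 1) ^ (-s) + (((n : ℂ) + 1) ^ (1 - s) - (n : ℂ) ^ (1 - s))

theorem norm_zetaTerm_le {n : ℕ} (hn : 1 ≤ n) {s : ℂ} (hs : 1 / 2 ≤ s.re) :
    ‖zetaTerm n s‖ ≤ ‖s - 1‖ * ‖s‖ * (n : ℝ) ^ (-(3 / 2) : ℝ) := by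
  have hn1 : (1 : ℝ) ≤ n := by exact_mod_cast hn
  have hn2 : (n : ℝ) ≤ n + 1 := by linarith
  let f (y : ℝ) : ℂ := (s - 1) * (((n + 1 : ℝ) : ℂ) ^ (-s) * y) + (y : ℂ) ^ (1 - s)
  have hderiv (y : ℝ) (hy : y ∈ Set.Icc (n : ℝ) (n + 1)) :
      HasDerivWithinAt f ((s - 1) * (((n + 1 : ℝ) : ℂ) ^ (-s) - (y : ℂ) ^ (-s)))
        (Set.Icc (n : ℝ) (n + 1)) y := by
    have hpow := hasDerivAt_ofReal_cpow_of_pos (by linarith [hy.1] : 0 < y) (1 - s)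
    have hlin := (((hasDerivAt_id (y : ℂ)).const_mul (((n + 1 : ℝ) : ℂ) ^ (-s))).const_mul
      (s - 1)).comp_ofReal
    refine ((hlin.add hpow).congr_deriv ?_).hasDerivWithinAt
    rw [sub_sub_cancel_left]
    ring
  have hbound (y : ℝ) (hy : y ∈ Set.Icc (n : ℝ) (n + 1)) :
      ‖(s - 1) * (((n + 1 : ℝ) : ℂ) ^ (-s) - (y : ℂ) ^ (-s))‖ ≤
        ‖s - 1‖ * ‖s‖ * (n : ℝ) ^ (-(3 / 2) : ℝ) := by
    rw [norm_mul, mul_assoc]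
    gcongr
    refine (norm_cpow_neg_sub_cpow_neg_le hn1 hy.1 hy.2 hs).trans ?_
    exact mul_le_of_le_one_right (by positivity) (by linarith [hy.1])
  have hmvt := (convex_Icc (n : ℝ) (n + 1)).norm_image_sub_le_of_norm_hasDerivWithin_le
    hderiv hbound (Set.left_mem_Icc.2 hn2) (Set.right_mem_Icc.2 hn2)
  rw [add_sub_cancel_left, norm_one, mul_one] at hmvt
  have hterm : zetaTerm n s = f (n + 1) - f n := by
    simp only [zetaTerm, f]
    push_cast
    ring
  rwa [hterm]

theorem rpow_neg_three_halves_le {n : ℕ} (hn : 1 ≤ n) :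
    (n : ℝ) ^ (-(3 / 2) : ℝ) ≤ 6 * (1 / √(n : ℝ) - 1 / √((n : ℝ) + 1)) := by
  have hn1 : (1 : ℝ) ≤ n := by exact_mod_cast hn
  have ha0 : 0 < √(n : ℝ) := Real.sqrt_pos.2 (by linarith)
  have hb0 : 0 < √((n : ℝ) + 1) := Real.sqrt_pos.2 (by linarith)
  have haa : √(n : ℝ) ^ 2 = n := Real.sq_sqrt (by linarith)
  have hbb : √((n : ℝ) + 1) ^ 2 = n + 1 := Real.sq_sqrt (by linarith)
  have hpow : (n : ℝ) ^ (-(3 / 2) : ℝ) = 1 / √(n : ℝ) ^ 3 := by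
    rw [Real.rpow_neg (by linarith), Real.sqrt_eq_rpow, ← Real.rpow_natCast,
      ← Real.rpow_mul (by linarith), one_div]
    norm_num
  rw [hpow]
  generalize √(n : ℝ) = a at *
  generalize √((n : ℝ) + 1) = b at *
  have hdiff : 1 / a - 1 / b = 1 / (a * b * (a + b)) := by
    rw [div_sub_div _ _ ha0.ne' hb0.ne', div_eq_div_iff (by positivity) (by positivity)]
    linear_combination (a * b) * (hbb - haa)
  have hb2 : b ≤ 3 / 2 * a := by nlinarith
  rw [hdiff, mul_one_div, div_le_div_iff₀ (by positivity) (by positivity)]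
  calc 1 * (a * b * (a + b)) ≤ a * (3 / 2 * a) * (a + 3 / 2 * a) := by rw [one_mul]; gcongr
    _ ≤ 6 * a ^ 3 := by linarith [pow_pos ha0 3, show a * (3 / 2 * a) * (a + 3 / 2 * a) =
        15 / 4 * a ^ 3 by ring]

theorem sum_rpow_neg_three_halves_le {N : ℕ} (hN : 1 ≤ N) (K : ℕ) :
    ∑ n ∈ range K, ((N + n : ℕ) : ℝ) ^ (-(3 / 2) : ℝ) ≤ 6 / √(N : ℝ) := by
  calc ∑ n ∈ range K, ((N + n : ℕ) : ℝ) ^ (-(3 / 2) : ℝ)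
      ≤ ∑ n ∈ range K, 6 * (1 / √((N + n : ℕ) : ℝ) - 1 / √((N + (n + 1) : ℕ) : ℝ)) :=
        sum_le_sum fun n _ => by
          rw [← add_assoc, Nat.cast_add_one (N + n)]
          exact rpow_neg_three_halves_le (by lia)
    _ = 6 * (1 / √(N : ℝ) - 1 / √((N + K : ℕ) : ℝ)) := by
        rw [← mul_sum, sum_range_sub', add_zero]
    _ ≤ 6 * (1 / √(N : ℝ)) := by
        gcongr
        exact sub_le_self _ (by positivity)
    _ = 6 / √(N : ℝ) := mul_one_div _ _

theorem summable_rpow_neg_three_halves :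
    Summable fun n : ℕ => ((n + 1 : ℕ) : ℝ) ^ (-(3 / 2) : ℝ) :=
  (summable_nat_add_iff 1).2 (Real.summable_nat_rpow.2 (by norm_num))

theorem summable_zetaTerm {s : ℂ} (hs : 1 / 2 ≤ s.re) :
    Summable fun n : ℕ => zetaTerm (n + 1) s :=
  .of_norm_bounded (summable_rpow_neg_three_halves.mul_left (‖s - 1‖ * ‖s‖))
    fun n => norm_zetaTerm_le n.succ_pos hs

theorem norm_tsum_zetaTerm_le {s : ℂ} (hs : 1 / 2 ≤ s.re) (N : ℕ) :
    ‖∑' n : ℕ, zetaTerm (n + N + 1) s‖ ≤ ‖s - 1‖ * (6 * ‖s‖ / √((N : ℝ) + 1)) := by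
  have hsum : Summable fun n : ℕ => ((N + 1 + n : ℕ) : ℝ) ^ (-(3 / 2) : ℝ) :=
    ((summable_nat_add_iff N).2 summable_rpow_neg_three_halves).congr fun n => by
      rw [show n + N + 1 = N + 1 + n by lia]
  have htail : ∑' n : ℕ, ((N + 1 + n : ℕ) : ℝ) ^ (-(3 / 2) : ℝ) ≤ 6 / √((N : ℝ) + 1) :=
    Real.tsum_le_of_sum_range_le (fun n => by positivity) fun K => by
      exact_mod_cast sum_rpow_neg_three_halves_le N.succ_pos K
  calc ‖∑' n : ℕ, zetaTerm (n + N + 1) s‖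
      ≤ ∑' n : ℕ, ‖s - 1‖ * ‖s‖ * ((N + 1 + n : ℕ) : ℝ) ^ (-(3 / 2) : ℝ) :=
        tsum_of_norm_bounded (hsum.mul_left _).hasSum fun n => by
          rw [add_assoc n, add_comm n]
          exact norm_zetaTerm_le (by lia) hs
    _ ≤ ‖s - 1‖ * ‖s‖ * (6 / √((N : ℝ) + 1)) := by rw [tsum_mul_left]; gcongr
    _ = _ := by ring

theorem sum_zetaTerm (s : ℂ) (N : ℕ) :
    ∑ n ∈ range N, zetaTerm (n + 1) s =
      (s - 1) * ∑ n ∈ range (N + 1), ((n : ℂ) + 1) ^ (-s) + ((N : ℂ) + 1) ^ (1 - s) - s := by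
  induction N with
  | zero => simp
  | succ N ih =>
    rw [sum_range_succ, ih, sum_range_succ _ (N + 1), zetaTerm]
    push_cast
    ring

theorem norm_natCast_add_one_cpow (n : ℕ) (s : ℂ) :
    ‖((n : ℂ) + 1) ^ s‖ = ((n : ℝ) + 1) ^ s.re := by
  exact_mod_cast norm_natCast_cpow_of_pos n.succ_pos s

theorem hasSum_natCast_add_one_cpow_neg {s : ℂ} (hs : 1 < s.re) :
    HasSum (fun n : ℕ => ((n : ℂ) + 1) ^ (-s)) (riemannZeta s) := by
  have hsum : Summable fun n : ℕ => 1 / ((n : ℂ) + 1) ^ s := by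
    simpa using (summable_nat_add_iff 1).2 (summable_one_div_nat_cpow.2 hs)
  rw [zeta_eq_tsum_one_div_nat_add_one_cpow hs]
  simpa only [cpow_neg, one_div] using hsum.hasSum

theorem add_tsum_zetaTerm_of_one_lt_re {s : ℂ} (hs : 1 < s.re) :
    s + ∑' n : ℕ, zetaTerm (n + 1) s = riemannZeta₁ s := by
  have hs1 : s ≠ 1 := fun h => by rw [h, one_re] at hs; exact lt_irrefl _ hs
  have hpow : Filter.Tendsto (fun N : ℕ => ((N : ℂ) + 1) ^ (1 - s)) Filter.atTop (nhds 0) := by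
    rw [tendsto_zero_iff_norm_tendsto_zero]
    simp_rw [norm_natCast_add_one_cpow, sub_re, one_re, ← neg_sub s.re]
    exact (tendsto_rpow_neg_atTop (by linarith)).comp
      (Filter.tendsto_atTop_add_const_right _ _ tendsto_natCast_atTop_atTop)
  have hlim := (summable_zetaTerm (by linarith : 1 / 2 ≤ s.re)).hasSum.tendsto_sum_nat
  simp_rw [sum_zetaTerm] at hlim
  have hlim' := ((((hasSum_natCast_add_one_cpow_neg hs).tendsto_sum_nat.comp
    (Filter.tendsto_add_atTop_nat 1)).const_mul (s - 1)).add hpow).sub_const s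
  have hsub : s - 1 ≠ 0 := sub_ne_zero.2 hs1
  rw [tendsto_nhds_unique hlim hlim', riemannZeta_eq_inv_sub_mul hs1]
  field_simp
  ring

theorem differentiable_zetaTerm (n : ℕ) : Differentiable ℂ (zetaTerm (n + 1)) := fun s => by
  have hn (m : ℕ) : ((m + 1 : ℕ) : ℂ) ≠ 0 := Nat.cast_ne_zero.2 m.succ_ne_zero
  have hone : DifferentiableAt ℂ (fun s : ℂ => 1 - s) s := by fun_prop
  have hneg : DifferentiableAt ℂ (fun s : ℂ => -s) s := by fun_prop
  have hsub : DifferentiableAt ℂ (fun s : ℂ => s - 1) s := by fun_prop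
  have hn2 : ((n + 1 : ℕ) : ℂ) + 1 ≠ 0 := by exact_mod_cast hn (n + 1)
  exact (hsub.mul (hneg.const_cpow (Or.inl hn2))).add
    ((hone.const_cpow (Or.inl hn2)).sub (hone.const_cpow (Or.inl (hn n))))

theorem differentiableOn_tsum_zetaTerm :
    DifferentiableOn ℂ (fun s => ∑' n : ℕ, zetaTerm (n + 1) s) {s | 1 / 2 < s.re} := by
  intro s₀ hs₀
  have hopen : IsOpen ({s : ℂ | 1 / 2 < s.re} ∩ Metric.ball s₀ 1) :=
    (isOpen_re_gt _).inter Metric.isOpen_ball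
  have hlocal := differentiableOn_tsum_of_summable_norm
    (summable_rpow_neg_three_halves.mul_left ((‖s₀‖ + 2) * (‖s₀‖ + 2)))
    (fun n => (differentiable_zetaTerm n).differentiableOn) hopen fun n s hs => ?_
  · exact (hlocal.differentiableAt
      (hopen.mem_nhds ⟨hs₀, Metric.mem_ball_self one_pos⟩)).differentiableWithinAt
  · have hnorm : ‖s‖ ≤ ‖s₀‖ + 1 := by
      linarith [norm_sub_norm_le s s₀, mem_ball_iff_norm.1 hs.2]
    have hnorm_sub : ‖s - 1‖ ≤ ‖s₀‖ + 2 := by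
      linarith [norm_sub_le s 1, norm_one (α := ℂ)]
    refine (norm_zetaTerm_le n.succ_pos hs.1.le).trans ?_
    gcongr
    linarith

theorem add_tsum_zetaTerm {s : ℂ} (hs : 1 / 2 < s.re) :
    s + ∑' n : ℕ, zetaTerm (n + 1) s = riemannZeta₁ s := by
  have hseries : AnalyticOnNhd ℂ (fun s => s + ∑' n : ℕ, zetaTerm (n + 1) s)
      {s | 1 / 2 < s.re} :=
    (differentiableOn_id.add differentiableOn_tsum_zetaTerm).analyticOnNhd (isOpen_re_gt _)
  have hzeta : AnalyticOnNhd ℂ riemannZeta₁ {s | 1 / 2 < s.re} :=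
    differentiable_riemannZeta₁.differentiableOn.analyticOnNhd (isOpen_re_gt _)
  refine hseries.eqOn_of_preconnected_of_eventuallyEq hzeta
    (convex_halfSpace_re_gt (1 / 2)).isPreconnected (z₀ := 2) (by norm_num) ?_ hs
  filter_upwards [(isOpen_re_gt 1).mem_nhds (show (2 : ℂ) ∈ {s : ℂ | 1 < s.re} by norm_num)]
    with z hz using add_tsum_zetaTerm_of_one_lt_re hz

theorem norm_riemannZeta_le {s : ℂ} (hs : 1 / 2 < s.re) (hs1 : s ≠ 1) (N : ℕ) :
    ‖riemannZeta s‖ ≤ ‖∑ n ∈ range (N + 1), ((n : ℂ) + 1) ^ (-s)‖ +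
      ((N : ℝ) + 1) ^ (1 - s.re) / ‖s - 1‖ + 6 * ‖s‖ / √((N : ℝ) + 1) := by
  have hsub : s - 1 ≠ 0 := sub_ne_zero.2 hs1
  have happrox : riemannZeta s = ∑ n ∈ range (N + 1), ((n : ℂ) + 1) ^ (-s) +
      ((N : ℂ) + 1) ^ (1 - s) / (s - 1) + (∑' n : ℕ, zetaTerm (n + N + 1) s) / (s - 1) := by
    rw [riemannZeta_eq_inv_sub_mul hs1, ← add_tsum_zetaTerm hs,
      ← (summable_zetaTerm hs.le).sum_add_tsum_nat_add N, sum_zetaTerm]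
    field_simp
    ring
  rw [happrox]
  refine norm_add₃_le.trans (add_le_add (add_le_add le_rfl (le_of_eq ?_)) ?_)
  · rw [norm_div, norm_natCast_add_one_cpow, sub_re, one_re]
  · rw [norm_div, div_le_iff₀ (norm_pos_iff.2 hsub), mul_comm]
    exact norm_tsum_zetaTerm_le hs.le N

theorem norm_riemannZeta_le_one_add {s : ℂ} (hs : 1 / 2 < s.re) (hs1 : s ≠ 1) :
    ‖riemannZeta s‖ ≤ 1 + 1 / ‖s - 1‖ + 6 * ‖s‖ := by
  simpa using norm_riemannZeta_le hs hs1 0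

theorem norm_riemannZeta_le_of_one_le_abs_im {s : ℂ} (hs : 1 / 2 < s.re) (him : 1 ≤ |s.im|) :
    ‖riemannZeta s‖ ≤ 8 * ‖s‖ := by
  have hne : s ≠ 1 := by
    rintro rfl
    norm_num at him
  have hsub : 1 ≤ ‖s - 1‖ := him.trans (by simpa using abs_im_le_norm (s - 1))
  have hinv : 1 / ‖s - 1‖ ≤ 1 := (div_le_one (by linarith)).2 hsub
  linarith [norm_riemannZeta_le_one_add hs hne, him.trans (abs_im_le_norm s)]

theorem ofReal_add_mul_I_ne_one {σ : ℝ} (hσ : σ ≠ 1) (t : ℝ) : (σ : ℂ) + t * I ≠ 1 := fun h =>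
  hσ (by simpa using congrArg re h)

theorem norm_ofReal_add_mul_I_le {σ t : ℝ} (hσ0 : 0 ≤ σ) (hσ1 : σ ≤ 1) (ht : 0 ≤ t) :
    ‖(σ : ℂ) + t * I‖ ≤ 1 + t := by
  refine norm_add_le_of_le ?_ (le_of_eq ?_)
  · rwa [norm_real, Real.norm_of_nonneg hσ0]
  · rw [norm_mul, norm_I, mul_one, norm_real, Real.norm_of_nonneg ht]

theorem norm_riemannZeta_le_of_le_one {σ : ℝ} (hσ : 1 / 2 < σ) (hσ1 : σ < 1) {t : ℝ} (ht : 0 ≤ t)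
    (ht1 : t ≤ 1) : ‖riemannZeta (σ + t * I)‖ ≤ 13 + 1 / (1 - σ) := by
  have hsub : 1 - σ ≤ ‖(σ : ℂ) + t * I - 1‖ := by
    have hre := abs_re_le_norm ((σ : ℂ) + t * I - 1)
    rw [show ((σ : ℂ) + t * I - 1).re = σ - 1 by simp] at hre
    linarith [neg_abs_le (σ - 1)]
  have hinv := one_div_le_one_div_of_le (by linarith) hsub
  have hzeta := norm_riemannZeta_le_one_add (s := σ + t * I) (by simpa using hσ)
    (ofReal_add_mul_I_ne_one hσ1.ne t)
  linarith [norm_ofReal_add_mul_I_le (by linarith) hσ1.le ht]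

theorem exists_norm_riemannZeta_le_norm_sum {σ : ℝ} (hσ : 1 / 2 < σ) (hσ1 : σ < 1) {t : ℝ}
    (ht : 1 ≤ t) :
    ∃ K : ℕ, (K : ℝ) ≤ t ^ 2 ∧
      ‖riemannZeta (σ + t * I)‖ ≤ ‖∑ n ∈ range K, ((n : ℂ) + 1) ^ (-((σ : ℂ) + t * I))‖ + 25 := by
  obtain ⟨N, hN⟩ : ∃ N, N + 1 = ⌊t ^ 2⌋₊ :=
    Nat.exists_add_one_eq.2 (Nat.floor_pos.2 (one_le_pow₀ ht))
  have hle : (N : ℝ) + 1 ≤ t ^ 2 := by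
    exact_mod_cast hN ▸ Nat.floor_le (sq_nonneg t)
  have hge : t ^ 2 < (N : ℝ) + 1 + 1 := by
    exact_mod_cast hN ▸ Nat.lt_floor_add_one (t ^ 2)
  refine ⟨N + 1, by exact_mod_cast hle, ?_⟩
  have hpole : ((N : ℝ) + 1) ^ (1 - σ) / ‖(σ : ℂ) + t * I - 1‖ ≤ 1 := by
    have him : t ≤ ‖(σ : ℂ) + t * I - 1‖ :=
      (le_abs_self t).trans (by simpa using abs_im_le_norm ((σ : ℂ) + t * I - 1))
    rw [div_le_one (by linarith)]
    refine le_trans ?_ him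
    calc ((N : ℝ) + 1) ^ (1 - σ) ≤ ((N : ℝ) + 1) ^ (1 / 2 : ℝ) :=
          Real.rpow_le_rpow_of_exponent_le (by linarith [N.cast_nonneg (α := ℝ)]) (by linarith)
      _ ≤ (t ^ 2) ^ (1 / 2 : ℝ) := Real.rpow_le_rpow (by positivity) hle (by norm_num)
      _ = t := by rw [← Real.sqrt_eq_rpow, Real.sqrt_sq (by linarith)]
  have htail : 6 * ‖(σ : ℂ) + t * I‖ / √((N : ℝ) + 1) ≤ 24 := by
    have hsqrt : t / 2 ≤ √((N : ℝ) + 1) :=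
      Real.le_sqrt_of_sq_le (by nlinarith [N.cast_nonneg (α := ℝ)])
    rw [div_le_iff₀ (by linarith)]
    linarith [norm_ofReal_add_mul_I_le (by linarith) hσ1.le (by linarith : 0 ≤ t)]
  have hzeta := norm_riemannZeta_le (s := σ + t * I) (by simpa using hσ)
    (ofReal_add_mul_I_ne_one hσ1.ne t) N
  rw [show ((σ : ℂ) + t * I).re = σ by simp] at hzeta
  linarith

theorem natCast_add_one_cpow_neg (n : ℕ) (σ t : ℝ) :
    ((n : ℂ) + 1) ^ (-((σ : ℂ) + t * I)) =
      ((((n : ℝ) + 1) ^ (-σ) : ℝ) : ℂ) * 𝐞 (logPhase (t / (2 * Real.pi)) 1 n) := by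
  have hn : (n : ℂ) + 1 ≠ 0 := n.cast_add_one_ne_zero
  have hlog : Complex.log ((n : ℂ) + 1) = (Real.log (n + 1) : ℝ) := by
    rw [ofReal_log (by positivity)]
    push_cast
    rfl
  have hπ : (Real.pi : ℂ) ≠ 0 := ofReal_ne_zero.2 Real.pi_ne_zero
  rw [neg_add, cpow_add _ _ hn, ofReal_cpow (by positivity)]
  push_cast
  congr 1
  rw [cpow_def_of_ne_zero hn, Real.fourierChar_apply, logPhase, hlog, Nat.cast_one, add_comm 1]
  congr 1
  push_cast
  field_simp

theorem exists_norm_riemannZeta_le_of_nonneg {σ : ℝ} (hσ : 1 / 2 < σ) (hσ1 : σ < 1) :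
    ∃ C : ℝ, 0 ≤ C ∧ ∀ t : ℝ, 0 ≤ t →
      ‖riemannZeta (σ + t * I)‖ ≤ C * (1 + t) ^ (1 / 6 : ℝ) := by
  obtain ⟨C, hC, hsum⟩ := exists_norm_sum_rpow_mul_logPhase_le hσ
  have hinv : 0 ≤ 1 / (1 - σ) := one_div_nonneg.2 (by linarith)
  refine ⟨C + 25 + 1 / (1 - σ), by positivity, fun t ht => ?_⟩
  have hone : 1 ≤ (1 + t) ^ (1 / 6 : ℝ) := Real.one_le_rpow (by linarith) (by norm_num)
  rcases le_total t 1 with ht1 | ht1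
  · calc _ ≤ 13 + 1 / (1 - σ) := norm_riemannZeta_le_of_le_one hσ hσ1 ht ht1
      _ ≤ (C + 25 + 1 / (1 - σ)) * 1 := by linarith
      _ ≤ _ := by gcongr
  · obtain ⟨K, hK, hzeta⟩ := exists_norm_riemannZeta_le_norm_sum hσ hσ1 ht1
    have hτ6 : (t ^ (1 / 6 : ℝ)) ^ 6 = t := by
      rw [← Real.rpow_natCast, ← Real.rpow_mul ht]
      norm_num
    have hpoly : ‖∑ n ∈ range K, ((n : ℂ) + 1) ^ (-((σ : ℂ) + t * I))‖ ≤ C * t ^ (1 / 6 : ℝ) := by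
      rw [sum_congr rfl fun n _ => natCast_add_one_cpow_neg n σ t]
      refine hsum _ _ (Real.one_le_rpow ht1 (by norm_num)) ?_ ?_ K ?_
      · rw [hτ6]
        gcongr
        linarith [Real.pi_lt_four]
      · rw [hτ6]
        gcongr
        linarith [Real.pi_gt_three]
      · rwa [pow_mul _ 6 2, hτ6]
    calc _ ≤ C * t ^ (1 / 6 : ℝ) + 25 := hzeta.trans (by gcongr)
      _ ≤ C * (1 + t) ^ (1 / 6 : ℝ) + (25 + 1 / (1 - σ)) * 1 := by
          gcongr
          · linarith
          · linarith
      _ ≤ C * (1 + t) ^ (1 / 6 : ℝ) + (25 + 1 / (1 - σ)) * (1 + t) ^ (1 / 6 : ℝ) := by gcongr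
      _ = _ := by ring

/-- The **Weyl bound** for the zeta function on vertical lines to the right of the critical line. -/
theorem exists_norm_riemannZeta_le {σ : ℝ} (hσ : 1 / 2 < σ) (hσ1 : σ < 1) :
    ∃ C : ℝ, 0 ≤ C ∧ ∀ t : ℝ,
      ‖riemannZeta (σ + t * I)‖ ≤ C * (1 + |t|) ^ (1 / 6 : ℝ) := by
  obtain ⟨C, hC, hbound⟩ := exists_norm_riemannZeta_le_of_nonneg hσ hσ1
  refine ⟨C, hC, fun t => ?_⟩
  rcases le_total 0 t with ht | ht
  · rw [abs_of_nonneg ht]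
    exact hbound t ht
  · have hconj : (σ : ℂ) + ((-t : ℝ) : ℂ) * I = (starRingEnd ℂ) (σ + t * I) := by
      simp [conj_ofReal]
    have hneg := hbound (-t) (by linarith)
    rw [hconj, riemannZeta_conj, RCLike.norm_conj] at hneg
    rwa [abs_of_nonpos ht]

end Zeta

/-! ### Laplace transforms and contour integrals -/

section Laplace

open MeasureTheory Set Complex

/-- Measurable functions that vanish on the negative half-line and are `O(exp (b * y))`; their
Laplace transform converges absolutely to the right of `b`. -/
structure CausalExpBound (b : ℝ) (f : ℝ → ℂ) : Prop where
  aestronglyMeasurable : AEStronglyMeasurable f volume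
  eq_zero_of_neg : ∀ y < 0, f y = 0
  exists_norm_le : ∃ C : ℝ, 0 ≤ C ∧ ∀ y, ‖f y‖ ≤ C * Real.exp (b * y)

/-- The two-sided Laplace transform. -/
noncomputable def laplaceTransform (f : ℝ → ℂ) (s : ℂ) : ℂ := ∫ y : ℝ, f y * cexp (-(s * y))

/-- The primitive of `f` that vanishes at `-∞`. -/
noncomputable def integralIic (f : ℝ → ℂ) (y : ℝ) : ℂ := ∫ v in Iic y, f v

theorem integrable_indicator_Ici_exp_neg_mul {s : ℂ} (hs : 0 < s.re) :
    Integrable ((Ici (0 : ℝ)).indicator fun y => cexp (-s * y)) := by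
  rw [integrable_indicator_iff measurableSet_Ici, integrableOn_Ici_iff_integrableOn_Ioi]
  exact integrableOn_exp_mul_complex_Ioi (by simpa using hs) 0

theorem integral_indicator_Ici_exp_neg_mul {s : ℂ} (hs : 0 < s.re) :
    ∫ y, (Ici (0 : ℝ)).indicator (fun y => cexp (-s * y)) y = 1 / s := by
  rw [integral_indicator measurableSet_Ici, integral_Ici_eq_integral_Ioi,
    integral_exp_mul_complex_Ioi (by simpa using hs)]
  simp

theorem integralIic_eq_zero {f : ℝ → ℂ} (hf : ∀ y < 0, f y = 0) {y : ℝ} (hy : y ≤ 0) :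
    integralIic f y = 0 := by
  rw [integralIic, integral_Iic_eq_integral_Iio]
  exact setIntegral_eq_zero_of_forall_eq_zero fun v hv => hf v (lt_of_lt_of_le hv hy)

open scoped FourierTransform in
theorem fourier_mul_exp_neg (f : ℝ → ℂ) (c ξ : ℝ) :
    𝓕 (fun y : ℝ => f y * cexp (-((c : ℂ) * y))) ξ =
      laplaceTransform f (c + ((2 * Real.pi * ξ : ℝ) : ℂ) * I) := by
  rw [Real.fourier_real_eq_integral_exp_smul, laplaceTransform]
  congr with v
  rw [smul_eq_mul, mul_left_comm, ← exp_add]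
  push_cast
  ring_nf

namespace CausalExpBound

variable {b : ℝ} {f g : ℝ → ℂ}

theorem integrable_mul_exp (hf : CausalExpBound b f) {s : ℂ} (hs : b < s.re) :
    Integrable fun y : ℝ => f y * cexp (-(s * y)) := by
  obtain ⟨C, hC, hbound⟩ := hf.exists_norm_le
  have hdom : Integrable ((Ici (0 : ℝ)).indicator fun y => C * Real.exp (-(s.re - b) * y)) := by
    rw [integrable_indicator_iff measurableSet_Ici, integrableOn_Ici_iff_integrableOn_Ioi]
    exact (exp_neg_integrableOn_Ioi 0 (sub_pos.2 hs)).const_mul C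
  refine hdom.mono' (hf.aestronglyMeasurable.mul (by fun_prop)) (.of_forall fun y => ?_)
  rcases lt_or_ge y 0 with hy | hy
  · rw [hf.eq_zero_of_neg y hy, zero_mul, norm_zero]
    exact indicator_nonneg (fun _ _ => by positivity) _
  · rw [norm_mul, norm_exp, neg_re, re_mul_ofReal, indicator_of_mem (mem_Ici.2 hy)]
    calc ‖f y‖ * Real.exp (-(s.re * y)) ≤ C * Real.exp (b * y) * Real.exp (-(s.re * y)) := by
          gcongr
          exact hbound y
      _ = C * Real.exp (-(s.re - b) * y) := by
          rw [mul_assoc, ← Real.exp_add]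
          ring_nf

theorem integrableOn_Iic (hb : 0 < b) (hf : CausalExpBound b f) (y : ℝ) :
    IntegrableOn f (Iic y) := by
  obtain ⟨C, -, hbound⟩ := hf.exists_norm_le
  exact ((integrableOn_exp_mul_Iic hb y).const_mul C).mono' hf.aestronglyMeasurable.restrict
    (.of_forall hbound)

theorem intervalIntegrable (hb : 0 < b) (hf : CausalExpBound b f) (x y : ℝ) :
    IntervalIntegrable f volume x y :=
  ((hf.integrableOn_Iic hb (max x y)).mono_set fun _ hz => hz.2).intervalIntegrable

theorem integralIic_sub (hb : 0 < b) (hf : CausalExpBound b f) (x y : ℝ) :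
    integralIic f y - integralIic f x = ∫ v in x..y, f v :=
  intervalIntegral.integral_Iic_sub_Iic (hf.integrableOn_Iic hb x) (hf.integrableOn_Iic hb y)

theorem continuous_integralIic (hb : 0 < b) (hf : CausalExpBound b f) :
    Continuous (integralIic f) := by
  have heq : integralIic f = fun y => integralIic f 0 + ∫ v in (0 : ℝ)..y, f v :=
    funext fun y => by rw [← hf.integralIic_sub hb, add_sub_cancel]
  rw [heq]
  exact continuous_const.add (intervalIntegral.continuous_primitive (hf.intervalIntegrable hb) 0)

protected theorem integralIic (hb : 0 < b) (hf : CausalExpBound b f) :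
    CausalExpBound b (integralIic f) := by
  obtain ⟨C, hC, hbound⟩ := hf.exists_norm_le
  refine ⟨(hf.continuous_integralIic hb).aestronglyMeasurable,
    fun y hy => integralIic_eq_zero hf.eq_zero_of_neg hy.le, C / b, by positivity, fun y => ?_⟩
  calc ‖∫ v in Iic y, f v‖ ≤ ∫ v in Iic y, C * Real.exp (b * v) :=
        norm_integral_le_of_norm_le ((integrableOn_exp_mul_Iic hb y).const_mul C)
          (.of_forall hbound)
    _ = C / b * Real.exp (b * y) := by
        rw [integral_const_mul, integral_exp_mul_Iic hb]
        ring

theorem iterate_integralIic (hb : 0 < b) (hf : CausalExpBound b f) (m : ℕ) :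
    CausalExpBound b (integralIic^[m] f) := by
  induction m with
  | zero => exact hf
  | succ m ih =>
    rw [Function.iterate_succ_apply']
    exact ih.integralIic hb

/-- A primitive is a convolution with the unit step. -/
theorem laplaceTransform_integralIic (hb : 0 < b) (hf : CausalExpBound b f) {s : ℂ}
    (hs : b < s.re) : laplaceTransform (integralIic f) s = laplaceTransform f s / s := by
  have hconv := integral_convolution (ContinuousLinearMap.mul ℝ ℂ) (ν := volume) (μ := volume)
    (hf.integrable_mul_exp hs) (integrable_indicator_Ici_exp_neg_mul (hb.trans hs))
  rw [integral_indicator_Ici_exp_neg_mul (hb.trans hs), ContinuousLinearMap.mul_apply',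
    mul_one_div] at hconv
  rw [laplaceTransform, laplaceTransform, ← hconv]
  congr with y
  simp only [convolution_def, ContinuousLinearMap.mul_apply']
  rw [integralIic, ← integral_indicator measurableSet_Iic, ← integral_mul_const]
  congr with v
  by_cases hv : v ≤ y
  · rw [indicator_of_mem (mem_Iic.2 hv), indicator_of_mem (mem_Ici.2 (sub_nonneg.2 hv)), mul_assoc,
      ← exp_add]
    push_cast
    ring_nf
  · rw [indicator_of_notMem (by simpa using hv), indicator_of_notMem (by simpa using hv), zero_mul,
      mul_zero]

theorem laplaceTransform_iterate_integralIic (hb : 0 < b) (hf : CausalExpBound b f) {s : ℂ}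
    (hs : b < s.re) (m : ℕ) :
    laplaceTransform (integralIic^[m] f) s = laplaceTransform f s / s ^ m := by
  induction m with
  | zero => rw [Function.iterate_zero_apply, pow_zero, div_one]
  | succ m ih =>
    rw [Function.iterate_succ_apply',
      (hf.iterate_integralIic hb m).laplaceTransform_integralIic hb hs, ih, div_div, pow_succ]

protected theorem sub (hf : CausalExpBound b f) (hg : CausalExpBound b g) :
    CausalExpBound b (fun y => f y - g y) := by
  obtain ⟨C, hC, hfC⟩ := hf.exists_norm_le
  obtain ⟨D, hD, hgD⟩ := hg.exists_norm_le
  refine ⟨hf.aestronglyMeasurable.sub hg.aestronglyMeasurable,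
    fun y hy => by rw [hf.eq_zero_of_neg y hy, hg.eq_zero_of_neg y hy, sub_zero],
    C + D, by positivity, fun y => ?_⟩
  rw [add_mul]
  exact norm_sub_le_of_le (hfC y) (hgD y)

theorem laplaceTransform_sub (hf : CausalExpBound b f) (hg : CausalExpBound b g)
    {s : ℂ} (hs : b < s.re) :
    laplaceTransform (fun y => f y - g y) s = laplaceTransform f s - laplaceTransform g s := by
  simp only [laplaceTransform, sub_mul]
  exact integral_sub (hf.integrable_mul_exp hs) (hg.integrable_mul_exp hs)

open scoped FourierTransform in
theorem laplaceTransform_inversion (hf : CausalExpBound b f) (hcont : Continuous f) {c : ℝ}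
    (hc : b < c) (hint : Integrable fun t : ℝ => laplaceTransform f (c + t * I)) (y : ℝ) :
    f y = 1 / (2 * Real.pi) *
      ∫ t : ℝ, laplaceTransform f (c + t * I) * cexp ((c + t * I) * y) := by
  let F (y : ℝ) : ℂ := f y * cexp (-((c : ℂ) * y))
  have hF : Integrable F := hf.integrable_mul_exp (s := c) (by simpa using hc)
  have hFF : Integrable (𝓕 F) := by
    rw [funext (fourier_mul_exp_neg f c)]
    exact hint.comp_mul_left' (by positivity)
  have hinv : ∫ ξ : ℝ, cexp ((2 * Real.pi * (ξ * y) : ℝ) * I) * 𝓕 F ξ = F y := by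
    have h := congrFun ((by fun_prop : Continuous F).fourierInv_fourier_eq hF hFF) y
    rw [Real.fourierInv_eq'] at h
    simpa [mul_comm y] using h
  have hscale := Measure.integral_comp_mul_left
    (fun t : ℝ => laplaceTransform f (c + t * I) * cexp ((c + t * I) * y)) (2 * Real.pi)
  rw [abs_of_pos (by positivity), real_smul, ofReal_inv, ← one_div] at hscale
  push_cast at hscale
  have hfF : f y = F y * cexp ((c : ℂ) * y) := by
    rw [mul_assoc, ← exp_add, neg_add_cancel, exp_zero, mul_one]
  rw [hfF, ← hinv, ← integral_mul_const, ← hscale]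
  congr with ξ
  rw [fourier_mul_exp_neg, mul_comm (cexp _) (laplaceTransform f _), mul_assoc, ← exp_add]
  push_cast
  ring_nf

end CausalExpBound

end Laplace

section ContourShift

open MeasureTheory Set Complex Filter Topology

theorem integrable_vertical_of_bound {f : ℂ → ℂ} {σ K : ℝ}
    (hf : Continuous fun t : ℝ => f (σ + t * I))
    (hbound : ∀ t : ℝ, ‖f (σ + t * I)‖ ≤ K * (1 + t ^ 2)⁻¹) :
    Integrable fun t : ℝ => f (σ + t * I) :=
  (integrable_inv_one_add_sq.const_mul K).mono' hf.aestronglyMeasurable (.of_forall hbound)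

theorem continuous_vertical {f : ℂ → ℂ} {S : Set ℂ} (hf : ContinuousOn f S) {σ : ℝ}
    (hσ : ∀ t : ℝ, (σ + t * I : ℂ) ∈ S) : Continuous fun t : ℝ => f (σ + t * I) :=
  hf.comp_continuous (by fun_prop) hσ

theorem tendsto_integral_horizontal {f : ℂ → ℂ} {a c K : ℝ} (hac : a ≤ c)
    (hbound : ∀ s : ℂ, a ≤ s.re → s.re ≤ c → ‖f s‖ ≤ K * (1 + s.im ^ 2)⁻¹) {ε : ℝ}
    (hε : ε ^ 2 = 1) :
    Tendsto (fun T : ℝ => ∫ x in a..c, f (x + ((ε * T : ℝ) : ℂ) * I)) atTop (𝓝 0) := by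
  have hlim : Tendsto (fun T : ℝ => K * (1 + T ^ 2)⁻¹ * |c - a|) atTop (𝓝 0) := by
    have hinv : Tendsto (fun T : ℝ => (1 + T ^ 2)⁻¹) atTop (𝓝 0) :=
      tendsto_inv_atTop_zero.comp
        (tendsto_atTop_add_const_left _ _ (tendsto_pow_atTop two_ne_zero))
    simpa using (hinv.const_mul K).mul_const |c - a|
  refine squeeze_zero_norm (fun T => ?_) hlim
  refine intervalIntegral.norm_integral_le_of_norm_le_const fun x hx => ?_
  rw [uIoc_of_le hac] at hx
  simpa [mul_pow, hε] using
    hbound (x + ((ε * T : ℝ) : ℂ) * I) (by simpa using hx.1.le) (by simpa using hx.2)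

theorem integral_boundary_rect_eq_zero {f : ℂ → ℂ} {a c : ℝ} (hac : a ≤ c)
    (hf : DifferentiableOn ℂ f {s | a ≤ s.re ∧ s.re ≤ c}) (T : ℝ) :
    (∫ x in a..c, f (x + ((-1 * T : ℝ) : ℂ) * I)) - (∫ x in a..c, f (x + ((1 * T : ℝ) : ℂ) * I)) +
      I • (∫ t in (-T)..T, f (c + t * I)) - I • (∫ t in (-T)..T, f (a + t * I)) = 0 := by
  have hrect := integral_boundary_rect_eq_zero_of_differentiableOn f (a + ((-T : ℝ) : ℂ) * I)
    (c + (T : ℂ) * I) (hf.mono fun s hs => by simpa [uIcc_of_le hac] using (mem_reProdIm.1 hs).1)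
  simpa using hrect

theorem integral_vertical_eq {f : ℂ → ℂ} {a c K : ℝ} (hac : a ≤ c)
    (hf : DifferentiableOn ℂ f {s | a ≤ s.re ∧ s.re ≤ c})
    (hbound : ∀ s : ℂ, a ≤ s.re → s.re ≤ c → ‖f s‖ ≤ K * (1 + s.im ^ 2)⁻¹) :
    ∫ t : ℝ, f (c + t * I) = ∫ t : ℝ, f (a + t * I) := by
  have hvert {σ : ℝ} (haσ : a ≤ σ) (hσc : σ ≤ c) :
      Tendsto (fun T : ℝ => ∫ t in (-T)..T, f (σ + t * I)) atTop
        (𝓝 (∫ t : ℝ, f (σ + t * I))) :=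
    intervalIntegral_tendsto_integral (integrable_vertical_of_bound (K := K)
      (continuous_vertical hf.continuousOn fun t => by simpa using ⟨haσ, hσc⟩)
      fun t => by simpa using hbound (σ + t * I) (by simpa using haσ) (by simpa using hσc))
      tendsto_neg_atTop_atBot tendsto_id
  have hlim := (((tendsto_integral_horizontal hac hbound (ε := -1) (by norm_num)).sub
    (tendsto_integral_horizontal hac hbound (one_pow 2))).add
      ((hvert hac le_rfl).const_smul I)).sub ((hvert le_rfl hac).const_smul I)
  simp only [integral_boundary_rect_eq_zero hac hf, sub_self, zero_add, ← smul_sub] at hlim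
  have hzero := tendsto_nhds_unique hlim tendsto_const_nhds
  exact sub_eq_zero.1 ((smul_eq_zero.1 hzero).resolve_left I_ne_zero)

end ContourShift

section Differences

open MeasureTheory Set Complex

theorem fwdDiff_iterate_le {f : ℕ → ℝ → ℝ} {δ : ℝ} (hδ : 0 ≤ δ)
    (hint : ∀ j a b, IntervalIntegrable (f j) volume a b)
    (hprim : ∀ j a b, f (j + 1) b - f (j + 1) a = ∫ v in a..b, f j v) (m : ℕ) {y U : ℝ}
    (hU : ∀ v ∈ Icc y (y + m * δ), f 0 v ≤ U) :
    (fwdDiff δ)^[m] (f m) y ≤ δ ^ m * U := by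
  induction m generalizing f U with
  | zero => simpa using hU y (by simp)
  | succ m ih =>
    have hshift (j : ℕ) (a b : ℝ) :
        IntervalIntegrable (fun v => f (j + 1) (v + δ)) volume a b := by
      simpa using (hint (j + 1) (a + δ) (b + δ)).comp_add_right δ
    rw [Function.iterate_succ_apply, pow_succ, mul_assoc]
    refine ih (f := fun j => fwdDiff δ (f (j + 1))) (U := δ * U)
      (fun j a b => (hshift j a b).sub (hint (j + 1) a b)) (fun j a b => ?_) (fun v hv => ?_)
    · simp only [fwdDiff]
      rw [intervalIntegral.integral_sub (hshift j a b) (hint (j + 1) a b),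
        intervalIntegral.integral_comp_add_right, ← hprim, ← hprim]
      ring
    · have hmono := intervalIntegral.integral_mono_on (by linarith) (hint 0 v (v + δ))
        (intervalIntegrable_const (c := U)) fun w hw => hU w ⟨hv.1.trans hw.1, by
          push_cast
          linarith [hw.2, hv.2]⟩
      rw [fwdDiff, hprim]
      simpa using hmono

theorem le_fwdDiff_iterate {f : ℕ → ℝ → ℝ} {δ : ℝ} (hδ : 0 ≤ δ)
    (hint : ∀ j a b, IntervalIntegrable (f j) volume a b)
    (hprim : ∀ j a b, f (j + 1) b - f (j + 1) a = ∫ v in a..b, f j v) (m : ℕ) {y U : ℝ}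
    (hU : ∀ v ∈ Icc y (y + m * δ), U ≤ f 0 v) :
    δ ^ m * U ≤ (fwdDiff δ)^[m] (f m) y := by
  have hle := fwdDiff_iterate_le (f := fun j => (-1 : ℝ) • f j) hδ
    (fun j a b => (hint j a b).const_mul _)
    (fun j a b => by
      simp only [Pi.smul_apply, intervalIntegral.integral_smul, ← hprim, smul_sub]) m
    (U := -U) fun v hv => by simpa using hU v hv
  rw [fwdDiff_iter_const_smul, Pi.smul_apply, smul_eq_mul] at hle
  linarith

theorem fwdDiff_iterate_re (δ : ℝ) (f : ℝ → ℂ) (m : ℕ) (y : ℝ) :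
    (fwdDiff δ)^[m] (fun v => (f v).re) y = ((fwdDiff δ)^[m] f y).re := by
  induction m generalizing f with
  | zero => rfl
  | succ m ih =>
    rw [Function.iterate_succ_apply, Function.iterate_succ_apply, ← ih]
    rfl

namespace CausalExpBound

variable {b : ℝ} {f : ℝ → ℂ}

theorem intervalIntegrable_re (hb : 0 < b) (hf : CausalExpBound b f) (x y : ℝ) :
    IntervalIntegrable (fun v => (f v).re) volume x y :=
  ⟨(hf.intervalIntegrable hb x y).1.re, (hf.intervalIntegrable hb x y).2.re⟩

theorem re_iterate_integralIic_sub (hb : 0 < b) (hf : CausalExpBound b f) (m : ℕ) (x y : ℝ) :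
    (integralIic^[m + 1] f y).re - (integralIic^[m + 1] f x).re =
      ∫ v in x..y, (integralIic^[m] f v).re := by
  have hm := hf.iterate_integralIic hb m
  rw [Function.iterate_succ_apply', ← sub_re, hm.integralIic_sub hb]
  exact (reCLM.intervalIntegral_comp_comm (hm.intervalIntegrable hb x y)).symm

theorem fwdDiff_iterate_integralIic_re_le (hb : 0 < b) (hf : CausalExpBound b f) {δ : ℝ}
    (hδ : 0 ≤ δ) (m : ℕ) {y U : ℝ} (hU : ∀ v ∈ Icc y (y + m * δ), (f v).re ≤ U) :
    ((fwdDiff δ)^[m] (integralIic^[m] f) y).re ≤ δ ^ m * U := by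
  rw [← fwdDiff_iterate_re]
  exact fwdDiff_iterate_le (f := fun j v => (integralIic^[j] f v).re) hδ
    (fun j => (hf.iterate_integralIic hb j).intervalIntegrable_re hb)
    (hf.re_iterate_integralIic_sub hb) m hU

theorem le_fwdDiff_iterate_integralIic_re (hb : 0 < b) (hf : CausalExpBound b f) {δ : ℝ}
    (hδ : 0 ≤ δ) (m : ℕ) {y U : ℝ} (hU : ∀ v ∈ Icc y (y + m * δ), U ≤ (f v).re) :
    δ ^ m * U ≤ ((fwdDiff δ)^[m] (integralIic^[m] f) y).re := by
  rw [← fwdDiff_iterate_re]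
  exact le_fwdDiff_iterate (f := fun j v => (integralIic^[j] f v).re) hδ
    (fun j => (hf.iterate_integralIic hb j).intervalIntegrable_re hb)
    (hf.re_iterate_integralIic_sub hb) m hU

end CausalExpBound

theorem norm_exp_ofReal_add_mul_I_mul (σ t v : ℝ) :
    ‖cexp ((σ + t * I) * v)‖ = Real.exp (σ * v) := by
  simp [norm_exp]

theorem integrable_mul_exp_vertical {G : ℝ → ℂ} (hG : Integrable G) (σ v : ℝ) :
    Integrable fun t : ℝ => G t * cexp ((σ + t * I) * v) :=
  hG.mul_bdd (c := Real.exp (σ * v)) (by fun_prop)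
    (.of_forall fun t => (norm_exp_ofReal_add_mul_I_mul σ t v).le)

theorem fwdDiff_iterate_integral_exp (σ δ : ℝ) (m : ℕ) {G : ℝ → ℂ} (hG : Integrable G) (y : ℝ) :
    (fwdDiff δ)^[m] (fun v : ℝ => ∫ t : ℝ, G t * cexp ((σ + t * I) * v)) y =
      ∫ t : ℝ, (cexp ((σ + t * I) * δ) - 1) ^ m * G t * cexp ((σ + t * I) * y) := by
  induction m generalizing G with
  | zero => simp only [Function.iterate_zero_apply, pow_zero, one_mul]
  | succ m ih =>
    have hstep : fwdDiff δ (fun v : ℝ => ∫ t : ℝ, G t * cexp ((σ + t * I) * v)) =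
        fun v : ℝ => ∫ t : ℝ, (cexp ((σ + t * I) * δ) - 1) * G t * cexp ((σ + t * I) * v) := by
      funext v
      rw [fwdDiff, ← integral_sub (integrable_mul_exp_vertical hG σ (v + δ))
        (integrable_mul_exp_vertical hG σ v)]
      congr with t
      rw [ofReal_add, mul_add, exp_add]
      ring
    have hG' : Integrable fun t : ℝ => (cexp ((σ + t * I) * δ) - 1) * G t := by
      simp_rw [sub_one_mul, mul_comm _ (G _)]
      exact (integrable_mul_exp_vertical hG σ δ).sub hG
    rw [Function.iterate_succ_apply, hstep, ih hG']
    simp_rw [pow_succ, mul_assoc]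

theorem norm_exp_sub_one_le_rpow {z : ℂ} (hz : z.re ≤ 1) {θ : ℝ} (hθ0 : 0 ≤ θ) (hθ1 : θ ≤ 1) :
    ‖cexp z - 1‖ ≤ 4 * ‖z‖ ^ θ := by
  rcases le_total ‖z‖ 1 with hz1 | hz1
  · calc ‖cexp z - 1‖ ≤ 2 * ‖z‖ ^ (1 : ℝ) := by rw [Real.rpow_one]; exact norm_exp_sub_one_le hz1
      _ ≤ 4 * ‖z‖ ^ θ := by
          gcongr ?_ * ?_
          · norm_num
          · exact Real.rpow_le_rpow_of_exponent_ge_of_imp (norm_nonneg _) hz1 hθ1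
              fun _ h => absurd h one_ne_zero
  · calc ‖cexp z - 1‖ ≤ ‖cexp z‖ + 1 := by simpa using norm_sub_le (cexp z) 1
      _ ≤ 4 * 1 := by
          rw [norm_exp]
          linarith [Real.exp_le_exp.2 hz, Real.exp_one_lt_d9]
      _ ≤ 4 * ‖z‖ ^ θ := by
          gcongr
          exact Real.one_le_rpow hz1 hθ0

theorem norm_exp_sub_one_pow_le {z : ℂ} (hz : z.re ≤ 1) {m : ℕ} (hm : m ≠ 0) {β : ℝ} (hβ0 : 0 ≤ β)
    (hβm : β ≤ m) : ‖cexp z - 1‖ ^ m ≤ 4 ^ m * ‖z‖ ^ β := by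
  have hm0 : (0 : ℝ) < m := by exact_mod_cast hm.bot_lt
  calc ‖cexp z - 1‖ ^ m ≤ (4 * ‖z‖ ^ (β / m)) ^ m := by
        gcongr
        exact norm_exp_sub_one_le_rpow hz (by positivity) ((div_le_one hm0).2 hβm)
    _ = 4 ^ m * ‖z‖ ^ β := by
        rw [mul_pow, ← Real.rpow_natCast (‖z‖ ^ (β / m)), ← Real.rpow_mul (norm_nonneg z),
          div_mul_cancel₀ β hm0.ne']

end Differences

section Smoothing

open MeasureTheory Set Complex

theorem ne_zero_of_pos_of_le_re {σ : ℝ} (hσ : 0 < σ) {s : ℂ} (hs : σ ≤ s.re) : s ≠ 0 := by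
  rintro rfl
  exact (hs.trans_lt hσ).false

theorem sq_mul_one_add_im_sq_le {σ : ℝ} (hσ : 0 ≤ σ) (hσ1 : σ ≤ 1) {s : ℂ} (hs : σ ≤ s.re) :
    σ ^ 2 * (1 + s.im ^ 2) ≤ ‖s‖ ^ 2 := by
  rw [← normSq_eq_norm_sq, normSq_apply]
  have hre : σ * σ ≤ s.re * s.re := mul_self_le_mul_self hσ hs
  have him : σ ^ 2 * s.im ^ 2 ≤ 1 * s.im ^ 2 := by
    gcongr
    exact pow_le_one₀ hσ hσ1
  linarith

theorem half_mul_one_add_abs_im_le {σ : ℝ} (hσ1 : σ ≤ 1) {s : ℂ} (hs : σ ≤ s.re) :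
    σ / 2 * (1 + |s.im|) ≤ ‖s‖ := by
  have him : σ * |s.im| ≤ 1 * |s.im| := by gcongr
  linarith [re_le_norm s, abs_im_le_norm s]

theorem norm_div_pow_le {σ K : ℝ} (hσ : 0 < σ) (hσ1 : σ ≤ 1) (hK : 0 ≤ K) {k : ℕ} {s w : ℂ}
    (hs : σ ≤ s.re) (hw : ‖w‖ ≤ K * ‖s‖ ^ k) :
    ‖w / s ^ (k + 2)‖ ≤ K / σ ^ 2 * (1 + s.im ^ 2)⁻¹ := by
  have hs0 : 0 < ‖s‖ := norm_pos_iff.2 (ne_zero_of_pos_of_le_re hσ hs)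
  rw [norm_div, norm_pow]
  calc ‖w‖ / ‖s‖ ^ (k + 2) ≤ K * ‖s‖ ^ k / ‖s‖ ^ (k + 2) := by gcongr
    _ = K / ‖s‖ ^ 2 := by rw [pow_add]; field_simp
    _ ≤ K / (σ ^ 2 * (1 + s.im ^ 2)) := by
        gcongr
        exact sq_mul_one_add_im_sq_le hσ.le hσ1 hs
    _ = _ := by field_simp

theorem norm_exp_mul_ofReal_le {c : ℝ} {s : ℂ} (hs : 0 ≤ s.re) (hsc : s.re ≤ c) (y : ℝ) :
    ‖cexp (s * y)‖ ≤ Real.exp (c * |y|) := by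
  rw [norm_exp, re_mul_ofReal]
  refine Real.exp_le_exp.2 ?_
  calc s.re * y ≤ s.re * |y| := by gcongr; exact le_abs_self y
    _ ≤ c * |y| := by gcongr

variable {b c σ K : ℝ} {k : ℕ} {E : ℝ → ℂ} {g : ℂ → ℂ}

theorem differentiableOn_div_pow (hσ : 0 < σ)
    (hg : DifferentiableOn ℂ g {s | σ ≤ s.re ∧ s.re ≤ c}) (k : ℕ) :
    DifferentiableOn ℂ (fun s => g s / s ^ k) {s | σ ≤ s.re ∧ s.re ≤ c} :=
  hg.div (by fun_prop) fun _ hs => pow_ne_zero _ (ne_zero_of_pos_of_le_re hσ hs.1)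

theorem integrable_vertical_div_pow (hσ : 0 < σ) (hσ1 : σ ≤ 1)
    (hg : DifferentiableOn ℂ g {s | σ ≤ s.re ∧ s.re ≤ c}) (hK : 0 ≤ K)
    (hgK : ∀ s : ℂ, σ ≤ s.re → s.re ≤ c → ‖g s‖ ≤ K * ‖s‖ ^ k) {τ : ℝ} (hστ : σ ≤ τ)
    (hτc : τ ≤ c) : Integrable fun t : ℝ => g (τ + t * I) / (τ + t * I) ^ (k + 2) := by
  have hre (t : ℝ) : ((τ : ℂ) + t * I).re = τ := by simp
  refine integrable_vertical_of_bound (K := K / σ ^ 2) (f := fun s => g s / s ^ (k + 2))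
    (continuous_vertical (differentiableOn_div_pow hσ hg (k + 2)).continuousOn fun t => ?_)
    fun t => ?_
  · simpa using ⟨hστ, hτc⟩
  · simpa using norm_div_pow_le hσ hσ1 hK (s := τ + t * I) (by rwa [hre])
      (hgK _ (by rwa [hre]) (by rwa [hre]))

/-- Laplace inversion on the line of abscissa `c`, followed by a shift to the line of abscissa
`σ`. -/
theorem iterate_integralIic_eq_integral (hb : 0 < b) (hbc : b < c) (hσ : 0 < σ) (hσ1 : σ ≤ 1)
    (hσc : σ ≤ c) (hE : CausalExpBound b E)
    (hlap : ∀ t : ℝ, laplaceTransform E (c + t * I) = g (c + t * I) / (c + t * I))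
    (hg : DifferentiableOn ℂ g {s | σ ≤ s.re ∧ s.re ≤ c}) (hK : 0 ≤ K)
    (hgK : ∀ s : ℂ, σ ≤ s.re → s.re ≤ c → ‖g s‖ ≤ K * ‖s‖ ^ k) (y : ℝ) :
    integralIic^[k + 1] E y = 1 / (2 * Real.pi) *
      ∫ t : ℝ, g (σ + t * I) / (σ + t * I) ^ (k + 2) * cexp ((σ + t * I) * y) := by
  have hlap' (t : ℝ) : laplaceTransform (integralIic^[k + 1] E) (c + t * I) =
      g (c + t * I) / (c + t * I) ^ (k + 2) := by
    rw [hE.laplaceTransform_iterate_integralIic hb (by simpa using hbc), hlap, div_div,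
      ← pow_succ']
  have hcont : Continuous (integralIic^[k + 1] E) := by
    rw [Function.iterate_succ']
    exact (hE.iterate_integralIic hb k).continuous_integralIic hb
  have hinv := (hE.iterate_integralIic hb (k + 1)).laplaceTransform_inversion hcont hbc
    (by simpa only [hlap'] using integrable_vertical_div_pow hσ hσ1 hg hK hgK hσc le_rfl) y
  simp_rw [hlap'] at hinv
  rw [hinv]
  congr 1
  refine integral_vertical_eq (f := fun s => g s / s ^ (k + 2) * cexp (s * y))
    (K := K / σ ^ 2 * Real.exp (c * |y|)) hσc
    ((differentiableOn_div_pow hσ hg (k + 2)).mul (by fun_prop)) fun s hσs hsc => ?_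
  rw [norm_mul, mul_right_comm]
  gcongr
  · exact norm_div_pow_le hσ hσ1 hK hσs (hgK s hσs hsc)
  · exact norm_exp_mul_ofReal_le (hσ.le.trans hσs) hsc y

theorem norm_exp_sub_one_pow_mul_div_pow_le {m : ℕ} (hm : m ≠ 0) (hσ : 0 < σ) (hσ1 : σ ≤ 1)
    {κ η : ℝ} (hκη : 0 ≤ κ + η) (hκηm : κ + η ≤ m) {δ : ℝ} (hδ : 0 < δ) (hδ1 : δ ≤ 1) {s w : ℂ}
    (hs : s.re = σ) (hw : ‖w‖ ≤ K * (1 + |s.im|) ^ κ) :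
    ‖(cexp (s * δ) - 1) ^ m * (w / s ^ (m + 1))‖ ≤
      4 ^ m * K * (σ / 2) ^ (-(1 + κ + η)) * δ ^ (m - (κ + η)) * (1 + |s.im|) ^ (-(1 + η)) := by
  have him : 0 < 1 + |s.im| := by positivity
  have hs0 : 0 < ‖s‖ := norm_pos_iff.2 (ne_zero_of_pos_of_le_re hσ hs.ge)
  have hexp : ‖cexp (s * δ) - 1‖ ^ m ≤ 4 ^ m * (δ ^ (m - (κ + η)) * ‖s‖ ^ (m - (κ + η))) := by
    have hre : (s * δ).re ≤ 1 := by
      rw [re_mul_ofReal, hs]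
      exact mul_le_one₀ hσ1 hδ.le hδ1
    refine (norm_exp_sub_one_pow_le hre hm (sub_nonneg.2 hκηm) (by linarith)).trans_eq ?_
    rw [norm_mul, norm_real, Real.norm_of_nonneg hδ.le, Real.mul_rpow hs0.le hδ.le,
      mul_comm (‖s‖ ^ _)]
  have hquot : ‖s‖ ^ (m - (κ + η)) / ‖s‖ ^ (m + 1) ≤
      (σ / 2) ^ (-(1 + κ + η)) * (1 + |s.im|) ^ (-(1 + κ + η)) := by
    rw [← Real.mul_rpow (by positivity) him.le, ← Real.rpow_natCast, ← Real.rpow_sub hs0,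
      show (m - (κ + η) : ℝ) - (m + 1 : ℕ) = -(1 + κ + η) by push_cast; ring]
    exact Real.rpow_le_rpow_of_nonpos (by positivity) (half_mul_one_add_abs_im_le hσ1 hs.ge)
      (by linarith)
  have hsplit : (1 + |s.im|) ^ κ * (1 + |s.im|) ^ (-(1 + κ + η)) = (1 + |s.im|) ^ (-(1 + η)) := by
    rw [← Real.rpow_add him]
    ring_nf
  have hw0 : 0 ≤ K * (1 + |s.im|) ^ κ := (norm_nonneg w).trans hw
  rw [norm_mul, norm_div, norm_pow, norm_pow]
  calc ‖cexp (s * δ) - 1‖ ^ m * (‖w‖ / ‖s‖ ^ (m + 1))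
      ≤ 4 ^ m * (δ ^ (m - (κ + η)) * ‖s‖ ^ (m - (κ + η))) *
          (K * (1 + |s.im|) ^ κ / ‖s‖ ^ (m + 1)) := by gcongr
    _ = 4 ^ m * δ ^ (m - (κ + η)) * (K * (1 + |s.im|) ^ κ) *
          (‖s‖ ^ (m - (κ + η)) / ‖s‖ ^ (m + 1)) := by ring
    _ ≤ 4 ^ m * δ ^ (m - (κ + η)) * (K * (1 + |s.im|) ^ κ) *
          ((σ / 2) ^ (-(1 + κ + η)) * (1 + |s.im|) ^ (-(1 + κ + η))) := by gcongr
    _ = _ := by rw [← hsplit]; ring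

theorem exists_norm_fwdDiff_iterate_integralIic_le {K' κ η : ℝ} (hb : 0 < b) (hbc : b < c)
    (hσ : 0 < σ) (hσ1 : σ ≤ 1) (hσc : σ ≤ c) (hE : CausalExpBound b E)
    (hlap : ∀ t : ℝ, laplaceTransform E (c + t * I) = g (c + t * I) / (c + t * I))
    (hg : DifferentiableOn ℂ g {s | σ ≤ s.re ∧ s.re ≤ c}) (hK : 0 ≤ K)
    (hgK : ∀ s : ℂ, σ ≤ s.re → s.re ≤ c → ‖g s‖ ≤ K * ‖s‖ ^ k) (hK' : 0 ≤ K')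
    (hgσ : ∀ t : ℝ, ‖g (σ + t * I)‖ ≤ K' * (1 + |t|) ^ κ) (hκ : 0 ≤ κ) (hη : 0 < η)
    (hκη : κ + η ≤ k + 1) :
    ∃ C : ℝ, 0 ≤ C ∧ ∀ δ : ℝ, 0 < δ → δ ≤ 1 → ∀ y : ℝ,
      ‖(fwdDiff δ)^[k + 1] (integralIic^[k + 1] E) y‖ ≤
        δ ^ (k + 1) * (C * δ ^ (-(κ + η)) * Real.exp (σ * y)) := by
  let J : ℝ := ∫ t : ℝ, (1 + ‖t‖) ^ (-(1 + η))
  have hJ : Integrable fun t : ℝ => (1 + ‖t‖) ^ (-(1 + η)) :=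
    integrable_one_add_norm (by rw [Module.finrank_self, Nat.cast_one]; linarith)
  have : 0 ≤ J := integral_nonneg fun t => by positivity
  let B : ℝ := 4 ^ (k + 1) * K' * (σ / 2) ^ (-(1 + κ + η))
  have : 0 ≤ B := by positivity
  refine ⟨‖(1 / (2 * Real.pi) : ℂ)‖ * (B * J), by positivity, fun δ hδ hδ1 y => ?_⟩
  have hδ_pow : δ ^ (((k + 1 : ℕ) : ℝ) - (κ + η)) = δ ^ (k + 1) * δ ^ (-(κ + η)) := by
    rw [sub_eq_add_neg, Real.rpow_add hδ, Real.rpow_natCast]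
  have hform : integralIic^[k + 1] E = (1 / (2 * Real.pi) : ℂ) • fun y : ℝ =>
      ∫ t : ℝ, g (σ + t * I) / (σ + t * I) ^ (k + 2) * cexp ((σ + t * I) * y) :=
    funext (iterate_integralIic_eq_integral hb hbc hσ hσ1 hσc hE hlap hg hK hgK)
  have hpoint (t : ℝ) : ‖(cexp ((σ + t * I) * δ) - 1) ^ (k + 1) *
      (g (σ + t * I) / (σ + t * I) ^ (k + 2)) * cexp ((σ + t * I) * y)‖ ≤
      B * (δ ^ (k + 1) * δ ^ (-(κ + η))) * Real.exp (σ * y) * (1 + ‖t‖) ^ (-(1 + η)) := by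
    rw [norm_mul, norm_exp_ofReal_add_mul_I_mul, ← hδ_pow, mul_right_comm _ (Real.exp _)]
    gcongr
    have hkernel := norm_exp_sub_one_pow_mul_div_pow_le (K := K') k.succ_ne_zero hσ hσ1
      (add_nonneg hκ hη.le) (by exact_mod_cast hκη) hδ hδ1 (s := σ + t * I) (w := g (σ + t * I))
      (by simp) (by simpa using hgσ t)
    rwa [show ((σ : ℂ) + t * I).im = t by simp] at hkernel
  have hint := norm_integral_le_of_norm_le
    (hJ.const_mul (B * (δ ^ (k + 1) * δ ^ (-(κ + η))) * Real.exp (σ * y))) (.of_forall hpoint)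
  rw [integral_const_mul] at hint
  rw [hform, fwdDiff_iter_const_smul, Pi.smul_apply, norm_smul,
    fwdDiff_iterate_integral_exp σ δ _ (integrable_vertical_div_pow hσ hσ1 hg hK hgK le_rfl hσc)]
  calc _ ≤ ‖(1 / (2 * Real.pi) : ℂ)‖ *
        (B * (δ ^ (k + 1) * δ ^ (-(κ + η))) * Real.exp (σ * y) * J) := by gcongr
    _ = _ := by ring

/-- The differences of the iterated primitives are weighted averages of `A - M`, which monotonicity
of `A` compares with the value at `y` from either side. -/
theorem abs_sub_re_le_of_fwdDiff_iterate_le {A : ℝ → ℝ} (hA : Monotone A) {M : ℝ → ℂ} (hb : 0 < b)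
    (hE : CausalExpBound b fun y => (A y : ℂ) - M y) {m : ℕ} {δ : ℝ} (hδ : 0 < δ) {y V R : ℝ}
    (hV : ∀ v ∈ Icc (y - m * δ) (y + m * δ), |(M v).re - (M y).re| ≤ V)
    (hR : ∀ v ∈ Icc (y - m * δ) y,
      ‖(fwdDiff δ)^[m] (integralIic^[m] fun y => (A y : ℂ) - M y) v‖ ≤ δ ^ m * R) :
    |A y - (M y).re| ≤ V + R := by
  have hmδ : 0 ≤ (m : ℝ) * δ := by positivity
  have hre (v : ℝ) : ((A v : ℂ) - M v).re = A v - (M v).re := by rw [sub_re, ofReal_re]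
  rw [abs_le]
  constructor
  · have hupper := hE.fwdDiff_iterate_integralIic_re_le hb hδ.le m (y := y - m * δ)
      (U := A y - (M y).re + V) fun v hv => by
        rw [sub_add_cancel] at hv
        rw [hre]
        linarith [hA hv.2, neg_le_of_abs_le (hV v ⟨hv.1, by linarith [hv.2]⟩)]
    have hlower := neg_le_of_abs_le ((abs_re_le_norm _).trans
      (hR (y - m * δ) ⟨le_rfl, by linarith⟩))
    rw [← mul_neg] at hlower
    linarith [le_of_mul_le_mul_left (hlower.trans hupper) (pow_pos hδ m)]
  · have hlower := hE.le_fwdDiff_iterate_integralIic_re hb hδ.le m (y := y)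
      (U := A y - (M y).re - V) fun v hv => by
        rw [hre]
        linarith [hA hv.1, le_of_abs_le (hV v ⟨by linarith [hv.1], hv.2⟩)]
    have hupper := le_of_abs_le ((abs_re_le_norm _).trans (hR y ⟨by linarith, le_rfl⟩))
    linarith [le_of_mul_le_mul_left (hlower.trans hupper) (pow_pos hδ m)]

end Smoothing

/-! ### Summatory functions and main terms -/

section Summatory

open MeasureTheory Set Complex

/-- The summatory function `∑_{n ≤ x} f n` in the variable `y = log x`. -/
noncomputable def logSummatory (f : ℕ → ℝ) (y : ℝ) : ℝ :=
  ∑ n ∈ Finset.Icc 1 ⌊Real.exp y⌋₊, f n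

theorem logSummatory_of_neg (f : ℕ → ℝ) {y : ℝ} (hy : y < 0) : logSummatory f y = 0 := by
  rw [logSummatory, Nat.floor_eq_zero.2 (Real.exp_lt_one_iff.2 hy),
    Finset.Icc_eq_empty (by norm_num), Finset.sum_empty]

theorem integral_Ioi_one_mul_cpow (A : ℝ → ℂ) (s : ℂ) :
    ∫ x in Ioi (1 : ℝ), A x * (x : ℂ) ^ (-(s + 1)) =
      ∫ y in Ioi (0 : ℝ), A (Real.exp y) * cexp (-(s * y)) := by
  rw [← Real.exp_zero, ← Real.image_exp_Ioi,
    integral_image_eq_integral_abs_deriv_smul measurableSet_Ioi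
      (fun y _ => (Real.hasDerivAt_exp y).hasDerivWithinAt) Real.exp_injective.injOn]
  refine setIntegral_congr_fun measurableSet_Ioi fun y _ => ?_
  have hcpow : (Real.exp y : ℂ) ^ (-(s + 1)) = cexp (-(s + 1) * y) := by
    rw [cpow_def_of_ne_zero (by exact_mod_cast (Real.exp_pos y).ne'),
      ← ofReal_log (Real.exp_pos y).le, Real.log_exp, mul_comm]
  rw [abs_of_pos (Real.exp_pos y), real_smul, hcpow, mul_left_comm, ofReal_exp, ← exp_add]
  ring_nf

variable {f : ℕ → ℝ} {b : ℝ}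

theorem monotone_logSummatory (hf : ∀ n, 0 ≤ f n) : Monotone (logSummatory f) := fun _ _ hxy =>
  Finset.sum_le_sum_of_subset_of_nonneg
    (Finset.Icc_subset_Icc_right (Nat.floor_le_floor (Real.exp_le_exp.2 hxy))) fun n _ _ => hf n

/-- Rankin's trick. -/
theorem sum_Icc_floor_le (hf : ∀ n, 0 ≤ f n) (hb : 0 ≤ b)
    (hs : LSeriesSummable (fun n => (f n : ℂ)) b) {x : ℝ} (hx : 0 ≤ x) :
    ∑ n ∈ Finset.Icc 1 ⌊x⌋₊, f n ≤ (∑' n, ‖LSeries.term (fun n => (f n : ℂ)) b n‖) * x ^ b := by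
  calc ∑ n ∈ Finset.Icc 1 ⌊x⌋₊, f n
      ≤ ∑ n ∈ Finset.Icc 1 ⌊x⌋₊, ‖LSeries.term (fun n => (f n : ℂ)) b n‖ * x ^ b := by
        refine Finset.sum_le_sum fun n hn => ?_
        rw [Finset.mem_Icc] at hn
        have hn0 : (0 : ℝ) < n := by exact_mod_cast hn.1
        have hnx : (n : ℝ) ≤ x := (Nat.le_floor_iff hx).1 hn.2
        rw [LSeries.norm_term_eq, if_neg (Nat.ne_of_gt hn.1), norm_real, Real.norm_of_nonneg (hf n),
          ofReal_re, div_mul_comm, ← Real.div_rpow hx hn0.le]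
        exact le_mul_of_one_le_left (hf n) (Real.one_le_rpow ((one_le_div hn0).2 hnx) hb)
    _ ≤ _ := by
        rw [← Finset.sum_mul]
        gcongr
        exact hs.norm.sum_le_tsum _ fun n _ => norm_nonneg _

theorem causalExpBound_logSummatory (hf : ∀ n, 0 ≤ f n) (hb : 0 ≤ b)
    (hs : LSeriesSummable (fun n => (f n : ℂ)) b) :
    CausalExpBound b fun y => (logSummatory f y : ℂ) := by
  refine ⟨(measurable_ofReal.comp (monotone_logSummatory hf).measurable).aestronglyMeasurable,
    fun y hy => by rw [logSummatory_of_neg f hy, ofReal_zero],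
    ∑' n, ‖LSeries.term (fun n => (f n : ℂ)) b n‖, tsum_nonneg fun n => norm_nonneg _, fun y => ?_⟩
  rw [norm_real, logSummatory, Real.norm_of_nonneg (Finset.sum_nonneg fun n _ => hf n),
    mul_comm b y, Real.exp_mul]
  exact sum_Icc_floor_le hf hb hs (Real.exp_pos y).le

theorem LSeries_eq_mul_integral_logSummatory (hf : ∀ n, 0 ≤ f n) (hb : 0 ≤ b)
    (hs : LSeriesSummable (fun n => (f n : ℂ)) b) {s : ℂ} (hbs : b < s.re) :
    LSeries (fun n => (f n : ℂ)) s =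
      s * ∫ y in Ioi (0 : ℝ), (logSummatory f y : ℂ) * cexp (-(s * y)) := by
  rw [LSeries_eq_mul_integral_of_nonneg f hb hbs _ hf, integral_Ioi_one_mul_cpow]
  · simp only [logSummatory, ofReal_sum]
  · refine .of_bound (∑' n, ‖LSeries.term (fun n => (f n : ℂ)) b n‖) (.of_forall fun n => ?_)
    rw [Real.norm_of_nonneg (Finset.sum_nonneg fun n _ => hf n),
      Real.norm_of_nonneg (by positivity)]
    simpa only [Nat.floor_natCast] using sum_Icc_floor_le hf hb hs n.cast_nonneg

theorem laplaceTransform_logSummatory (hf : ∀ n, 0 ≤ f n) (hb : 0 ≤ b)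
    (hs : LSeriesSummable (fun n => (f n : ℂ)) b) {s : ℂ} (hbs : b < s.re) :
    laplaceTransform (fun y => (logSummatory f y : ℂ)) s = LSeries (fun n => (f n : ℂ)) s / s := by
  rw [LSeries_eq_mul_integral_logSummatory hf hb hs hbs,
    mul_div_cancel_left₀ _ (ne_zero_of_re_pos (hb.trans_lt hbs)), laplaceTransform,
    ← setIntegral_eq_integral_of_forall_compl_eq_zero (s := Ici (0 : ℝ)) fun y hy => by
      rw [logSummatory_of_neg f (by simpa using hy), ofReal_zero, zero_mul],
    integral_Ici_eq_integral_Ioi]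

end Summatory

section MainTerm

open MeasureTheory Set Complex Polynomial

/-- The function `v ^ i / i!` on the positive half-line, with Laplace transform
`1 / s ^ (i + 1)`. -/
noncomputable def powDensity (i : ℕ) : ℝ → ℂ :=
  (Ici (0 : ℝ)).indicator fun v => (v : ℂ) ^ i / (i.factorial : ℂ)

theorem powDensity_of_nonneg (i : ℕ) {v : ℝ} (hv : 0 ≤ v) :
    powDensity i v = ((v ^ i / i.factorial : ℝ) : ℂ) := by
  rw [powDensity, indicator_of_mem (mem_Ici.2 hv)]
  push_cast
  rfl

theorem powDensity_of_neg (i : ℕ) {v : ℝ} (hv : v < 0) : powDensity i v = 0 :=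
  indicator_of_notMem (notMem_Ici.2 hv) _

theorem causalExpBound_powDensity_zero {b : ℝ} (hb : 0 ≤ b) : CausalExpBound b (powDensity 0) := by
  refine ⟨(Measurable.indicator (by fun_prop) measurableSet_Ici).aestronglyMeasurable,
    fun y hy => powDensity_of_neg 0 hy, 1, zero_le_one, fun y => ?_⟩
  rcases lt_or_ge y 0 with hy | hy
  · rw [powDensity_of_neg 0 hy, norm_zero]
    positivity
  · simpa [powDensity_of_nonneg 0 hy] using mul_nonneg hb hy

theorem laplaceTransform_powDensity_zero {s : ℂ} (hs : 0 < s.re) :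
    laplaceTransform (powDensity 0) s = 1 / s := by
  rw [← integral_indicator_Ici_exp_neg_mul hs, laplaceTransform]
  congr with y
  rcases lt_or_ge y 0 with hy | hy
  · rw [powDensity_of_neg 0 hy, indicator_of_notMem (notMem_Ici.2 hy), zero_mul]
  · simp [powDensity_of_nonneg 0 hy, hy]

theorem integralIic_powDensity {b : ℝ} (hb : 0 < b) {i : ℕ}
    (h : CausalExpBound b (powDensity i)) : integralIic (powDensity i) = powDensity (i + 1) := by
  funext y
  rcases lt_or_ge y 0 with hy | hy
  · rw [integralIic_eq_zero h.eq_zero_of_neg hy.le, powDensity_of_neg _ hy]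
  · have hcongr : ∫ v in (0 : ℝ)..y, powDensity i v =
        ∫ v in (0 : ℝ)..y, ((v ^ i / i.factorial : ℝ) : ℂ) :=
      intervalIntegral.integral_congr fun v hv =>
        powDensity_of_nonneg i (by rw [uIcc_of_le hy] at hv; exact hv.1)
    rw [← sub_zero (integralIic _ y), ← integralIic_eq_zero h.eq_zero_of_neg le_rfl,
      h.integralIic_sub hb, hcongr, powDensity_of_nonneg _ hy, intervalIntegral.integral_ofReal,
      intervalIntegral.integral_div, integral_pow, Nat.factorial_succ]
    push_cast
    rw [zero_pow i.succ_ne_zero, sub_zero, div_div]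

theorem powDensity_eq_iterate (i : ℕ) : powDensity i = integralIic^[i] (powDensity 0) := by
  induction i with
  | zero => rfl
  | succ i ih =>
    have hbound : CausalExpBound 1 (powDensity i) := by
      rw [ih]
      exact (causalExpBound_powDensity_zero zero_le_one).iterate_integralIic one_pos i
    rw [Function.iterate_succ_apply', ← ih, integralIic_powDensity one_pos hbound]

theorem causalExpBound_powDensity {b : ℝ} (hb : 0 < b) (i : ℕ) :
    CausalExpBound b (powDensity i) := by
  rw [powDensity_eq_iterate]
  exact (causalExpBound_powDensity_zero hb.le).iterate_integralIic hb i

theorem laplaceTransform_powDensity (i : ℕ) {s : ℂ} (hs : 0 < s.re) :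
    laplaceTransform (powDensity i) s = 1 / s ^ (i + 1) := by
  obtain ⟨b, hb, hbs⟩ := exists_between hs
  rw [powDensity_eq_iterate,
    (causalExpBound_powDensity_zero hb.le).laplaceTransform_iterate_integralIic hb hbs,
    laplaceTransform_powDensity_zero hs, div_div, pow_succ']

/-- The derivative of the main term belonging to the polar part `∑ i < n, a i / (s - 1) ^ (i + 1)`
of a Dirichlet series. -/
noncomputable def mainDensity (a : ℕ → ℂ) (n : ℕ) (v : ℝ) : ℂ :=
  ∑ i ∈ Finset.range n, a i * (Real.exp v * powDensity i v)

theorem causalExpBound_mainDensity (a : ℕ → ℂ) (n : ℕ) {b : ℝ} (hb : 1 < b) :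
    CausalExpBound b (mainDensity a n) := by
  have hpow := fun i => causalExpBound_powDensity (sub_pos.2 hb) i
  choose C hC hbound using fun i => (hpow i).exists_norm_le
  refine ⟨Finset.aestronglyMeasurable_fun_sum _ fun i _ =>
      (AEStronglyMeasurable.mul (by fun_prop) (hpow i).aestronglyMeasurable).const_mul _,
    fun y hy => Finset.sum_eq_zero fun i _ => by rw [powDensity_of_neg i hy, mul_zero, mul_zero],
    ∑ i ∈ Finset.range n, ‖a i‖ * C i,
    Finset.sum_nonneg fun i _ => mul_nonneg (norm_nonneg _) (hC i), fun y => ?_⟩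
  rw [Finset.sum_mul]
  refine norm_sum_le_of_le _ fun i _ => ?_
  rw [norm_mul, norm_mul, mul_assoc, norm_real, Real.norm_of_nonneg (Real.exp_pos y).le]
  refine mul_le_mul_of_nonneg_left ?_ (norm_nonneg _)
  calc Real.exp y * ‖powDensity i y‖ ≤ Real.exp y * (C i * Real.exp ((b - 1) * y)) := by
        gcongr
        exact hbound i y
    _ = C i * Real.exp (b * y) := by
        rw [mul_left_comm, ← Real.exp_add]
        ring_nf

theorem laplaceTransform_mainDensity (a : ℕ → ℂ) (n : ℕ) {s : ℂ} (hs : 1 < s.re) :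
    laplaceTransform (mainDensity a n) s = ∑ i ∈ Finset.range n, a i / (s - 1) ^ (i + 1) := by
  have hs' : 0 < (s - 1).re := by simpa using hs
  obtain ⟨b, hb, hbs⟩ := exists_between hs'
  have hshift (y : ℝ) : mainDensity a n y * cexp (-(s * y)) =
      ∑ i ∈ Finset.range n, a i * (powDensity i y * cexp (-((s - 1) * y))) := by
    rw [mainDensity, Finset.sum_mul]
    refine Finset.sum_congr rfl fun i _ => ?_
    rw [show -((s - 1) * y) = y + -(s * y) by ring, exp_add, ofReal_exp]
    ring
  rw [laplaceTransform, funext hshift, integral_finsetSum _ fun i _ =>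
    ((causalExpBound_powDensity hb i).integrable_mul_exp hbs).const_mul _]
  refine Finset.sum_congr rfl fun i _ => ?_
  rw [integral_const_mul, ← laplaceTransform, laplaceTransform_powDensity i hs', mul_one_div]

/-- `exp * P` is the primitive of `exp * (P + derivative P)`; the truncated Neumann series of
`(1 + derivative)⁻¹` recovers `P`. -/
theorem exists_add_derivative_eq {R : Type*} [CommRing R] (Q : R[X]) :
    ∃ P : R[X], P + derivative P = Q := by
  have htelescope (n : ℕ) : (∑ j ∈ Finset.range n, (-1 : R[X]) ^ j * derivative^[j] Q) +
      derivative (∑ j ∈ Finset.range n, (-1 : R[X]) ^ j * derivative^[j] Q) =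
      Q - (-1) ^ n * derivative^[n] Q := by
    induction n with
    | zero => simp
    | succ n ih =>
      have hderiv : derivative ((-1 : R[X]) ^ n * derivative^[n] Q) =
          (-1) ^ n * derivative^[n + 1] Q := by
        rw [show (-1 : R[X]) ^ n = C ((-1) ^ n) by simp, derivative_C_mul,
          Function.iterate_succ_apply']
      rw [Finset.sum_range_succ, derivative_add, hderiv, add_add_add_comm, ih]
      ring
  refine ⟨_, (htelescope (Q.natDegree + 1)).trans ?_⟩
  rw [iterate_derivative_eq_zero (Nat.lt_succ_self _), mul_zero, sub_zero]

theorem natDegree_add_derivative {R : Type*} [Semiring R] (P : R[X]) :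
    (P + derivative P).natDegree = P.natDegree := by
  rcases eq_or_ne P 0 with rfl | hP
  · simp
  · exact natDegree_eq_of_degree_eq (degree_add_eq_left_of_degree_lt (degree_derivative_lt hP))

theorem leadingCoeff_add_derivative {R : Type*} [Semiring R] (P : R[X]) :
    (P + derivative P).leadingCoeff = P.leadingCoeff := by
  rcases eq_or_ne P 0 with rfl | hP
  · simp
  · exact leadingCoeff_add_of_degree_lt' (degree_derivative_lt hP)

/-- The polynomial factor of the derivative of the main term: `exp v * (polarPoly a n).eval v` is
the real part of `mainDensity a n v` for `v ≥ 0`. -/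
noncomputable def polarPoly (a : ℕ → ℂ) (n : ℕ) : ℝ[X] :=
  ∑ i ∈ Finset.range n, C ((a i).re / i.factorial) * X ^ i

theorem re_mainDensity (a : ℕ → ℂ) (n : ℕ) {v : ℝ} (hv : 0 ≤ v) :
    (mainDensity a n v).re = Real.exp v * (polarPoly a n).eval v := by
  rw [mainDensity, polarPoly, re_sum, eval_finsetSum, Finset.mul_sum]
  refine Finset.sum_congr rfl fun i _ => ?_
  rw [powDensity_of_nonneg i hv, ← ofReal_mul, re_mul_ofReal, eval_mul, eval_C, eval_pow, eval_X]
  ring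

theorem re_integralIic_mainDensity (a : ℕ → ℂ) (n : ℕ) {P : ℝ[X]}
    (hP : P + derivative P = polarPoly a n) {y : ℝ} (hy : 0 ≤ y) :
    (integralIic (mainDensity a n) y).re = Real.exp y * P.eval y - P.eval 0 := by
  have hm := causalExpBound_mainDensity a n one_lt_two
  have hcongr : ∫ v in (0 : ℝ)..y, (mainDensity a n v).re =
      ∫ v in (0 : ℝ)..y, (Real.exp v * P.eval v + Real.exp v * (derivative P).eval v) := by
    refine intervalIntegral.integral_congr fun v hv => ?_
    rw [uIcc_of_le hy] at hv
    rw [re_mainDensity a n hv.1, ← hP, eval_add, mul_add]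
  have hre : (integralIic (mainDensity a n) y).re = ∫ v in (0 : ℝ)..y, (mainDensity a n v).re := by
    rw [← sub_zero (integralIic _ y), ← integralIic_eq_zero hm.eq_zero_of_neg le_rfl,
      hm.integralIic_sub two_pos]
    exact (reCLM.intervalIntegral_comp_comm (hm.intervalIntegrable two_pos 0 y)).symm
  have hFTC := intervalIntegral.integral_eq_sub_of_hasDerivAt (a := 0) (b := y)
    (f := fun v => Real.exp v * P.eval v)
    (fun v _ => (Real.hasDerivAt_exp v).mul (P.hasDerivAt v))
    (Continuous.intervalIntegrable (by fun_prop) _ _)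
  rw [hre, hcongr, hFTC, Real.exp_zero, one_mul]

theorem coeff_polarPoly (a : ℕ → ℂ) {n i : ℕ} (hi : i < n) :
    (polarPoly a n).coeff i = (a i).re / i.factorial := by
  simp [polarPoly, finsetSum_coeff, hi]

theorem natDegree_polarPoly {a : ℕ → ℂ} {n : ℕ} (ha : (a n).re ≠ 0) :
    (polarPoly a (n + 1)).natDegree = n := by
  refine natDegree_eq_of_le_of_coeff_ne_zero (natDegree_sum_le_of_forall_le _ _ fun i hi =>
    (natDegree_C_mul_X_pow_le _ _).trans (Finset.mem_range_succ_iff.1 hi)) ?_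
  rw [coeff_polarPoly a n.lt_succ_self]
  exact div_ne_zero ha (by positivity)

end MainTerm

/-! ### The polar part at `1` and the asymptotic formula -/

section Pole

open Set Complex

/-- The `j`-th Taylor remainder of `φ` at `1`, divided by `(s - 1) ^ j`. -/
noncomputable def taylorRem (φ : ℂ → ℂ) (j : ℕ) : ℂ → ℂ := (fun f => dslope f 1)^[j] φ

theorem taylorRem_succ (φ : ℂ → ℂ) (j : ℕ) :
    taylorRem φ (j + 1) = dslope (taylorRem φ j) 1 := Function.iterate_succ_apply' _ _ _

theorem eq_sum_add_taylorRem (φ : ℂ → ℂ) (n : ℕ) (s : ℂ) :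
    φ s = ∑ j ∈ Finset.range n, taylorRem φ j 1 * (s - 1) ^ j + (s - 1) ^ n * taylorRem φ n s := by
  induction n with
  | zero => simp [taylorRem]
  | succ n ih =>
    have hslope := sub_smul_dslope (taylorRem φ n) 1 s
    rw [← taylorRem_succ, smul_eq_mul] at hslope
    rw [ih, Finset.sum_range_succ, pow_succ, mul_assoc, hslope]
    ring

theorem differentiableOn_taylorRem {φ : ℂ → ℂ} {U : Set ℂ} (hU : U ∈ nhds (1 : ℂ))
    (hφ : DifferentiableOn ℂ φ U) (n : ℕ) : DifferentiableOn ℂ (taylorRem φ n) U := by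
  induction n with
  | zero => exact hφ
  | succ n ih => rw [taylorRem_succ]; exact (differentiableOn_dslope hU).2 ih

theorem div_pow_sub_sum_eq_taylorRem (φ : ℂ → ℂ) (r : ℕ) {s : ℂ} (hs : s ≠ 1) :
    φ s / (s - 1) ^ (r + 1) -
      ∑ i ∈ Finset.range (r + 1), taylorRem φ (r - i) 1 / (s - 1) ^ (i + 1) =
      taylorRem φ (r + 1) s := by
  have h1 : s - 1 ≠ 0 := sub_ne_zero.2 hs
  have hreflect : ∑ i ∈ Finset.range (r + 1), taylorRem φ (r - i) 1 / (s - 1) ^ (i + 1) =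
      (∑ j ∈ Finset.range (r + 1), taylorRem φ j 1 * (s - 1) ^ j) / (s - 1) ^ (r + 1) := by
    rw [← Finset.sum_range_reflect, Finset.sum_div]
    refine Finset.sum_congr rfl fun i hi => ?_
    have hir : i ≤ r := Finset.mem_range_succ_iff.1 hi
    rw [Nat.add_sub_cancel, div_eq_div_iff (pow_ne_zero _ h1) (pow_ne_zero _ h1), mul_assoc,
      ← pow_add, Nat.sub_sub_self hir]
    congr 2
    lia
  rw [hreflect, eq_sum_add_taylorRem φ (r + 1) s, add_div, add_sub_cancel_left,
    mul_div_cancel_left₀ _ (pow_ne_zero _ h1)]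

/-- `(s - 1) ^ (r + 1)` times the Dirichlet series of `(r + 1) ^ ω(n)`. -/
noncomputable def regularSeries (r : ℕ) (s : ℂ) : ℂ :=
  riemannZeta₁ s ^ (r + 1) * cofactorSeries r s

theorem differentiableOn_regularSeries (r : ℕ) :
    DifferentiableOn ℂ (regularSeries r) {s | 1 / 2 < s.re} :=
  (differentiable_riemannZeta₁.pow _).differentiableOn.mul (differentiableOn_cofactorSeries r)

theorem regularSeries_div_pow (r : ℕ) {s : ℂ} (hs : s ≠ 1) :
    regularSeries r s / (s - 1) ^ (r + 1) = riemannZeta s ^ (r + 1) * cofactorSeries r s := by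
  have : s - 1 ≠ 0 := sub_ne_zero.2 hs
  rw [regularSeries, riemannZeta_eq_inv_sub_mul hs, mul_pow, inv_pow]
  field_simp

/-- The coefficient of `(s - 1) ^ (-(i + 1))` in the Laurent expansion of the Dirichlet series of
`(r + 1) ^ ω(n)` at `1`, for `i ≤ r`. -/
noncomputable def polarCoeff (r i : ℕ) : ℂ := taylorRem (regularSeries r) (r - i) 1

theorem polarCoeff_self (r : ℕ) :
    polarCoeff r r = ((∏' p : Nat.Primes, eulerFactor r p : ℝ) : ℂ) := by
  rw [polarCoeff, Nat.sub_self, ← cofactorSeries_one]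
  simp [taylorRem, regularSeries, riemannZeta₁_one]

/-- The Dirichlet series of `(r + 1) ^ ω(n)` minus its polar part at `1`. -/
noncomputable def regularPart (r : ℕ) : ℂ → ℂ := taylorRem (regularSeries r) (r + 1)

theorem differentiableOn_regularPart (r : ℕ) :
    DifferentiableOn ℂ (regularPart r) {s | 1 / 2 < s.re} :=
  differentiableOn_taylorRem ((isOpen_re_gt _).mem_nhds (by norm_num))
    (differentiableOn_regularSeries r) _

theorem regularPart_eq (r : ℕ) {s : ℂ} (hs : s ≠ 1) :
    regularPart r s = riemannZeta s ^ (r + 1) * cofactorSeries r s -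
      ∑ i ∈ Finset.range (r + 1), polarCoeff r i / (s - 1) ^ (i + 1) := by
  rw [← regularSeries_div_pow r hs]
  exact (div_pow_sub_sum_eq_taylorRem (regularSeries r) r hs).symm

theorem exists_norm_regularPart_le_zeta (r : ℕ) {σ : ℝ} (hσ : 1 / 2 < σ) :
    ∃ A B : ℝ, 0 ≤ A ∧ 0 ≤ B ∧ ∀ s : ℂ, σ ≤ s.re → 1 ≤ |s.im| →
      ‖regularPart r s‖ ≤ A * ‖riemannZeta s‖ ^ (r + 1) + B := by
  obtain ⟨C, hC, hcofactor⟩ := exists_norm_cofactorSeries_le r hσ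
  refine ⟨C, ∑ i ∈ Finset.range (r + 1), ‖polarCoeff r i‖, hC, by positivity,
    fun s hs him => ?_⟩
  have hnorm : 1 ≤ ‖s - 1‖ := him.trans (by simpa using abs_im_le_norm (s - 1))
  rw [regularPart_eq r (by rintro rfl; simp at him; linarith)]
  refine (norm_sub_le _ _).trans (add_le_add ?_ (norm_sum_le_of_le _ fun i _ => ?_))
  · rw [norm_mul, norm_pow, mul_comm]
    gcongr
    exact hcofactor s hs
  · rw [norm_div, norm_pow]
    exact div_le_self (norm_nonneg _) (one_le_pow₀ hnorm)

theorem exists_norm_regularPart_le_of_abs_im_le (r : ℕ) {σ : ℝ} (hσ : 1 / 2 < σ) (c : ℝ) :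
    ∃ D : ℝ, 0 ≤ D ∧ ∀ s : ℂ, σ ≤ s.re → s.re ≤ c → |s.im| ≤ 1 → ‖regularPart r s‖ ≤ D := by
  have hcompact : IsCompact (Icc σ c ×ℂ Icc (-1 : ℝ) 1) := isCompact_Icc.reProdIm isCompact_Icc
  obtain ⟨D, hD⟩ := hcompact.exists_bound_of_continuousOn
    ((differentiableOn_regularPart r).continuousOn.mono fun s hs => hσ.trans_le hs.1.1)
  exact ⟨max D 0, le_max_right _ _, fun s hs hsc him =>
    (hD s ⟨⟨hs, hsc⟩, abs_le.1 him⟩).trans (le_max_left _ _)⟩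

theorem exists_norm_regularPart_le_strip (r : ℕ) {σ : ℝ} (hσ : 1 / 2 < σ) (c : ℝ) :
    ∃ K : ℝ, 0 ≤ K ∧ ∀ s : ℂ, σ ≤ s.re → s.re ≤ c → ‖regularPart r s‖ ≤ K * ‖s‖ ^ (r + 1) := by
  obtain ⟨A, B, hA, hB, hfar⟩ := exists_norm_regularPart_le_zeta r hσ
  obtain ⟨D, hD, hnear⟩ := exists_norm_regularPart_le_of_abs_im_le r hσ c
  have : 0 < σ := by linarith
  refine ⟨A * 8 ^ (r + 1) + B + D / σ ^ (r + 1), by positivity, fun s hs hsc => ?_⟩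
  rcases le_total 1 |s.im| with him | him
  · have hzeta := norm_riemannZeta_le_of_one_le_abs_im (hσ.trans_le hs) him
    have hs1 : 1 ≤ ‖s‖ ^ (r + 1) := one_le_pow₀ (him.trans (abs_im_le_norm s))
    calc ‖regularPart r s‖ ≤ A * (8 * ‖s‖) ^ (r + 1) + B * ‖s‖ ^ (r + 1) := by
          refine (hfar s hs him).trans (add_le_add ?_ (le_mul_of_one_le_right hB hs1))
          gcongr
      _ = (A * 8 ^ (r + 1) + B) * ‖s‖ ^ (r + 1) := by rw [mul_pow]; ring
      _ ≤ _ := mul_le_mul_of_nonneg_right (le_add_of_nonneg_right (by positivity)) (by positivity)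
  · have hs1 : σ ^ (r + 1) ≤ ‖s‖ ^ (r + 1) := by
      gcongr
      exact hs.trans (re_le_norm s)
    calc ‖regularPart r s‖ ≤ D := hnear s hs hsc him
      _ = D / σ ^ (r + 1) * σ ^ (r + 1) := by field_simp
      _ ≤ (A * 8 ^ (r + 1) + B + D / σ ^ (r + 1)) * ‖s‖ ^ (r + 1) := by
          gcongr
          exact le_add_of_nonneg_left (by positivity)

theorem exists_norm_regularPart_le_line (r : ℕ) {σ : ℝ} (hσ : 1 / 2 < σ) (hσ1 : σ < 1) :
    ∃ K : ℝ, 0 ≤ K ∧ ∀ t : ℝ, ‖regularPart r (σ + t * I)‖ ≤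
      K * (1 + |t|) ^ (((r : ℝ) + 1) / 6) := by
  obtain ⟨A, B, hA, hB, hfar⟩ := exists_norm_regularPart_le_zeta r hσ
  obtain ⟨D, hD, hnear⟩ := exists_norm_regularPart_le_of_abs_im_le r hσ 1
  obtain ⟨C, hC, hzeta⟩ := exists_norm_riemannZeta_le hσ hσ1
  refine ⟨A * C ^ (r + 1) + B + D, by positivity, fun t => ?_⟩
  have hT : 1 ≤ (1 + |t|) ^ (((r : ℝ) + 1) / 6) :=
    Real.one_le_rpow (le_add_of_nonneg_right (abs_nonneg t)) (by positivity)
  have hpow : ((1 + |t|) ^ (1 / 6 : ℝ)) ^ (r + 1) = (1 + |t|) ^ (((r : ℝ) + 1) / 6) := by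
    rw [← Real.rpow_natCast, ← Real.rpow_mul (by positivity), one_div_mul_eq_div, Nat.cast_succ]
  have hre : ((σ : ℂ) + t * I).re = σ := by simp
  have him : ((σ : ℂ) + t * I).im = t := by simp
  rcases le_total 1 |t| with ht | ht
  · calc ‖regularPart r (σ + t * I)‖
        ≤ A * (C * (1 + |t|) ^ (1 / 6 : ℝ)) ^ (r + 1) + B * (1 + |t|) ^ (((r : ℝ) + 1) / 6) := by
          refine (hfar _ hre.ge (by rwa [him])).trans
            (add_le_add ?_ (le_mul_of_one_le_right hB hT))
          gcongr
          exact hzeta t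
      _ = (A * C ^ (r + 1) + B) * (1 + |t|) ^ (((r : ℝ) + 1) / 6) := by
          rw [mul_pow, hpow]; ring
      _ ≤ _ := mul_le_mul_of_nonneg_right (le_add_of_nonneg_right hD) (by positivity)
  · calc ‖regularPart r (σ + t * I)‖ ≤ D := hnear _ hre.ge (hre.trans_le hσ1.le) (by rwa [him])
      _ ≤ A * C ^ (r + 1) + B + D := le_add_of_nonneg_left (by positivity)
      _ ≤ _ := le_mul_of_one_le_right (by positivity) hT

end Pole

section Asymptotic

open Set Complex Polynomial Asymptotics

/-- The sum of `(r + 1) ^ ω(n)` over `n ≤ exp y`. -/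
noncomputable def omegaSummatory (r : ℕ) : ℝ → ℝ := logSummatory fun n => (omegaPow (r + 1) n : ℝ)

theorem monotone_omegaSummatory (r : ℕ) : Monotone (omegaSummatory r) :=
  monotone_logSummatory fun n => by exact_mod_cast omegaPow_nonneg _ n

theorem lseriesSummable_omegaPow (r : ℕ) {b : ℝ} (hb : 1 < b) :
    LSeriesSummable (fun n => ((omegaPow (r + 1) n : ℝ) : ℂ)) b := by
  simpa only [ofReal_intCast] using
    (LSeriesHasSum_omegaPow r (s := b) (by rwa [ofReal_re])).LSeriesSummable

theorem causalExpBound_omegaSummatory (r : ℕ) {b : ℝ} (hb : 1 < b) :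
    CausalExpBound b fun y => (omegaSummatory r y : ℂ) :=
  causalExpBound_logSummatory (fun n => by exact_mod_cast omegaPow_nonneg _ n) (by linarith)
    (lseriesSummable_omegaPow r hb)

theorem laplaceTransform_omegaSummatory (r : ℕ) {s : ℂ} (hs : 1 < s.re) :
    laplaceTransform (fun y => (omegaSummatory r y : ℂ)) s =
      riemannZeta s ^ (r + 1) * cofactorSeries r s / s := by
  obtain ⟨b, hb, hbs⟩ := exists_between hs
  rw [← (LSeriesHasSum_omegaPow r hs).LSeries_eq, omegaSummatory, laplaceTransform_logSummatory
    (fun n => by exact_mod_cast omegaPow_nonneg _ n) (by linarith)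
    (lseriesSummable_omegaPow r hb) hbs]
  simp only [ofReal_intCast]

/-- The main term of `omegaSummatory r`. -/
noncomputable def omegaMain (r : ℕ) : ℝ → ℂ := integralIic (mainDensity (polarCoeff r) (r + 1))

theorem causalExpBound_omegaSummatory_sub (r : ℕ) {b : ℝ} (hb : 1 < b) :
    CausalExpBound b fun y => (omegaSummatory r y : ℂ) - omegaMain r y :=
  (causalExpBound_omegaSummatory r hb).sub
    ((causalExpBound_mainDensity _ _ hb).integralIic (by linarith))

theorem laplaceTransform_omegaSummatory_sub (r : ℕ) {s : ℂ} (hs : 1 < s.re) :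
    laplaceTransform (fun y => (omegaSummatory r y : ℂ) - omegaMain r y) s =
      regularPart r s / s := by
  obtain ⟨b, hb, hbs⟩ := exists_between hs
  have hb0 : 0 < b := by linarith
  have hmain := causalExpBound_mainDensity (polarCoeff r) (r + 1) hb
  rw [omegaMain,
    (causalExpBound_omegaSummatory r hb).laplaceTransform_sub (hmain.integralIic hb0) hbs,
    laplaceTransform_omegaSummatory r hs, hmain.laplaceTransform_integralIic hb0 hbs,
    laplaceTransform_mainDensity _ _ hs, regularPart_eq r (by rintro rfl; simp at hs), sub_div]

theorem CausalExpBound.exists_abs_re_integralIic_sub_le {b : ℝ} (hb : 0 < b) {f : ℝ → ℂ}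
    (hf : CausalExpBound b f) : ∃ C : ℝ, 0 ≤ C ∧ ∀ y d v : ℝ, v ∈ Icc (y - d) (y + d) →
      |(integralIic f v).re - (integralIic f y).re| ≤ d * (C * Real.exp (b * (y + d))) := by
  obtain ⟨C, hC, hbound⟩ := hf.exists_norm_le
  refine ⟨C, hC, fun y d v hv => ?_⟩
  have hd : |v - y| ≤ d := abs_sub_le_iff.2 ⟨by linarith [hv.2], by linarith [hv.1]⟩
  have hd0 : 0 ≤ d := (abs_nonneg _).trans hd
  rw [← sub_re, hf.integralIic_sub hb y v]
  refine (abs_re_le_norm _).trans ?_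
  calc ‖∫ u in y..v, f u‖ ≤ C * Real.exp (b * (y + d)) * |v - y| := by
        refine intervalIntegral.norm_integral_le_of_norm_le_const fun u hu => (hbound u).trans ?_
        have : u ≤ y + d := (uIoc_subset_uIcc hu).2.trans (sup_le (by linarith) hv.2)
        gcongr
    _ ≤ d * (C * Real.exp (b * (y + d))) := by
        rw [mul_comm]
        gcongr

/-- The first term is the smoothing error, the second the contour integral. -/
theorem exists_abs_omegaSummatory_sub_le_smoothed (r : ℕ) {e : ℝ} (he : 0 < e) (he4 : e ≤ 1 / 4) :
    ∃ C D : ℝ, 0 ≤ C ∧ 0 ≤ D ∧ ∀ δ : ℝ, 0 < δ → δ ≤ 1 → ∀ y : ℝ,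
      |omegaSummatory r y - (omegaMain r y).re| ≤ D * δ * Real.exp ((1 + e) * y) +
        C * δ ^ (-(((r : ℝ) + 1) / 6 + e)) * Real.exp ((1 / 2 + e) * y) := by
  have hb : (1 : ℝ) < 1 + e := by linarith
  have hσ : 1 / 2 < 1 / 2 + e := by linarith
  obtain ⟨K, hK, hgK⟩ := exists_norm_regularPart_le_strip r hσ 3
  obtain ⟨K', hK', hgσ⟩ := exists_norm_regularPart_le_line r hσ (by linarith)
  have hE := causalExpBound_omegaSummatory_sub r hb
  obtain ⟨C, hC, hcontour⟩ := exists_norm_fwdDiff_iterate_integralIic_le (c := 3) (η := e)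
    (by linarith) (by linarith) (by linarith) (by linarith) (by linarith) hE
    (fun t => laplaceTransform_omegaSummatory_sub r (by simp))
    ((differentiableOn_regularPart r).mono fun s hs => hσ.trans_le hs.1)
    hK hgK hK' hgσ (by positivity) he (by push_cast; linarith)
  obtain ⟨D, hD, hmain⟩ := (causalExpBound_mainDensity (polarCoeff r) (r + 1)
    hb).exists_abs_re_integralIic_sub_le (by linarith)
  let m : ℕ := r + 1 + 1
  refine ⟨C, m * (D * Real.exp ((1 + e) * m)), hC, by positivity, fun δ hδ hδ1 y => ?_⟩
  refine (abs_sub_re_le_of_fwdDiff_iterate_le (m := m) (monotone_omegaSummatory r)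
    (by linarith) hE hδ (hmain y (m * δ)) (fun v hv => (hcontour δ hδ hδ1 v).trans
      (by gcongr; exact hv.2))).trans (add_le_add_left ?_ _)
  calc m * δ * (D * Real.exp ((1 + e) * (y + m * δ)))
      ≤ m * δ * (D * Real.exp ((1 + e) * (y + m * 1))) := by gcongr
    _ = _ := by
      rw [mul_one, mul_add, Real.exp_add]
      ring

theorem exists_abs_omegaSummatory_sub_le (r : ℕ) {ε : ℝ} (hε : 0 < ε) :
    ∃ C : ℝ, 0 ≤ C ∧ ∀ y : ℝ, 0 ≤ y → |omegaSummatory r y - (omegaMain r y).re| ≤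
      C * Real.exp ((1 - 3 / ((r : ℝ) + 7) + ε) * y) := by
  let e := min (ε / 2) (1 / 4)
  have he : 0 < e := by positivity
  have heε : e ≤ ε / 2 := min_le_left _ _
  let ρ : ℝ := 3 / ((r : ℝ) + 7)
  have : 0 < ρ := by positivity
  have hρ1 : ρ ≤ 1 := (div_le_one (by positivity)).2 (by linarith [r.cast_nonneg (α := ℝ)])
  have hbalance : ρ * (((r : ℝ) + 1) / 6) + 1 / 2 = 1 - ρ := by
    simp only [ρ]
    field_simp
    ring
  obtain ⟨C, D, hC, hD, hbound⟩ := exists_abs_omegaSummatory_sub_le_smoothed r he (min_le_right _ _)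
  refine ⟨D + C, by positivity, fun y hy => (hbound (Real.exp (-(ρ * y))) (Real.exp_pos _)
    (Real.exp_le_one_iff.2 (neg_nonpos.2 (by positivity))) y).trans ?_⟩
  rw [mul_assoc D, mul_assoc C, ← Real.exp_mul, ← Real.exp_add, ← Real.exp_add, add_mul D]
  gcongr
  · rw [← neg_mul, ← add_mul]
    exact mul_le_mul_of_nonneg_right (by linarith) hy
  · have hexponent : -(ρ * y) * -(((r : ℝ) + 1) / 6 + e) + (1 / 2 + e) * y =
        (ρ * (((r : ℝ) + 1) / 6) + 1 / 2 + (1 + ρ) * e) * y := by ring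
    rw [hexponent, hbalance]
    gcongr
    nlinarith

theorem abs_moebiusSqFloorSum_sub_le {r : ℕ} {P : ℝ[X]}
    (hP : P + derivative P = polarPoly (polarCoeff r) (r + 1)) {x B : ℝ} (hx : 1 ≤ x)
    (hB : |omegaSummatory r (Real.log x) - (omegaMain r (Real.log x)).re| ≤ B) :
    |(moebiusSqFloorSum r x : ℝ) - x * P.eval (Real.log x)| ≤ B + |P.eval 0| := by
  have hx0 : 0 < x := by linarith
  have hsum : (moebiusSqFloorSum r x : ℝ) = omegaSummatory r (Real.log x) := by
    rw [moebiusSqFloorSum_eq_sum_omegaPow r hx0.le, omegaSummatory, logSummatory,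
      Real.exp_log hx0, Int.cast_sum]
  rw [omegaMain, re_integralIic_mainDensity _ _ hP (Real.log_nonneg hx), Real.exp_log hx0,
    ← hsum] at hB
  calc |(moebiusSqFloorSum r x : ℝ) - x * P.eval (Real.log x)|
      = |(moebiusSqFloorSum r x - (x * P.eval (Real.log x) - P.eval 0)) - P.eval 0| := by
        congr 1
        ring
    _ ≤ _ := (abs_sub _ _).trans (by gcongr)

theorem isBigO_moebiusSqFloorSum_sub {r : ℕ} {P : ℝ[X]}
    (hP : P + derivative P = polarPoly (polarCoeff r) (r + 1)) {ε : ℝ} (hε : 0 < ε) :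
    (fun x : ℝ => (moebiusSqFloorSum r x : ℝ) - x * P.eval (Real.log x)) =O[Filter.atTop]
      fun x : ℝ => x ^ (1 - 3 / ((r : ℝ) + 7) + ε) := by
  obtain ⟨C, -, hbound⟩ := exists_abs_omegaSummatory_sub_le r hε
  refine .of_bound (C + |P.eval 0|) ?_
  filter_upwards [Filter.eventually_ge_atTop (1 : ℝ)] with x hx
  have hρ1 : 3 / ((r : ℝ) + 7) ≤ 1 :=
    (div_le_one (by positivity)).2 (by linarith [r.cast_nonneg (α := ℝ)])
  have hrpow : Real.exp ((1 - 3 / ((r : ℝ) + 7) + ε) * Real.log x) =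
      x ^ (1 - 3 / ((r : ℝ) + 7) + ε) := by
    rw [Real.rpow_def_of_pos (by linarith), mul_comm]
  have h1 : 1 ≤ x ^ (1 - 3 / ((r : ℝ) + 7) + ε) := Real.one_le_rpow hx (by linarith)
  rw [Real.norm_eq_abs, Real.norm_of_nonneg (zero_le_one.trans h1), add_mul, ← hrpow]
  refine (abs_moebiusSqFloorSum_sub_le hP hx (hbound _ (Real.log_nonneg hx))).trans ?_
  rw [hrpow]
  gcongr
  exact le_mul_of_one_le_right (abs_nonneg _) h1

end Asymptotic

theorem corollary1p5_general (r : ℕ) :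
    Multipliable (eulerFactor r) ∧
    ∃ P : Polynomial ℝ,
      P.natDegree = r ∧
      P.leadingCoeff = 1 / (r.factorial : ℝ) * ∏' p : Nat.Primes, eulerFactor r p ∧
      ∀ ε : ℝ, 0 < ε →
        Asymptotics.IsBigO Filter.atTop
          (fun x : ℝ => (moebiusSqFloorSum r x : ℝ) - x * P.eval (Real.log x))
          (fun x : ℝ => x ^ (1 - 3 / ((r : ℝ) + 7) + ε)) := by
  have hres : (polarCoeff r r).re = ∏' p : Nat.Primes, eulerFactor r p := by
    rw [polarCoeff_self, Complex.ofReal_re]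
  have hdeg : (polarPoly (polarCoeff r) (r + 1)).natDegree = r :=
    natDegree_polarPoly (hres ▸ tprod_eulerFactor_ne_zero r)
  obtain ⟨P, hP⟩ := exists_add_derivative_eq (polarPoly (polarCoeff r) (r + 1))
  refine ⟨(hasProd_eulerFactor r).multipliable, P, ?_, ?_,
    fun ε hε => isBigO_moebiusSqFloorSum_sub hP hε⟩
  · rw [← natDegree_add_derivative, hP, hdeg]
  · rw [← leadingCoeff_add_derivative, hP, Polynomial.leadingCoeff, hdeg,
      coeff_polarPoly _ r.lt_succ_self, hres, one_div_mul_eq_div]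

theorem corollary1p5 (r : ℕ) (hr : 2 ≤ r) :
    Multipliable (eulerFactor r) ∧
    ∃ P : Polynomial ℝ,
      P.natDegree = r ∧
      P.leadingCoeff = 1 / (r.factorial : ℝ) * ∏' p : Nat.Primes, eulerFactor r p ∧
      ∀ ε : ℝ, 0 < ε →
        Asymptotics.IsBigO Filter.atTop
          (fun x : ℝ => (moebiusSqFloorSum r x : ℝ) - x * P.eval (Real.log x))
          (fun x : ℝ => x ^ (1 - 3 / ((r : ℝ) + 7) + ε)) :=
  corollary1p5_general r
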